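/- Signatures are at most countable and contain at least one individual constant. Models are non-empty. A *constraint* is a finite conjunction of literals. $T\models\phi$ means that $\phi$ is true in every model of $T$ under every assignment. Different tuples of variables are disjoint. Let $T$ be a theory in a signature $\Sigma$. * $T$ is *convex* if, whenever $T\models\delta\to\bigvee_{i=1}^n x_i=y_i$ with $\delta$ a constraint, $x_i,y_i$ variables and $n\ge1$, then $T\models\delta\to x_i=y_i$ for some $i$. * $T$ is *stably infinite* if every constraint satisfiable in a model of $T$ is satisfiable in an infinite model of $T$. * $T$ is *equality interpolating* if, whenever $T\models\delta_1(\underline x,\underline z_1,y_1)\wedge\delta_2(\underline x,\underline z_2,y_2)\to y_1=y_2$ with $\delta_1,\delta_2$ constraints, there is a term $t(\underline x)$ with $T\models\delta_1\wedge\delta_2\to y_1=t(\underline x)\wedge y_2=t(\underline x)$. * A *model completion* of a universal theory $T$ is a theory $T^*\supseteq T$ in the same signature which has quantifier elimination and is such that every constraint satisfiable in a model of $T$ is satisfiable in a model of $T^*$. * A *$T$-cover* of $\exists\underline e\,\phi(\underline e,\underline y)$ ($\phi$ quantifier-free) is a quantifier-free $\psi(\underline y)$ with $T\models\phi\to\psi$,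 such that $T\models\psi\to\theta$ for every quantifier-free $\theta(\underline y,\underline z)$ with $T\models\phi(\underline e,\underline y)\to\theta(\underline y,\underline z)$. * A constraint $\phi(\underline x,\underline z)$ *implicitly defines* $z_i$ in $T$ if $T\models\phi(\underline x,\underline z)\wedge\phi(\underline x,\underline z')\to z_i=z_i'$. A term $t(\underline x)$ is a *Beth term* for it if $T\models\phi(\underline x,\underline z)\to z_i=t(\underline x)$. If $T$ has a model completion $T^*$, let $\mathtt{ImplDef}^T_{\phi,z_i}(\underline x)$ be a quantifier-free formula equivalent in $T^*$ to $\forall\underline z\,\forall\underline z'\,(\phi(\underline x,\underline z)\wedge\phi(\underline x,\underline z')\to z_i=z'_i)$. **Theorem.** Let $T_1,T_2$ be convex, stably infinite, equality interpolating universal theories over disjoint signatures $\Sigma_1,\Sigma_2$, each admitting a model completion, and let $T=T_1\cup T_2$. Then $T$ admits a model completion $T^*$, and every existential formula $\exists\underline e\,\phi(\underline e,\underline x)$ of $\Sigma_1\cup\Sigma_2$ ($\phi$ quantifier-free) has a $T$-cover. Call a formula $\exists\underline z\,\bigl(\bigwedge_i z_i=s_i(\underline x)\wedge\exists\underline e\,(\psi_1(\underline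 z,\underline e)\wedge\psi_2(\underline z,\underline e))\bigr)$, with $s_i$ terms of $\Sigma_1\cup\Sigma_2$ (possibly variables from $\underline x$) and $\psi_h$ a $\Sigma_h$-constraint that implies $e_i\ne e_j$ for $i\ne j$, a *terminal working formula* if $T_h\models\psi_h\to\neg\mathtt{ImplDef}^{T_h}_{\psi_h,e_i}(\underline z)$ for $h=1,2$ and all $i$. Then: 1. for every constraint $\phi$ of $\Sigma_1\cup\Sigma_2$, the formula $\exists\underline e\,\phi(\underline e,\underline x)$ is equivalent modulo $T$ to a finite disjunction of terminal working formulas; 2. if $\theta_h(\underline z)$ is a $T_h$-cover of $\exists\underline e\,\psi_h(\underline z,\underline e)$ for $h=1,2$, then $\theta_1(\underline s(\underline x))\wedge\theta_2(\underline s(\underline x))$ is a $T$-cover of the terminal working formula displayed above. Moreover this is effective. Fix numberings of the symbols of $\Sigma_1,\Sigma_2$ and the induced Gödel numberings of terms and formulas. Suppose that, for $h=1,2$, there are an algorithm computing $T_h$-covers of existential $\Sigma_h$-formulas and an algorithm that, on every $\Sigma_h$-constraint implicitly defining a given variable in $T_h$, computes a Beth term. Then there are algorithms that compute the decompositions in 1,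 $T$-covers of all existential formulas of $\Sigma_1\cup\Sigma_2$, and, for every formula of $\Sigma_1\cup\Sigma_2$, a quantifier-free formula equivalent to it in $T^*$. -/

import Mathlib

open FirstOrder

universe u v u₁ v₁ u₂ v₂

namespace Covers

open FirstOrder.Language FirstOrder.Language.BoundedFormula

section Basic

variable {L : FirstOrder.Language.{u, v}}

/-- A literal is an atom or the negation of an atom. -/
def IsLiteral {α : Type*} {k : ℕ} (φ : L.BoundedFormula α k) : Prop :=
  φ.IsAtomic ∨ ∃ ψ : L.BoundedFormula α k, ψ.IsAtomic ∧ φ = ψ.not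

/-- A constraint is a finite conjunction of literals (the empty conjunction is `⊤`). -/
inductive IsConstraint {α : Type*} {k : ℕ} : L.BoundedFormula α k → Prop
  | top : IsConstraint ⊤
  | literal {φ : L.BoundedFormula α k} (h : IsLiteral φ) : IsConstraint φ
  | inf {φ ψ : L.BoundedFormula α k} (hφ : IsConstraint φ) (hψ : IsConstraint ψ) :
      IsConstraint (φ ⊓ ψ)

/-- `φ` is satisfiable in a model of `T`. -/
def SatisfiableIn (T : L.Theory) {n : ℕ} (φ : L.Formula (Fin n)) : Prop :=
  ∃ (M : Theory.ModelType.{u, v, max u v} T) (x : Fin n → M), φ.Realize x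

/-- Every constraint satisfiable in a model of `T` is satisfiable in an infinite model of `T`. -/
def IsStablyInfinite (T : L.Theory) : Prop :=
  ∀ (n : ℕ) (δ : L.Formula (Fin n)), IsConstraint δ → SatisfiableIn T δ →
    ∃ (M : Theory.ModelType.{u, v, max u v} T) (x : Fin n → M), Infinite M ∧ δ.Realize x

/-- If a constraint implies modulo `T` a nonempty finite disjunction of equations between
variables, then it implies modulo `T` one of these equations. -/
def IsConvex (T : L.Theory) : Prop :=
  ∀ (n : ℕ) (δ : L.Formula (Fin n)), IsConstraint δ →
    ∀ l : List (Fin n × Fin n), l ≠ [] →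
      (∀ (M : Theory.ModelType.{u, v, max u v} T) (x : Fin n → M), δ.Realize x →
        ∃ p ∈ l, x p.1 = x p.2) →
      ∃ p ∈ l, ∀ (M : Theory.ModelType.{u, v, max u v} T) (x : Fin n → M), δ.Realize x →
        x p.1 = x p.2

/-- The equality interpolating condition. The constraint `δ₁` has the shared variables `x`
and the private variables `z₁`, one of which, with index `y₁`, is the distinguished one;
similarly for `δ₂`. -/
def IsEqualityInterpolating (T : L.Theory) : Prop :=
  ∀ (n k₁ k₂ : ℕ) (δ₁ : L.BoundedFormula (Fin n) k₁) (δ₂ : L.BoundedFormula (Fin n) k₂)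
    (y₁ : Fin k₁) (y₂ : Fin k₂), IsConstraint δ₁ → IsConstraint δ₂ →
    (∀ (M : Theory.ModelType.{u, v, max u v} T) (x : Fin n → M) (z₁ : Fin k₁ → M)
      (z₂ : Fin k₂ → M), δ₁.Realize x z₁ → δ₂.Realize x z₂ → z₁ y₁ = z₂ y₂) →
    ∃ t : L.Term (Fin n),
      ∀ (M : Theory.ModelType.{u, v, max u v} T) (x : Fin n → M) (z₁ : Fin k₁ → M)
        (z₂ : Fin k₂ → M), δ₁.Realize x z₁ → δ₂.Realize x z₂ →
          z₁ y₁ = t.realize x ∧ z₂ y₂ = t.realize x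

/-- `φ'` is a quantifier-free formula equivalent to `φ` modulo `T`. -/
def IsQFEquivalent (T : L.Theory) {n : ℕ} (φ φ' : L.Formula (Fin n)) : Prop :=
  φ'.IsQF ∧ T ⊨ᵇ φ.iff φ'

/-- Quantifier elimination. -/
def HasQE (T : L.Theory) : Prop :=
  ∀ (n : ℕ) (φ : L.Formula (Fin n)), ∃ φ' : L.Formula (Fin n), IsQFEquivalent T φ φ'

/-- `Tstar` is a model completion of the (universal) theory `T`. -/
structure IsModelCompletion (T Tstar : L.Theory) : Prop where
  subset : T ⊆ Tstar
  satisfiable : ∀ (n : ℕ) (δ : L.Formula (Fin n)), IsConstraint δ →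
    SatisfiableIn T δ → SatisfiableIn Tstar δ
  qe : HasQE Tstar

def HasModelCompletion (T : L.Theory) : Prop :=
  ∃ Tstar : L.Theory, IsModelCompletion T Tstar

/-- The quantifier-free formula `θ(y, z)` is a residue of `∃ e, φ(e, y)`. The variables `y` are
the `n` free variables, `e` are the `k` bound-variable slots of `φ`, `z` those of `θ`; since `e`
and `z` are disjoint, validity of `φ(e, y) → θ(y, z)` in `T` is validity of
`(∃ e, φ) → (∀ z, θ)`. -/
def IsResidue (T : L.Theory) {n k m : ℕ} (φ : L.BoundedFormula (Fin n) k)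
    (θ : L.BoundedFormula (Fin n) m) : Prop :=
  θ.IsQF ∧ T ⊨ᵇ φ.exs.imp θ.alls

/-- `ψ(y)` is a `T`-cover of `∃ e, φ(e, y)`. -/
def IsCover (T : L.Theory) {n k : ℕ} (φ : L.BoundedFormula (Fin n) k)
    (ψ : L.Formula (Fin n)) : Prop :=
  IsResidue T φ ψ ∧
    ∀ (m : ℕ) (θ : L.BoundedFormula (Fin n) m), IsResidue T φ θ → T ⊨ᵇ ψ.imp θ.alls

/-- Every existential formula has a `T`-cover (uniform quantifier-free interpolation). -/
def HasCovers (T : L.Theory) : Prop :=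
  ∀ (n k : ℕ) (φ : L.BoundedFormula (Fin n) k), φ.IsQF →
    ∃ ψ : L.Formula (Fin n), IsCover T φ ψ

/-- `φ(x, z)`, with all of `z` except `z i` existentially quantified, implicitly defines `z i`. -/
def ImplicitlyDefines (T : L.Theory) {n k : ℕ} (φ : L.BoundedFormula (Fin n) k) (i : Fin k) :
    Prop :=
  ∀ (M : Theory.ModelType.{u, v, max u v} T) (x : Fin n → M) (z z' : Fin k → M),
    φ.Realize x z → φ.Realize x z' → z i = z' i

/-- `φ(x, z)`, with all of `z` except `z i` existentially quantified, explicitly defines `z i`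
through the term `t(x)`. -/
def ExplicitlyDefines (T : L.Theory) {n k : ℕ} (φ : L.BoundedFormula (Fin n) k) (i : Fin k)
    (t : L.Term (Fin n)) : Prop :=
  ∀ (M : Theory.ModelType.{u, v, max u v} T) (x : Fin n → M) (z : Fin k → M),
    φ.Realize x z → z i = t.realize x

/-- `D(x)` is a quantifier-free formula which, in a model completion of `T`, is equivalent to
`∀ z z', φ(x, z) ∧ φ(x, z') → z i = z' i`. -/
def IsImplDef (T : L.Theory) {n k : ℕ} (φ : L.BoundedFormula (Fin n) k) (i : Fin k)
    (D : L.Formula (Fin n)) : Prop :=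
  D.IsQF ∧ ∃ Tstar : L.Theory, IsModelCompletion T Tstar ∧
    ∀ (M : Theory.ModelType.{u, v, max u v} Tstar) (x : Fin n → M),
      D.Realize x ↔ ∀ z z' : Fin k → M, φ.Realize x z → φ.Realize x z' → z i = z' i

/-- The constraint `φ(x, z)` forces the `z` to be pairwise distinct, and `φ` implies modulo `T`
that no `z i` is implicitly definable. -/
def IsTerminalFor (T : L.Theory) {n k : ℕ} (φ : L.BoundedFormula (Fin n) k) : Prop :=
  IsConstraint φ ∧
  (∀ (M : Theory.ModelType.{u, v, max u v} (∅ : L.Theory)) (x : Fin n → M) (z : Fin k → M),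
    φ.Realize x z → Function.Injective z) ∧
  ∀ i : Fin k, ∃ D : L.Formula (Fin n), IsImplDef T φ i D ∧ T ⊨ᵇ φ.exs.imp D.not

end Basic

section Combination

/-- The union of two theories over disjoint signatures, in the disjoint union of the
signatures. -/
def unionTheory {L₁ : FirstOrder.Language.{u₁, v₁}} {L₂ : FirstOrder.Language.{u₂, v₂}} (T₁ : L₁.Theory)
    (T₂ : L₂.Theory) : (L₁.sum L₂).Theory :=
  LHom.sumInl.onTheory T₁ ∪ LHom.sumInr.onTheory T₂

/-- A working formula `∃ z, (⋀ i, z i = terms i (x)) ∧ ∃ e, ψ₁(z, e) ∧ ψ₂(z, e)` with parameters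
`x`, defined variables `z` and existential variables `e`, where `ψ₁`, `ψ₂` are pure. The explicit
definitions are given in unravelled form, by terms of the combined signature in `x` alone; the
parameters are accessible to `ψ₁`, `ψ₂` through those `z i` whose term is a parameter. -/
structure WorkingFormula (L₁ : FirstOrder.Language.{u₁, v₁}) (L₂ : FirstOrder.Language.{u₂, v₂})
    (n : ℕ) where
  m : ℕ
  k : ℕ
  terms : Fin m → (L₁.sum L₂).Term (Fin n)
  ψ₁ : L₁.BoundedFormula (Fin m) k
  ψ₂ : L₂.BoundedFormula (Fin m) k

variable {L₁ : FirstOrder.Language.{u₁, v₁}} {L₂ : FirstOrder.Language.{u₂, v₂}} {n : ℕ}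

/-- The conjunction of a pure formula of each signature, with the explicit definitions of a
working formula substituted for the defined variables. -/
def WorkingFormula.combine (W : WorkingFormula L₁ L₂ n) {l : ℕ}
    (θ₁ : L₁.BoundedFormula (Fin W.m) l) (θ₂ : L₂.BoundedFormula (Fin W.m) l) :
    (L₁.sum L₂).BoundedFormula (Fin n) l :=
  (LHom.sumInl.onBoundedFormula θ₁).subst W.terms ⊓
    (LHom.sumInr.onBoundedFormula θ₂).subst W.terms

/-- The quantifier-free matrix of a working formula, after elimination of the defined
variables. -/
def WorkingFormula.matrix (W : WorkingFormula L₁ L₂ n) :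
    (L₁.sum L₂).BoundedFormula (Fin n) W.k :=
  W.combine W.ψ₁ W.ψ₂

def WorkingFormula.IsTerminal (T₁ : L₁.Theory) (T₂ : L₂.Theory) (W : WorkingFormula L₁ L₂ n) :
    Prop :=
  IsTerminalFor T₁ W.ψ₁ ∧ IsTerminalFor T₂ W.ψ₂

/-- `Ws` is a finite list of terminal working formulas whose disjunction is equivalent to
`∃ e, φ(e, x)` modulo the union of the theories. -/
def IsTerminalDecomposition (T₁ : L₁.Theory) (T₂ : L₂.Theory) {k : ℕ}
    (φ : (L₁.sum L₂).BoundedFormula (Fin n) k) (Ws : List (WorkingFormula L₁ L₂ n)) : Prop :=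
  (∀ W ∈ Ws, W.IsTerminal T₁ T₂) ∧
    unionTheory T₁ T₂ ⊨ᵇ φ.exs.iff ((Ws.map fun W => W.matrix.exs).foldr (· ⊔ ·) ⊥)

end Combination

section Effective

/-- A numbering of the function symbols and of the relation symbols of a signature. -/
structure SymbolCoding (L : FirstOrder.Language.{u, v}) where
  func : (Σ n, L.Functions n) → ℕ
  rel : (Σ n, L.Relations n) → ℕ
  func_injective : Function.Injective func
  rel_injective : Function.Injective rel

/-- The induced numbering of the symbols of a disjoint union of signatures: even numbers for the
first signature, odd numbers for the second one. -/
def SymbolCoding.sum {L₁ : FirstOrder.Language.{u₁, v₁}} {L₂ : FirstOrder.Language.{u₂, v₂}}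
    (c₁ : SymbolCoding L₁) (c₂ : SymbolCoding L₂) : SymbolCoding (L₁.sum L₂) where
  func
    | ⟨n, Sum.inl f⟩ => 2 * c₁.func ⟨n, f⟩
    | ⟨n, Sum.inr f⟩ => 2 * c₂.func ⟨n, f⟩ + 1
  rel
    | ⟨n, Sum.inl R⟩ => 2 * c₁.rel ⟨n, R⟩
    | ⟨n, Sum.inr R⟩ => 2 * c₂.rel ⟨n, R⟩ + 1
  func_injective := by
    rintro ⟨n, f | f⟩ ⟨m, g | g⟩ h <;> simp only at h
    · have := c₁.func_injective (by omega : c₁.func ⟨n, f⟩ = c₁.func ⟨m, g⟩)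
      cases this; rfl
    · omega
    · omega
    · have := c₂.func_injective (by omega : c₂.func ⟨n, f⟩ = c₂.func ⟨m, g⟩)
      cases this; rfl
  rel_injective := by
    rintro ⟨n, f | f⟩ ⟨m, g | g⟩ h <;> simp only at h
    · have := c₁.rel_injective (by omega : c₁.rel ⟨n, f⟩ = c₁.rel ⟨m, g⟩)
      cases this; rfl
    · omega
    · omega
    · have := c₂.rel_injective (by omega : c₂.rel ⟨n, f⟩ = c₂.rel ⟨m, g⟩)
      cases this; rfl

variable {L : FirstOrder.Language.{u, v}}

/-- Gödel numbers of terms. -/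
def codeTerm (c : SymbolCoding L) {α : Type*} [Encodable α] : L.Term α → ℕ
  | Term.var a => Nat.pair 0 (Encodable.encode a)
  | Term.func f ts => Nat.pair 1
      (Nat.pair (c.func ⟨_, f⟩) (Encodable.encode (List.ofFn fun i => codeTerm c (ts i))))

/-- Gödel numbers of formulas. -/
def codeFormula (c : SymbolCoding L) {α : Type*} [Encodable α] :
    {k : ℕ} → L.BoundedFormula α k → ℕ
  | _, BoundedFormula.falsum => Nat.pair 0 0
  | _, BoundedFormula.equal t₁ t₂ => Nat.pair 1 (Nat.pair (codeTerm c t₁) (codeTerm c t₂))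
  | _, BoundedFormula.rel R ts => Nat.pair 2
      (Nat.pair (c.rel ⟨_, R⟩) (Encodable.encode (List.ofFn fun i => codeTerm c (ts i))))
  | _, BoundedFormula.imp φ ψ => Nat.pair 3 (Nat.pair (codeFormula c φ) (codeFormula c ψ))
  | _, BoundedFormula.all φ => Nat.pair 4 (codeFormula c φ)

/-- Some algorithm terminates on every existential formula `∃ e, φ(e, y)` (given by the lengths
`n`, `k` of `y`, `e` and the Gödel number of `φ`) and outputs a `T`-cover of it. -/
def HasComputableCovers (c : SymbolCoding L) (T : L.Theory) : Prop :=
  ∃ f : ℕ × ℕ × ℕ →. ℕ, Partrec f ∧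
    ∀ (n k : ℕ) (φ : L.BoundedFormula (Fin n) k), φ.IsQF →
      ∃ ψ : L.Formula (Fin n), IsCover T φ ψ ∧ codeFormula c ψ ∈ f (n, k, codeFormula c φ)

/-- Some algorithm terminates on every constraint `φ(x, z)` that implicitly defines `z i`, and
outputs a term explicitly defining it. Nothing is required on other inputs. -/
def HasComputableBethTerms (c : SymbolCoding L) (T : L.Theory) : Prop :=
  ∃ f : ℕ × ℕ × ℕ × ℕ →. ℕ, Partrec f ∧
    ∀ (n k : ℕ) (φ : L.BoundedFormula (Fin n) k) (i : Fin k), IsConstraint φ →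
      ImplicitlyDefines T φ i →
        ∃ t : L.Term (Fin n), ExplicitlyDefines T φ i t ∧
          codeTerm c t ∈ f (n, k, (i : ℕ), codeFormula c φ)

/-- Some algorithm eliminates quantifiers modulo `T`. -/
def HasComputableQE (c : SymbolCoding L) (T : L.Theory) : Prop :=
  ∃ f : ℕ × ℕ →. ℕ, Partrec f ∧
    ∀ (n : ℕ) (φ : L.Formula (Fin n)),
      ∃ φ' : L.Formula (Fin n), IsQFEquivalent T φ φ' ∧
        codeFormula c φ' ∈ f (n, codeFormula c φ)

/-- Gödel numbers of working formulas. -/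
def codeWorkingFormula {L₁ : FirstOrder.Language.{u₁, v₁}} {L₂ : FirstOrder.Language.{u₂, v₂}}
    (c₁ : SymbolCoding L₁) (c₂ : SymbolCoding L₂) {n : ℕ} (W : WorkingFormula L₁ L₂ n) : ℕ :=
  Encodable.encode [W.m, W.k,
    Encodable.encode (List.ofFn fun i => codeTerm (c₁.sum c₂) (W.terms i)),
    codeFormula c₁ W.ψ₁, codeFormula c₂ W.ψ₂]

/-- Some algorithm rewrites every existential formula `∃ e, φ(e, x)`, with `φ` a constraint of the
combined signature, into a disjunction of terminal working formulas. -/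
def HasComputableTerminalDecompositions {L₁ : FirstOrder.Language.{u₁, v₁}}
    {L₂ : FirstOrder.Language.{u₂, v₂}} (c₁ : SymbolCoding L₁) (c₂ : SymbolCoding L₂)
    (T₁ : L₁.Theory) (T₂ : L₂.Theory) : Prop :=
  ∃ f : ℕ × ℕ × ℕ →. ℕ, Partrec f ∧
    ∀ (n k : ℕ) (φ : (L₁.sum L₂).BoundedFormula (Fin n) k), IsConstraint φ →
      ∃ Ws : List (WorkingFormula L₁ L₂ n), IsTerminalDecomposition T₁ T₂ φ Ws ∧
        Encodable.encode (Ws.map (codeWorkingFormula c₁ c₂)) ∈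
          f (n, k, codeFormula (c₁.sum c₂) φ)

end Effective

end Covers

-- Covers have a semantic description: a quantifier-free ψ is a cover of ∃e φ iff φ implies ψ modulo
-- T and every tuple satisfying ψ in a model M of T satisfies ∃e φ in some extension of M that is a
-- model of T (`isCover_of_extension`, `IsCover.exists_extension`; the second uses compactness and
-- the diagram of M). For universal T, a model completion gives covers, since the quantifier-free
-- equivalent of ∃e φ in it is one. Conversely, if all covers exist, T together with the axioms ψ →
-- ∃e φ is a model completion (`isModelCompletion_coverTheory`): the limit of a chain of extensions
-- that realize more and more existential formulas satisfies the axioms, and these eliminate one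
-- quantifier at a time. So everything reduces to covers for the union.
--
-- Terminal formulas. Let θ₁ and θ₂ hold at the values a of the terms in M. In each signature ψ_h is
-- realized by elements outside M in an infinite extension (`exists_fresh_extension`). Otherwise a
-- finite part of the diagram together with ψ_h implies a disjunction of equations between some e_i
-- and elements of M; convexity selects one of them, and equality interpolation turns it into a
-- definition e_i = t(a), against ¬ImplDef. Löwenheim–Skolem brings both extensions to one
-- cardinality. As the e_i are new and distinct, both structures can be placed on the same carrier M
-- + {e_i} + K, and, the signatures being disjoint, they form one model of the union
-- (`isCover_combine`).
--
-- Decomposition. A conjunction of literals is purified by naming all its subterms, once for every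
-- pattern of equalities among them (`exists_holds_purify`). Let C_i be a cover of "ψ_h has two
-- realizations that differ at e_i"; in the model completion it is equivalent to ¬ImplDef. Where
-- some C_i fails, ψ_h implicitly defines e_i, and a Beth term moves e_i to the defined variables.
-- Where all C_i hold, ψ_h is terminal (`exists_conv_cSplits`). The number of existential variables
-- drops with each definition, so the process stops (`exists_conv_cLoop`).
--
-- Effectivity. The procedure is written on Gödel numbers, primitive recursively in a fuel parameter
-- and in fuel-bounded oracles for covers and Beth terms; `Conv` expresses convergence as fuel
-- grows. Correctness is proved once, for arbitrary oracles. Oracles obtained by choice give the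
-- existence statements, and computable ones give the algorithms.

universe w w'

-- Closure rules for primitive recursion, collected for automation.

attribute [fun_prop] Primrec

namespace PrimrecRules

section
variable {α β γ σ τ : Type*} [Primcodable α] [Primcodable β] [Primcodable γ] [Primcodable σ]
  [Primcodable τ]

@[fun_prop] theorem id' : Primrec (fun a : α => a) := Primrec.id
@[fun_prop] theorem const' (b : β) : Primrec (fun _ : α => b) := Primrec.const b
@[fun_prop] theorem comp' {f : β → γ} {g : α → β} (hf : Primrec f) (hg : Primrec g) :
    Primrec (fun a => f (g a)) := hf.comp hg
@[fun_prop] theorem fst {f : α → β × γ} (hf : Primrec f) : Primrec (fun a => (f a).1) :=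
  Primrec.fst.comp hf
@[fun_prop] theorem snd {f : α → β × γ} (hf : Primrec f) : Primrec (fun a => (f a).2) :=
  Primrec.snd.comp hf
@[fun_prop] theorem mk {f : α → β} {g : α → γ} (hf : Primrec f) (hg : Primrec g) :
    Primrec (fun a => (f a, g a)) := hf.pair hg
@[fun_prop] theorem add {f g : α → ℕ} (hf : Primrec f) (hg : Primrec g) :
    Primrec (fun a => f a + g a) := Primrec.nat_add.comp hf hg
@[fun_prop] theorem sub {f g : α → ℕ} (hf : Primrec f) (hg : Primrec g) :
    Primrec (fun a => f a - g a) := Primrec.nat_sub.comp hf hg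
@[fun_prop] theorem mul {f g : α → ℕ} (hf : Primrec f) (hg : Primrec g) :
    Primrec (fun a => f a * g a) := Primrec.nat_mul.comp hf hg
@[fun_prop] theorem div {f g : α → ℕ} (hf : Primrec f) (hg : Primrec g) :
    Primrec (fun a => f a / g a) := Primrec.nat_div.comp hf hg
@[fun_prop] theorem mod {f g : α → ℕ} (hf : Primrec f) (hg : Primrec g) :
    Primrec (fun a => f a % g a) := Primrec.nat_mod.comp hf hg
@[fun_prop] theorem natPair {f g : α → ℕ} (hf : Primrec f) (hg : Primrec g) :
    Primrec (fun a => Nat.pair (f a) (g a)) := Primrec₂.natPair.comp hf hg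
@[fun_prop] theorem unpair {f : α → ℕ} (hf : Primrec f) :
    Primrec (fun a => Nat.unpair (f a)) := Primrec.unpair.comp hf
@[fun_prop] theorem encode {f : α → β} (hf : Primrec f) :
    Primrec (fun a => Encodable.encode (f a)) := Primrec.encode.comp hf
@[fun_prop] theorem ofNatList {f : α → ℕ} (hf : Primrec f) :
    Primrec (fun a => Denumerable.ofNat (List ℕ) (f a)) := (Primrec.ofNat (List ℕ)).comp hf
@[fun_prop] theorem some {f : α → β} (hf : Primrec f) : Primrec (fun a => Option.some (f a)) :=
  Primrec.option_some.comp hf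
@[fun_prop] theorem optionBind {f : α → Option β} {g : α → β → Option σ} (hf : Primrec f)
    (hg : Primrec (fun p : α × β => g p.1 p.2)) : Primrec (fun a => (f a).bind (g a)) :=
  Primrec.option_bind hf hg
@[fun_prop] theorem optionMap {f : α → Option β} {g : α → β → σ} (hf : Primrec f)
    (hg : Primrec (fun p : α × β => g p.1 p.2)) : Primrec (fun a => (f a).map (g a)) :=
  Primrec.option_map hf hg
@[fun_prop] theorem cons {f : α → β} {g : α → List β} (hf : Primrec f) (hg : Primrec g) :
    Primrec (fun a => f a :: g a) := Primrec.list_cons.comp hf hg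
@[fun_prop] theorem append {f g : α → List β} (hf : Primrec f) (hg : Primrec g) :
    Primrec (fun a => f a ++ g a) := Primrec.list_append.comp hf hg
@[fun_prop] theorem listMap {f : α → List β} {g : α → β → σ} (hf : Primrec f)
    (hg : Primrec (fun p : α × β => g p.1 p.2)) : Primrec (fun a => (f a).map (g a)) :=
  Primrec.list_map hf hg
@[fun_prop] theorem flatMap {f : α → List β} {g : α → β → List σ} (hf : Primrec f)
    (hg : Primrec (fun p : α × β => g p.1 p.2)) : Primrec (fun a => (f a).flatMap (g a)) :=
  Primrec.list_flatMap hf hg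
@[fun_prop] theorem flatten {f : α → List (List β)} (hf : Primrec f) :
    Primrec (fun a => (f a).flatten) := Primrec.list_flatten.comp hf
@[fun_prop] theorem length {f : α → List β} (hf : Primrec f) :
    Primrec (fun a => (f a).length) := Primrec.list_length.comp hf
@[fun_prop] theorem listGetD {f : α → List β} {n : α → ℕ} {d : β} (hf : Primrec f)
    (hn : Primrec n) : Primrec (fun a => (f a).getD (n a) d) :=
  (Primrec.list_getD d).comp hf hn
@[fun_prop] theorem listGet? {f : α → List β} {n : α → ℕ} (hf : Primrec f)
    (hn : Primrec n) : Primrec (fun a => (f a)[n a]?) :=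
  Primrec.list_getElem?.comp hf hn
@[fun_prop] theorem listIdxOf {f : α → ℕ} {l : α → List ℕ} (hf : Primrec f)
    (hl : Primrec l) : Primrec (fun a => List.idxOf (f a) (l a)) :=
  Primrec.list_idxOf.comp hf hl
@[fun_prop] theorem range {f : α → ℕ} (hf : Primrec f) :
    Primrec (fun a => List.range (f a)) := Primrec.list_range.comp hf
@[fun_prop] theorem foldr {l : α → List β} {h : α → β → σ → σ} {z : α → σ} (hl : Primrec l)
    (hh : Primrec (fun p : α × β × σ => h p.1 p.2.1 p.2.2)) (hz : Primrec z) :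
    Primrec (fun a => (l a).foldr (h a) (z a)) :=
  Primrec.list_foldr hl hz (h := fun a p => h a p.1 p.2) hh
@[fun_prop] theorem iterate {n : α → ℕ} {g : α → β} {h : α → β → β} (hn : Primrec n)
    (hg : Primrec g) (hh : Primrec (fun p : α × β => h p.1 p.2)) :
    Primrec (fun a => (h a)^[n a] (g a)) := Primrec.nat_iterate hn hg hh
@[fun_prop] theorem iteEq {x y : α → ℕ} {f g : α → σ} (hx : Primrec x) (hy : Primrec y)
    (hf : Primrec f) (hg : Primrec g) : Primrec (fun a => if x a = y a then f a else g a) :=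
  Primrec.ite (Primrec.eq.comp hx hy) hf hg
@[fun_prop] theorem iteLt {x y : α → ℕ} {f g : α → σ} (hx : Primrec x) (hy : Primrec y)
    (hf : Primrec f) (hg : Primrec g) : Primrec (fun a => if x a < y a then f a else g a) :=
  Primrec.ite (Primrec.nat_lt.comp hx hy) hf hg

end

end PrimrecRules

namespace Covers

open FirstOrder.Language FirstOrder.Language.BoundedFormula

/-! ### Fuel-bounded computations and their relation to partial recursive functions. -/

section Conv

/-- A fuel-bounded computation never returns anything but `y`, and returns `y` given enough
fuel. -/
def Conv {β : Type*} (F : ℕ → Option β) (y : β) : Prop :=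
  (∀ s, F s = none ∨ F s = some y) ∧ ∃ s₀, ∀ s, s₀ ≤ s → F s = some y

variable {α β γ : Type*}

theorem Conv.const (y : β) : Conv (fun _ => some y) y := ⟨fun _ => Or.inr rfl, 0, fun _ _ => rfl⟩

/-- The second computation matters only at `x`, since the first never returns anything else; the
maximum of the two fuel bounds suffices. -/
theorem Conv.bind {F : ℕ → Option α} {G : ℕ → α → Option β} {x : α} {y : β} (hF : Conv F x)
    (hG : Conv (fun s => G s x) y) : Conv (fun s => (F s).bind (G s)) y := by
  obtain ⟨h1, s1, h2⟩ := hF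
  obtain ⟨h3, s2, h4⟩ := hG
  refine ⟨fun s => ?_, max s1 s2, fun s hs => ?_⟩
  · rcases h1 s with h | h
    · simp [h]
    · simpa [h] using h3 s
  · have := h2 s (le_trans (le_max_left _ _) hs)
    simpa [this] using h4 s (le_trans (le_max_right _ _) hs)

theorem Conv.map {F : ℕ → Option α} {x : α} (g : α → β) (hF : Conv F x) :
    Conv (fun s => (F s).map g) (g x) := by
  have := hF.bind (G := fun _ a => some (g a)) (Conv.const (g x))
  refine ⟨fun s => ?_, ?_⟩
  · simpa [Option.map_eq_bind, Function.comp_def] using this.1 s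
  · simpa [Option.map_eq_bind, Function.comp_def] using this.2

/-- Apply a partial function to all entries of a list. -/
def optMapM (f : α → Option β) (l : List α) : Option (List β) :=
  l.foldr (fun a r => (f a).bind fun b => r.map fun bs => b :: bs) (some [])

theorem Conv.optMapM {ι : Type*} {F : ℕ → α → Option β} (l : List ι) (x : ι → α) (y : ι → β)
    (h : ∀ i ∈ l, Conv (fun s => F s (x i)) (y i)) :
    Conv (fun s => optMapM (F s) (l.map x)) (l.map y) := by
  induction l with
  | nil => exact Conv.const _
  | cons i l ih =>
    have h1 := h i (by simp)
    have h2 := ih fun j hj => h j (by simp [hj])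
    exact h1.bind (G := fun s b => (Covers.optMapM (F s) (l.map x)).map fun bs => b :: bs)
      (h2.map _)

@[fun_prop] theorem primrec_optMapM [Primcodable α] [Primcodable β] [Primcodable γ]
    {f : γ → α → Option β} {l : γ → List α} (hf : Primrec fun p : γ × α => f p.1 p.2)
    (hl : Primrec l) : Primrec fun c => optMapM (f c) (l c) := by
  unfold optMapM
  fun_prop

/-- Search for the least fuel with an answer. No monotonicity in the fuel is needed, because `Conv`
excludes wrong answers at every fuel. -/
theorem exists_partrec_of_conv [Primcodable α] [Primcodable β] {A : ℕ → α → Option β}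
    (hA : Primrec fun p : ℕ × α => A p.1 p.2) :
    ∃ f : α →. β, Partrec f ∧ ∀ x y, Conv (fun s => A s x) y → y ∈ f x := by
  refine ⟨fun x => Nat.rfindOpt fun s => A s x, ?_, fun x y h => ?_⟩
  · refine Partrec.rfindOpt ?_
    exact (Primrec.to_comp (hA.comp (Primrec.snd.pair Primrec.fst)) : _)
  · obtain ⟨h1, s, h2⟩ := h
    have hd : (Nat.rfindOpt fun s => A s x).Dom := Nat.rfindOpt_dom.2 ⟨s, y, h2 s le_rfl⟩
    obtain ⟨s', hs'⟩ := Nat.rfindOpt_spec (Part.get_mem hd)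
    rcases h1 s' with h | h
    · simp [h] at hs'
    · simp only at h
      rw [h] at hs'
      simp only [Option.mem_def, Option.some.injEq] at hs'
      rw [hs']
      exact Part.get_mem hd

/-- The step-bounded universal evaluator is primitive recursive, sound and monotone in its bound; it
turns a partial recursive oracle into a total function of the fuel. -/
theorem exists_fuel_of_partrec [Primcodable α] {f : α →. ℕ} (hf : Partrec f) :
    ∃ A : ℕ → α → Option ℕ, (Primrec fun p : ℕ × α => A p.1 p.2) ∧
      ∀ x y, y ∈ f x → Conv (fun s => A s x) y := by
  obtain ⟨c, hc⟩ := Nat.Partrec.Code.exists_code.1 hf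
  refine ⟨fun s x => Nat.Partrec.Code.evaln s c (Encodable.encode x), ?_, fun x y h => ?_⟩
  · exact Nat.Partrec.Code.primrec_evaln.comp
      ((Primrec.fst.pair (Primrec.const c)).pair (Primrec.encode.comp Primrec.snd))
  · have h' : y ∈ c.eval (Encodable.encode x) := by
      rw [hc]
      simpa using h
    obtain ⟨s0, hs0⟩ := Nat.Partrec.Code.evaln_complete.1 h'
    refine ⟨fun s => ?_, s0, fun s hs => Nat.Partrec.Code.evaln_mono hs hs0⟩
    rcases hv : Nat.Partrec.Code.evaln s c (Encodable.encode x) with _ | z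
    · exact Or.inl hv
    · right
      refine Eq.trans hv ?_
      have := Nat.Partrec.Code.evaln_sound (by exact hv : z ∈ Nat.Partrec.Code.evaln s c _)
      rw [Part.mem_unique this h']

end Conv

/-! ### Structural recursion on Gödel numbers. -/

section CodeFolds

theorem lt_encode_of_mem {d : ℕ} {l : List ℕ} (h : d ∈ l) : d < Encodable.encode l := by
  induction l with
  | nil => simp at h
  | cons a l ih =>
    rw [Encodable.encode_list_cons]
    have h1 := Nat.left_le_pair a (Encodable.encode l)
    have h2 := Nat.right_le_pair a (Encodable.encode l)
    rcases List.mem_cons.1 h with rfl | h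
    · exact Nat.lt_succ_of_le h1
    · exact Nat.lt_succ_of_le ((ih h).le.trans h2)

theorem lt_of_mem_ofNat {d n : ℕ} (h : d ∈ Denumerable.ofNat (List ℕ) n) : d < n := by
  simpa using lt_encode_of_mem h

theorem lt_of_mem_args {c d : ℕ}
    (h : d ∈ Denumerable.ofNat (List ℕ) c.unpair.2.unpair.2) : d < c :=
  (lt_of_mem_ofNat h).trans_le ((Nat.unpair_right_le _).trans (Nat.unpair_right_le _))

/-- Termination of `formFold`: a pair is at least the sum of its components, so a nonzero tag makes
it exceed its second component. -/
theorem unpair_right_lt_of_left_ne_zero {c : ℕ} (h : c.unpair.1 ≠ 0) : c.unpair.2 < c := by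
  rcases (Nat.unpair_right_le c).lt_or_eq with h' | h'
  · exact h'
  · exfalso
    have h1 := Nat.pair_unpair c
    rw [h'] at h1
    have h2 := Nat.add_le_pair c.unpair.1 c
    omega

variable {σ : Type*}

/-- Structural recursion over Gödel numbers of terms. -/
def termFold (V : ℕ → σ) (F : ℕ → List (ℕ × σ) → σ) (c : ℕ) : σ :=
  if c.unpair.1 = 0 then V c.unpair.2
  else F c.unpair.2.unpair.1
    ((Denumerable.ofNat (List ℕ) c.unpair.2.unpair.2).attach.map
      fun d : {d : ℕ // d ∈ Denumerable.ofNat (List ℕ) c.unpair.2.unpair.2} =>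
        (d.1, termFold V F d.1))
termination_by c
decreasing_by exact lt_of_mem_args d.2

theorem termFold_eq (V : ℕ → σ) (F : ℕ → List (ℕ × σ) → σ) (c : ℕ) :
    termFold V F c = if c.unpair.1 = 0 then V c.unpair.2
      else F c.unpair.2.unpair.1
        ((Denumerable.ofNat (List ℕ) c.unpair.2.unpair.2).map fun d => (d, termFold V F d)) := by
  rw [termFold]
  congr 2
  simp

-- Course-of-values recursion: `hist` lists the values at all smaller codes, so its length is the
-- current code, and each argument code, being smaller, is found in it.
@[fun_prop] theorem primrec_termFold {P : Type*} [Primcodable P] [Primcodable σ] {V : P → ℕ → σ}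
    {F : P → ℕ → List (ℕ × σ) → σ} {c : P → ℕ} (hV : Primrec fun p : P × ℕ => V p.1 p.2)
    (hF : Primrec fun p : P × ℕ × List (ℕ × σ) => F p.1 p.2.1 p.2.2) (hc : Primrec c) :
    Primrec fun p => termFold (V p) (F p) (c p) := by
  have key : Primrec₂ fun (p : P) (c : ℕ) => termFold (V p) (F p) c := by
    refine Primrec.nat_strong_rec _ (g := fun p hist =>
      if hist.length.unpair.1 = 0 then some (V p hist.length.unpair.2)
      else (optMapM (fun d => hist[d]?.map fun r => (d, r))
        (Denumerable.ofNat (List ℕ) hist.length.unpair.2.unpair.2)).map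
          (F p hist.length.unpair.2.unpair.1)) ?_ fun p n => ?_
    · have hV' : Primrec fun q : P × List σ => V q.1 q.2.length.unpair.2 :=
        hV.comp (g := fun q : P × List σ => (q.1, q.2.length.unpair.2)) (by fun_prop)
      have hF' : Primrec fun q : (P × List σ) × List (ℕ × σ) =>
          F q.1.1 q.1.2.length.unpair.2.unpair.1 q.2 :=
        hF.comp (g := fun q : (P × List σ) × List (ℕ × σ) =>
          (q.1.1, q.1.2.length.unpair.2.unpair.1, q.2)) (by fun_prop)
      show Primrec fun q : P × List σ => _
      fun_prop
    · rw [termFold_eq]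
      simp only [List.length_map, List.length_range]
      split_ifs
      · rfl
      · have : ∀ l : List ℕ, (∀ d ∈ l, d < n) →
            optMapM (fun d => ((List.range n).map (termFold (V p) (F p)))[d]?.map
              fun r => (d, r)) l = some (l.map fun d => (d, termFold (V p) (F p) d)) := by
          intro l
          induction l with
          | nil => intro; rfl
          | cons a l ih =>
            intro h
            have h1 := ih fun d hd => h d (by simp [hd])
            have h2 := h a (by simp)
            rw [optMapM, List.foldr_cons]
            change Option.bind _ (fun b => Option.map _ (optMapM _ l)) = _
            rw [h1]
            simp [h2]
        rw [this _ fun d hd => lt_of_mem_args hd]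
        rfl
  exact key.comp Primrec.id hc

/-- Structural recursion over Gödel numbers of formulas. -/
def formFold (B : σ) (E : ℕ → ℕ → σ) (R : ℕ → List ℕ → σ) (I : σ → σ → σ) (A : σ → σ) (c : ℕ) :
    σ :=
  if h0 : c.unpair.1 = 0 then B
  else if c.unpair.1 = 1 then E c.unpair.2.unpair.1 c.unpair.2.unpair.2
  else if c.unpair.1 = 2 then
    R c.unpair.2.unpair.1 (Denumerable.ofNat (List ℕ) c.unpair.2.unpair.2)
  else if c.unpair.1 = 3 then
    have := unpair_right_lt_of_left_ne_zero h0
    have _h1 := (Nat.unpair_left_le c.unpair.2).trans_lt this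
    have _h2 := (Nat.unpair_right_le c.unpair.2).trans_lt this
    I (formFold B E R I A c.unpair.2.unpair.1) (formFold B E R I A c.unpair.2.unpair.2)
  else
    have := unpair_right_lt_of_left_ne_zero h0
    A (formFold B E R I A c.unpair.2)
termination_by c

@[fun_prop] theorem primrec_formFold {P : Type*} [Primcodable P] [Primcodable σ] {B : P → σ}
    {E : P → ℕ → ℕ → σ} {R : P → ℕ → List ℕ → σ} {I : P → σ → σ → σ} {A : P → σ → σ} {c : P → ℕ}
    (hB : Primrec B) (hE : Primrec fun p : P × ℕ × ℕ => E p.1 p.2.1 p.2.2)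
    (hR : Primrec fun p : P × ℕ × List ℕ => R p.1 p.2.1 p.2.2)
    (hI : Primrec fun p : P × σ × σ => I p.1 p.2.1 p.2.2)
    (hA : Primrec fun p : P × σ => A p.1 p.2) (hc : Primrec c) :
    Primrec fun p => formFold (B p) (E p) (R p) (I p) (A p) (c p) := by
  have key : Primrec₂ fun (p : P) (c : ℕ) => formFold (B p) (E p) (R p) (I p) (A p) c := by
    refine Primrec.nat_strong_rec _ (g := fun p hist =>
      if hist.length.unpair.1 = 0 then some (B p)
      else if hist.length.unpair.1 = 1 then
        some (E p hist.length.unpair.2.unpair.1 hist.length.unpair.2.unpair.2)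
      else if hist.length.unpair.1 = 2 then
        some (R p hist.length.unpair.2.unpair.1
          (Denumerable.ofNat (List ℕ) hist.length.unpair.2.unpair.2))
      else if hist.length.unpair.1 = 3 then
        hist[hist.length.unpair.2.unpair.1]?.bind fun x =>
          hist[hist.length.unpair.2.unpair.2]?.map fun y => I p x y
      else hist[hist.length.unpair.2]?.map fun x => A p x) ?_ fun p n => ?_
    · have hE' : Primrec fun q : P × List σ =>
          E q.1 q.2.length.unpair.2.unpair.1 q.2.length.unpair.2.unpair.2 :=
        hE.comp (g := fun q : P × List σ =>
          (q.1, q.2.length.unpair.2.unpair.1, q.2.length.unpair.2.unpair.2)) (by fun_prop)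
      have hR' : Primrec fun q : P × List σ => R q.1 q.2.length.unpair.2.unpair.1
          (Denumerable.ofNat (List ℕ) q.2.length.unpair.2.unpair.2) :=
        hR.comp (g := fun q : P × List σ => (q.1, q.2.length.unpair.2.unpair.1,
          Denumerable.ofNat (List ℕ) q.2.length.unpair.2.unpair.2)) (by fun_prop)
      have hI' : Primrec fun q : ((P × List σ) × σ) × σ => I q.1.1.1 q.1.2 q.2 :=
        hI.comp (g := fun q : ((P × List σ) × σ) × σ => (q.1.1.1, q.1.2, q.2)) (by fun_prop)
      have hA' : Primrec fun q : (P × List σ) × σ => A q.1.1 q.2 :=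
        hA.comp (g := fun q : (P × List σ) × σ => (q.1.1, q.2)) (by fun_prop)
      show Primrec fun q : P × List σ => _
      fun_prop
    · rw [formFold]
      simp only [List.length_map, List.length_range]
      split_ifs with h0 h1 h2 h3
      · rfl
      · rfl
      · rfl
      · have := unpair_right_lt_of_left_ne_zero h0
        have h1 := (Nat.unpair_left_le n.unpair.2).trans_lt this
        have h2 := (Nat.unpair_right_le n.unpair.2).trans_lt this
        simp [h1, h2]
      · have := unpair_right_lt_of_left_ne_zero h0
        simp [this]
  exact key.comp Primrec.id hc

end CodeFolds

/-! ### Gödel numbers of terms and formulas, and their injectivity. -/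

section Codes

/-- Gödel number of a variable. -/
def cVar (v : ℕ) : ℕ := Nat.pair 0 v
/-- Gödel number of an application of a function symbol. -/
def cFun (f : ℕ) (l : List ℕ) : ℕ := Nat.pair 1 (Nat.pair f (Encodable.encode l))
/-- Gödel number of falsity. -/
def cFalsum : ℕ := Nat.pair 0 0
/-- Gödel number of an equation. -/
def cEq (a b : ℕ) : ℕ := Nat.pair 1 (Nat.pair a b)
/-- Gödel number of a relational atom. -/
def cRel (R : ℕ) (l : List ℕ) : ℕ := Nat.pair 2 (Nat.pair R (Encodable.encode l))
/-- Gödel number of an implication. -/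
def cImp (a b : ℕ) : ℕ := Nat.pair 3 (Nat.pair a b)
/-- Gödel number of a universal quantification. -/
def cAll (a : ℕ) : ℕ := Nat.pair 4 a
/-- Gödel number of a negation. -/
def cNot (a : ℕ) : ℕ := cImp a cFalsum
/-- Gödel number of a conjunction. -/
def cAnd (a b : ℕ) : ℕ := cNot (cImp a (cNot b))
/-- Gödel number of a disjunction. -/
def cOr (a b : ℕ) : ℕ := cImp (cNot a) b
/-- Gödel number of truth. -/
def cTop : ℕ := cNot cFalsum
/-- Gödel number of a finite conjunction. -/
def cConj (l : List ℕ) : ℕ := l.foldr (fun a b => cAnd a b) cTop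
/-- Gödel number of a finite disjunction. -/
def cDisj (l : List ℕ) : ℕ := l.foldr (fun a b => cOr a b) cFalsum

section
variable {α : Type*} [Primcodable α] {f g : α → ℕ} {l : α → List ℕ}

@[fun_prop] theorem primrec_cVar (hf : Primrec f) : Primrec fun a => cVar (f a) := by
  unfold cVar; fun_prop
@[fun_prop] theorem primrec_cFun (hf : Primrec f) (hl : Primrec l) :
    Primrec fun a => cFun (f a) (l a) := by unfold cFun; fun_prop
@[fun_prop] theorem primrec_cEq (hf : Primrec f) (hg : Primrec g) :
    Primrec fun a => cEq (f a) (g a) := by unfold cEq; fun_prop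
@[fun_prop] theorem primrec_cRel (hf : Primrec f) (hl : Primrec l) :
    Primrec fun a => cRel (f a) (l a) := by unfold cRel; fun_prop
@[fun_prop] theorem primrec_cImp (hf : Primrec f) (hg : Primrec g) :
    Primrec fun a => cImp (f a) (g a) := by unfold cImp; fun_prop
@[fun_prop] theorem primrec_cNot (hf : Primrec f) : Primrec fun a => cNot (f a) := by
  unfold cNot; fun_prop
@[fun_prop] theorem primrec_cAnd (hf : Primrec f) (hg : Primrec g) :
    Primrec fun a => cAnd (f a) (g a) := by unfold cAnd; fun_prop
@[fun_prop] theorem primrec_cOr (hf : Primrec f) (hg : Primrec g) :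
    Primrec fun a => cOr (f a) (g a) := by unfold cOr; fun_prop
@[fun_prop] theorem primrec_cConj (hl : Primrec l) : Primrec fun a => cConj (l a) := by
  unfold cConj; fun_prop
@[fun_prop] theorem primrec_cDisj (hl : Primrec l) : Primrec fun a => cDisj (l a) := by
  unfold cDisj; fun_prop
end

section
variable {σ : Type*} (V : ℕ → σ) (F : ℕ → List (ℕ × σ) → σ) (B : σ) (E : ℕ → ℕ → σ)
  (R : ℕ → List ℕ → σ) (I : σ → σ → σ) (A : σ → σ)

@[simp] theorem termFold_cVar (v : ℕ) : termFold V F (cVar v) = V v := by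
  rw [termFold_eq]; simp [cVar]
@[simp] theorem termFold_cFun (f : ℕ) (l : List ℕ) :
    termFold V F (cFun f l) = F f (l.map fun d => (d, termFold V F d)) := by
  rw [termFold_eq]; simp [cFun]
@[simp] theorem formFold_cFalsum : formFold B E R I A cFalsum = B := by
  rw [formFold]; simp [cFalsum]
@[simp] theorem formFold_cEq (a b : ℕ) : formFold B E R I A (cEq a b) = E a b := by
  rw [formFold]; simp [cEq]
@[simp] theorem formFold_cRel (a : ℕ) (l : List ℕ) :
    formFold B E R I A (cRel a l) = R a l := by
  rw [formFold]; simp [cRel]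
@[simp] theorem formFold_cImp (a b : ℕ) :
    formFold B E R I A (cImp a b) = I (formFold B E R I A a) (formFold B E R I A b) := by
  rw [formFold]; simp [cImp]
@[simp] theorem formFold_cAll (a : ℕ) :
    formFold B E R I A (cAll a) = A (formFold B E R I A a) := by
  rw [formFold]; simp [cAll]
end

variable {L : FirstOrder.Language.{u, v}} (c : SymbolCoding L) {α : Type*} [Encodable α] {k : ℕ}

@[simp] theorem codeTerm_var (a : α) :
    codeTerm c (Term.var a : L.Term α) = cVar (Encodable.encode a) := by
  simp [codeTerm, cVar]
@[simp] theorem codeTerm_func {l : ℕ} (f : L.Functions l) (ts : Fin l → L.Term α) :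
    codeTerm c (Term.func f ts) =
      cFun (c.func ⟨l, f⟩) (List.ofFn fun i => codeTerm c (ts i)) := by
  simp [codeTerm, cFun]
@[simp] theorem codeFormula_falsum :
    codeFormula c (falsum : L.BoundedFormula α k) = cFalsum := by simp [codeFormula, cFalsum]
@[simp] theorem codeFormula_bot :
    codeFormula c (⊥ : L.BoundedFormula α k) = cFalsum := codeFormula_falsum c
@[simp] theorem codeFormula_equal (t₁ t₂ : L.Term (α ⊕ Fin k)) :
    codeFormula c (equal t₁ t₂) = cEq (codeTerm c t₁) (codeTerm c t₂) := by
  simp [codeFormula, cEq]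
@[simp] theorem codeFormula_rel {l : ℕ} (R : L.Relations l) (ts : Fin l → L.Term (α ⊕ Fin k)) :
    codeFormula c (rel R ts) =
      cRel (c.rel ⟨l, R⟩) (List.ofFn fun i => codeTerm c (ts i)) := by
  simp [codeFormula, cRel]
@[simp] theorem codeFormula_imp (φ ψ : L.BoundedFormula α k) :
    codeFormula c (φ.imp ψ) = cImp (codeFormula c φ) (codeFormula c ψ) := by
  simp [codeFormula, cImp]
@[simp] theorem codeFormula_all (φ : L.BoundedFormula α (k + 1)) :
    codeFormula c φ.all = cAll (codeFormula c φ) := by simp [codeFormula, cAll]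
@[simp] theorem codeFormula_not (φ : L.BoundedFormula α k) :
    codeFormula c φ.not = cNot (codeFormula c φ) := by
  rw [BoundedFormula.not, codeFormula_imp, codeFormula_bot, cNot]
@[simp] theorem codeFormula_top :
    codeFormula c (⊤ : L.BoundedFormula α k) = cTop := by
  change codeFormula c (BoundedFormula.not ⊥) = _
  simp [cTop]
@[simp] theorem codeFormula_inf (φ ψ : L.BoundedFormula α k) :
    codeFormula c (φ ⊓ ψ) = cAnd (codeFormula c φ) (codeFormula c ψ) := by
  change codeFormula c (BoundedFormula.not (φ.imp ψ.not)) = _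
  simp [cAnd]
@[simp] theorem codeFormula_sup (φ ψ : L.BoundedFormula α k) :
    codeFormula c (φ ⊔ ψ) = cOr (codeFormula c φ) (codeFormula c ψ) := by
  change codeFormula c (φ.not.imp ψ) = _
  simp [cOr]

/-- Finite conjunction. -/
def conj (l : List (L.BoundedFormula α k)) : L.BoundedFormula α k := l.foldr (· ⊓ ·) ⊤
/-- Finite disjunction. -/
def disj (l : List (L.BoundedFormula α k)) : L.BoundedFormula α k := l.foldr (· ⊔ ·) ⊥

theorem codeFormula_conj (l : List (L.BoundedFormula α k)) :
    codeFormula c (conj l) = cConj (l.map (codeFormula c)) := by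
  induction l with
  | nil => simp [conj, cConj]
  | cons a l ih => simp_all [conj, cConj]

theorem codeFormula_disj (l : List (L.BoundedFormula α k)) :
    codeFormula c (disj l) = cDisj (l.map (codeFormula c)) := by
  induction l with
  | nil => simp [disj, cDisj]
  | cons a l ih => simp_all [disj, cDisj]

/-- Symbol numbers determine the arity as well as the symbol, so the argument lists can be compared
entrywise. This identifies a term by its position in a list of codes. -/
theorem codeTerm_injective : Function.Injective (codeTerm c : L.Term α → ℕ) := by
  intro t
  induction t with
  | var a =>
    rintro (b | ⟨g, us⟩) h
    · simpa [cVar] using h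
    · simp [cVar, cFun] at h
  | @func l f ts ih =>
    rintro (b | ⟨g, us⟩) h
    · simp [cVar, cFun] at h
    · rename_i l'
      simp only [codeTerm_func, cFun, Nat.pair_eq_pair, true_and] at h
      obtain ⟨h1, h2⟩ := h
      have h1 := c.func_injective h1
      have h2 := Encodable.encode_injective h2
      obtain ⟨rfl, h1⟩ := Sigma.mk.inj h1
      cases h1
      congr 1
      funext i
      exact ih i (congrFun (List.ofFn_injective h2) i)

/-- For a fixed number of bound slots a code determines the formula; hence oracles chosen on
formulas are well defined as functions of codes. -/
theorem codeFormula_injective : Function.Injective (codeFormula c : L.BoundedFormula α k → ℕ) := by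
  intro φ
  induction φ with
  | falsum =>
    intro ψ h
    cases ψ <;> first | rfl | simp [cFalsum, cEq, cRel, cImp, cAll] at h
  | equal t₁ t₂ =>
    intro ψ h
    cases ψ <;> first | simp [cFalsum, cEq, cRel, cImp, cAll] at h
    rw [codeTerm_injective c h.1, codeTerm_injective c h.2]
  | rel R ts =>
    intro ψ h
    cases ψ <;> first | simp [cFalsum, cEq, cRel, cImp, cAll] at h
    obtain ⟨h1, h2⟩ := h
    have h1 := c.rel_injective h1
    obtain ⟨rfl, h1⟩ := Sigma.mk.inj h1
    cases h1
    congr 1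
    funext i
    exact codeTerm_injective c (congrFun (List.ofFn_injective h2) i)
  | imp φ₁ φ₂ ih₁ ih₂ =>
    intro ψ h
    cases ψ <;> first | simp [cFalsum, cEq, cRel, cImp, cAll] at h
    rw [ih₁ h.1, ih₂ h.2]
  | all φ ih =>
    intro ψ h
    cases ψ <;> first | simp [cFalsum, cEq, cRel, cImp, cAll] at h
    rw [ih h]

end Codes

/-! ### Change of signature with simultaneous substitution. -/

section Translation

variable {L : FirstOrder.Language.{u₁, v₁}} {L' : FirstOrder.Language.{u₂, v₂}} {α β : Type*}

/-- Translate a term along a language map and substitute terms for its variables. -/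
def transTerm (g : L →ᴸ L') (σ : α → L'.Term β) (t : L.Term α) : L'.Term β :=
  (g.onTerm t).subst σ

@[simp] theorem realize_transTerm {M : Type*} [L.Structure M] [L'.Structure M] (g : L →ᴸ L')
    [g.IsExpansionOn M] (σ : α → L'.Term β) (t : L.Term α) (v : β → M) :
    (transTerm g σ t).realize v = t.realize fun a => (σ a).realize v := by
  simp [transTerm]

/-- Translate a quantifier-free formula along a language map and substitute terms for its
variables (quantified subformulas are discarded). -/
def transQF (g : L →ᴸ L') {l : ℕ} : {k : ℕ} → (α ⊕ Fin k → L'.Term (β ⊕ Fin l)) →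
    L.BoundedFormula α k → L'.BoundedFormula β l
  | _, _, falsum => falsum
  | _, σ, equal t₁ t₂ => equal (transTerm g σ t₁) (transTerm g σ t₂)
  | _, σ, rel R ts => rel (g.onRelation R) fun i => transTerm g σ (ts i)
  | _, σ, imp φ ψ => imp (transQF g σ φ) (transQF g σ ψ)
  | _, _, all _ => falsum

variable (g : L →ᴸ L') {k l : ℕ} (σ : α ⊕ Fin k → L'.Term (β ⊕ Fin l))

theorem realize_transQF {M : Type*} [L.Structure M] [L'.Structure M] [g.IsExpansionOn M]
    {φ : L.BoundedFormula α k} (hφ : φ.IsQF) (x : β → M) (z : Fin l → M) :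
    (transQF g σ φ).Realize x z ↔
      φ.Realize (fun a => (σ (Sum.inl a)).realize (Sum.elim x z))
        (fun j => (σ (Sum.inr j)).realize (Sum.elim x z)) := by
  have key : (Sum.elim (fun a => (σ (Sum.inl a)).realize (Sum.elim x z))
        (fun j => (σ (Sum.inr j)).realize (Sum.elim x z))) =
        fun a => (σ a).realize (Sum.elim x z) := by
    funext a; rcases a with a | a <;> rfl
  induction hφ with
  | falsum => rfl
  | of_isAtomic h =>
    cases h with
    | equal t₁ t₂ =>
      simp only [Term.bdEqual, transQF, Realize, realize_transTerm, key]
    | rel R ts =>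
      simp only [Relations.boundedFormula, transQF, Realize, realize_transTerm, key,
        LHom.map_onRelation]
  | imp h₁ h₂ ih₁ ih₂ => simp only [transQF, realize_imp, ih₁, ih₂]

theorem isQF_transQF {φ : L.BoundedFormula α k} (hφ : φ.IsQF) : (transQF g σ φ).IsQF := by
  induction hφ with
  | falsum => exact IsQF.falsum
  | of_isAtomic h =>
    cases h with
    | equal t₁ t₂ => exact (IsAtomic.equal _ _).isQF
    | rel R ts => exact (IsAtomic.rel _ _).isQF
  | imp h₁ h₂ ih₁ ih₂ => exact ih₁.imp ih₂

theorem isAtomic_transQF {φ : L.BoundedFormula α k} (hφ : φ.IsAtomic) :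
    (transQF g σ φ).IsAtomic := by
  cases hφ with
  | equal t₁ t₂ => exact IsAtomic.equal _ _
  | rel R ts => exact IsAtomic.rel _ _

theorem isLiteral_transQF {φ : L.BoundedFormula α k} (hφ : IsLiteral φ) :
    IsLiteral (transQF g σ φ) := by
  rcases hφ with h | ⟨ψ, h, rfl⟩
  · exact Or.inl (isAtomic_transQF g σ h)
  · exact Or.inr ⟨_, isAtomic_transQF g σ h, rfl⟩

theorem isConstraint_transQF {φ : L.BoundedFormula α k} (hφ : IsConstraint φ) :
    IsConstraint (transQF g σ φ) := by
  induction hφ with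
  | top => exact IsConstraint.top
  | literal h => exact IsConstraint.literal (isLiteral_transQF g σ h)
  | inf h₁ h₂ ih₁ ih₂ => exact IsConstraint.inf ih₁ ih₂

/-- The language map `g` acts on symbol numbers as `f ↦ a * f + b`. -/
def Tracks (g : L →ᴸ L') (c : SymbolCoding L) (c' : SymbolCoding L') (a b : ℕ) : Prop :=
  (∀ (n : ℕ) (f : L.Functions n), c'.func ⟨n, g.onFunction f⟩ = a * c.func ⟨n, f⟩ + b) ∧
  ∀ (n : ℕ) (R : L.Relations n), c'.rel ⟨n, g.onRelation R⟩ = a * c.rel ⟨n, R⟩ + b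

theorem tracks_id (c : SymbolCoding L) : Tracks (LHom.id L) c c 1 0 := by
  constructor <;> intros <;> simp [LHom.id]

theorem tracks_inl (c : SymbolCoding L) (c' : SymbolCoding L') :
    Tracks (LHom.sumInl : L →ᴸ L.sum L') c (c.sum c') 2 0 :=
  ⟨fun _ _ => rfl, fun _ _ => rfl⟩

theorem tracks_inr (c : SymbolCoding L) (c' : SymbolCoding L') :
    Tracks (LHom.sumInr : L' →ᴸ L.sum L') c' (c.sum c') 2 1 :=
  ⟨fun _ _ => rfl, fun _ _ => rfl⟩

/-- `transTerm` on Gödel numbers. -/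
def cTransTerm (a b : ℕ) (V : ℕ → ℕ) (t : ℕ) : ℕ :=
  termFold V (fun f l => cFun (a * f + b) (l.map fun p => p.2)) t

/-- `transQF` on Gödel numbers. -/
def cTransQF (a b : ℕ) (V : ℕ → ℕ) (φ : ℕ) : ℕ :=
  formFold cFalsum (fun s t => cEq (cTransTerm a b V s) (cTransTerm a b V t))
    (fun R l => cRel (a * R + b) (l.map fun t => cTransTerm a b V t)) (fun p q => cImp p q)
    (fun _ => cFalsum) φ

@[fun_prop] theorem primrec_cTransTerm {P : Type*} [Primcodable P] {a b : ℕ} {V : P → ℕ → ℕ}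
    {t : P → ℕ} (hV : Primrec fun p : P × ℕ => V p.1 p.2) (ht : Primrec t) :
    Primrec fun p => cTransTerm a b (V p) (t p) := by
  unfold cTransTerm
  fun_prop

@[fun_prop] theorem primrec_cTransQF {P : Type*} [Primcodable P] {a b : ℕ} {V : P → ℕ → ℕ}
    {t : P → ℕ} (hV : Primrec fun p : P × ℕ => V p.1 p.2) (ht : Primrec t) :
    Primrec fun p => cTransQF a b (V p) (t p) := by
  have h1 {Q : Type _} [Primcodable Q] (f : Q → P) (g : Q → ℕ) (hf : Primrec f) (hg : Primrec g) :
      Primrec fun q => V (f q) (g q) := hV.comp (hf.pair hg)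
  unfold cTransQF
  have h2 : Primrec fun p : (P × ℕ × ℕ) × ℕ => V p.1.1 p.2 := h1 _ _ (by fun_prop) (by fun_prop)
  have h3 : Primrec fun p : ((P × ℕ × List ℕ) × ℕ) × ℕ => V p.1.1.1 p.2 :=
    h1 _ _ (by fun_prop) (by fun_prop)
  fun_prop

variable [Encodable α] [Encodable β] {g} {c : SymbolCoding L} {c' : SymbolCoding L'} {a b : ℕ}
  {V : ℕ → ℕ}

theorem codeTerm_transTerm (h : Tracks g c c' a b) {σ : α → L'.Term β}
    (hV : ∀ x, codeTerm c' (σ x) = V (Encodable.encode x)) (t : L.Term α) :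
    codeTerm c' (transTerm g σ t) = cTransTerm a b V (codeTerm c t) := by
  induction t with
  | var x => simp [transTerm, cTransTerm, hV, LHom.onTerm]
  | func f ts ih =>
    simp only [transTerm, cTransTerm, LHom.onTerm, Term.subst, codeTerm_func, h.1,
      termFold_cFun, List.map_ofFn, Function.comp_def] at ih ⊢
    simp only [ih]

theorem codeFormula_transQF (h : Tracks g c c' a b) {σ : α ⊕ Fin k → L'.Term (β ⊕ Fin l)}
    (hV : ∀ x, codeTerm c' (σ x) = V (Encodable.encode x)) {φ : L.BoundedFormula α k}
    (hφ : φ.IsQF) :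
    codeFormula c' (transQF g σ φ) = cTransQF a b V (codeFormula c φ) := by
  induction hφ with
  | falsum => simp [transQF, cTransQF]
  | of_isAtomic hA =>
    cases hA with
    | equal t₁ t₂ => simp [transQF, cTransQF, Term.bdEqual, codeTerm_transTerm h hV]
    | rel R ts =>
      simp [transQF, cTransQF, Relations.boundedFormula, codeTerm_transTerm h hV, h.2,
        List.map_ofFn, Function.comp_def]
  | imp h₁ h₂ ih₁ ih₂ => simp_all [transQF, cTransQF]

end Translation

/-! ### Constraints and disjunctive normal forms. -/

section NormalForm

variable {L : FirstOrder.Language.{u, v}} {α : Type*} {k : ℕ}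

theorem IsLiteral.isQF {φ : L.BoundedFormula α k} (h : IsLiteral φ) : φ.IsQF := by
  rcases h with h | ⟨ψ, h, rfl⟩
  · exact h.isQF
  · exact h.isQF.not

theorem IsConstraint.isQF {φ : L.BoundedFormula α k} (h : IsConstraint φ) : φ.IsQF := by
  induction h with
  | top => exact IsQF.top
  | literal h => exact h.isQF
  | inf _ _ h₁ h₂ => exact h₁.inf h₂

theorem realize_conj {M : Type*} [L.Structure M] (l : List (L.BoundedFormula α k)) (x : α → M)
    (z : Fin k → M) : (conj l).Realize x z ↔ ∀ φ ∈ l, φ.Realize x z :=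
  realize_foldr_inf l x z

theorem realize_disj {M : Type*} [L.Structure M] (l : List (L.BoundedFormula α k)) (x : α → M)
    (z : Fin k → M) : (disj l).Realize x z ↔ ∃ φ ∈ l, φ.Realize x z :=
  realize_foldr_sup l x z

theorem isConstraint_conj {l : List (L.BoundedFormula α k)} (h : ∀ φ ∈ l, IsConstraint φ) :
    IsConstraint (conj l) := by
  induction l with
  | nil => exact IsConstraint.top
  | cons a l ih =>
    exact IsConstraint.inf (h a (by simp)) (ih fun φ hφ => h φ (by simp [hφ]))

theorem isQF_conj {l : List (L.BoundedFormula α k)} (h : ∀ φ ∈ l, φ.IsQF) : (conj l).IsQF := by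
  induction l with
  | nil => exact IsQF.top
  | cons a l ih => exact (h a (by simp)).inf (ih fun φ hφ => h φ (by simp [hφ]))

theorem isQF_disj {l : List (L.BoundedFormula α k)} (h : ∀ φ ∈ l, φ.IsQF) : (disj l).IsQF := by
  induction l with
  | nil => exact isQF_bot
  | cons a l ih => exact (h a (by simp)).sup (ih fun φ hφ => h φ (by simp [hφ]))

/-- Disjunctive normal forms of a quantifier-free formula and of its negation, as lists of lists
of literals. -/
def dnf : {k : ℕ} → L.BoundedFormula α k →
    List (List (L.BoundedFormula α k)) × List (List (L.BoundedFormula α k))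
  | _, falsum => ([], [ [] ])
  | _, equal s t => ([ [equal s t] ], [ [(equal s t).not] ])
  | _, rel R ts => ([ [rel R ts] ], [ [(rel R ts).not] ])
  | _, imp φ ψ => ((dnf φ).2 ++ (dnf ψ).1,
      (dnf φ).1.flatMap fun a => (dnf ψ).2.map fun b => a ++ b)
  | _, all _ => ([], [])

/-- A formula and its negation are treated together because the antecedent of an implication occurs
negatively. -/
theorem realize_dnf {M : Type*} [L.Structure M] {φ : L.BoundedFormula α k} (hφ : φ.IsQF)
    (x : α → M) (z : Fin k → M) :
    (φ.Realize x z ↔ ∃ ls ∈ (dnf φ).1, ∀ ψ ∈ ls, ψ.Realize x z) ∧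
      (¬ φ.Realize x z ↔ ∃ ls ∈ (dnf φ).2, ∀ ψ ∈ ls, ψ.Realize x z) := by
  induction hφ with
  | falsum => simp [dnf, Realize]
  | of_isAtomic hA =>
    cases hA with
    | equal t₁ t₂ => simp [dnf, Term.bdEqual]
    | rel R ts => simp [dnf, Relations.boundedFormula]
  | imp h₁ h₂ ih₁ ih₂ =>
    constructor
    · simp only [dnf, realize_imp, List.mem_append, or_and_right, exists_or, ← ih₂.1, ← ih₁.2]
      tauto
    · rw [realize_imp, Classical.not_imp, ih₁.1, ih₂.2]
      simp only [dnf, List.mem_flatMap, List.mem_map]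
      constructor
      · rintro ⟨⟨a, ha, ha'⟩, b, hb, hb'⟩
        refine ⟨_, ⟨a, ha, b, hb, rfl⟩, fun ψ hψ => ?_⟩
        rcases List.mem_append.1 hψ with h | h
        exacts [ha' _ h, hb' _ h]
      · rintro ⟨_, ⟨a, ha, b, hb, rfl⟩, h⟩
        exact ⟨⟨a, ha, fun ψ hψ => h ψ (by simp [hψ])⟩, b, hb, fun ψ hψ => h ψ (by simp [hψ])⟩

theorem isLiteral_of_mem_dnf {φ : L.BoundedFormula α k} :
    (∀ ls ∈ (dnf φ).1, ∀ ψ ∈ ls, IsLiteral ψ) ∧ (∀ ls ∈ (dnf φ).2, ∀ ψ ∈ ls, IsLiteral ψ) := by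
  induction φ with
  | falsum => simp [dnf]
  | equal s t =>
    simp only [dnf, List.mem_singleton, forall_eq]
    exact ⟨Or.inl (IsAtomic.equal _ _), Or.inr ⟨_, IsAtomic.equal _ _, rfl⟩⟩
  | rel R ts =>
    simp only [dnf, List.mem_singleton, forall_eq]
    exact ⟨Or.inl (IsAtomic.rel _ _), Or.inr ⟨_, IsAtomic.rel _ _, rfl⟩⟩
  | imp φ ψ ih₁ ih₂ =>
    constructor
    · intro ls hls
      rcases List.mem_append.1 hls with h | h
      exacts [ih₁.2 _ h, ih₂.1 _ h]
    · intro ls hls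
      simp only [dnf, List.mem_flatMap, List.mem_map] at hls
      obtain ⟨a, ha, b, hb, rfl⟩ := hls
      intro ψ hψ
      rcases List.mem_append.1 hψ with h | h
      exacts [ih₁.1 _ ha _ h, ih₂.2 _ hb _ h]
  | all φ ih => simp [dnf]

/-- `dnf` on Gödel numbers. -/
def cDnf (φ : ℕ) : List (List ℕ) × List (List ℕ) :=
  formFold (σ := List (List ℕ) × List (List ℕ)) ([], [ [] ])
    (fun s t => ([ [cEq s t] ], [ [cNot (cEq s t)] ]))
    (fun R l => ([ [cRel R l] ], [ [cNot (cRel R l)] ]))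
    (fun p q => (p.2 ++ q.1, p.1.flatMap fun a => q.2.map fun b => a ++ b))
    (fun _ => ([], [])) φ

@[fun_prop] theorem primrec_cDnf {P : Type*} [Primcodable P] {f : P → ℕ} (hf : Primrec f) :
    Primrec fun p => cDnf (f p) := by
  unfold cDnf
  fun_prop

theorem cDnf_codeFormula [Encodable α] (c : SymbolCoding L) (φ : L.BoundedFormula α k) :
    cDnf (codeFormula c φ) = ((dnf φ).1.map (List.map (codeFormula c)),
      (dnf φ).2.map (List.map (codeFormula c))) := by
  unfold cDnf
  induction φ with
  | falsum => simp [dnf]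
  | equal s t => simp [dnf]
  | rel R ts => simp [dnf]
  | imp φ ψ ih₁ ih₂ =>
    simp [dnf, ih₁, ih₂, List.flatMap_map, List.map_flatMap, Function.comp_def]
  | all φ ih => simp [dnf]

end NormalForm

/-! ### Renaming of variables in quantifier-free formulas. -/

section Renaming

variable {L : FirstOrder.Language.{u, v}} {α β : Type*} {k l : ℕ}

/-- Rename the variables of a quantifier-free formula. -/
def ren (g : α ⊕ Fin k → β ⊕ Fin l) (φ : L.BoundedFormula α k) : L.BoundedFormula β l :=
  transQF (LHom.id L) (fun a => Term.var (g a)) φ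

variable (g : α ⊕ Fin k → β ⊕ Fin l) {φ : L.BoundedFormula α k}

theorem realize_ren (hφ : φ.IsQF) {M : Type*} [L.Structure M] (x : β → M) (z : Fin l → M) :
    (ren g φ).Realize x z ↔ φ.Realize (fun a => Sum.elim x z (g (Sum.inl a)))
      (fun j => Sum.elim x z (g (Sum.inr j))) := by
  rw [ren, realize_transQF _ _ hφ]
  rfl

theorem isQF_ren (hφ : φ.IsQF) : (ren g φ).IsQF := isQF_transQF _ _ hφ

theorem isConstraint_ren (hφ : IsConstraint φ) : IsConstraint (ren g φ) :=
  isConstraint_transQF _ _ hφ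

/-- The equation between two variables. -/
def eqVar (a b : α ⊕ Fin k) : L.BoundedFormula α k := equal (Term.var a) (Term.var b)

theorem isLiteral_eqVar (a b : α ⊕ Fin k) : IsLiteral (eqVar a b : L.BoundedFormula α k) :=
  Or.inl (IsAtomic.equal _ _)

theorem isLiteral_not_eqVar (a b : α ⊕ Fin k) :
    IsLiteral (eqVar a b : L.BoundedFormula α k).not :=
  Or.inr ⟨_, IsAtomic.equal _ _, rfl⟩

@[simp] theorem realize_eqVar {M : Type*} [L.Structure M] (a b : α ⊕ Fin k) (x : α → M)
    (z : Fin k → M) :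
    (eqVar a b : L.BoundedFormula α k).Realize x z ↔ Sum.elim x z a = Sum.elim x z b := Iff.rfl

/-- Rename the variables of a quantifier-free formula without bound variable slots. -/
def renF (g : α → β) (φ : L.Formula α) : L.Formula β :=
  ren (Sum.elim (fun a => Sum.inl (g a)) Fin.elim0) φ

theorem realize_renF (g : α → β) {φ : L.Formula α} (hφ : φ.IsQF) {M : Type*} [L.Structure M]
    (x : β → M) : (renF g φ).Realize x ↔ φ.Realize fun a => x (g a) := by
  rw [renF, Formula.Realize, realize_ren _ hφ, Formula.Realize]
  exact iff_of_eq (congrArg _ (Subsingleton.elim _ _))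

/-- `δ(z)` together with the equations `x i = z (idx i)`. -/
def withParams {n N : ℕ} (δ : L.Formula (Fin N)) (idx : Fin n → Fin N) :
    L.BoundedFormula (Fin n) N :=
  ren (Sum.elim Sum.inr Fin.elim0) δ ⊓
    conj ((List.finRange n).map fun i => eqVar (Sum.inl i) (Sum.inr (idx i)))

theorem isConstraint_withParams {n N : ℕ} {δ : L.Formula (Fin N)} (hδ : IsConstraint δ)
    (idx : Fin n → Fin N) : IsConstraint (withParams δ idx) := by
  refine IsConstraint.inf (isConstraint_ren _ hδ) (isConstraint_conj ?_)
  simp only [List.mem_map]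
  rintro _ ⟨i, -, rfl⟩
  exact IsConstraint.literal (isLiteral_eqVar _ _)

theorem realize_withParams {n N : ℕ} {δ : L.Formula (Fin N)} (hδ : δ.IsQF)
    (idx : Fin n → Fin N) {M : Type*} [L.Structure M] (x : Fin n → M) (z : Fin N → M) :
    (withParams δ idx).Realize x z ↔ δ.Realize z ∧ ∀ i, x i = z (idx i) := by
  rw [withParams, realize_inf, realize_ren _ hδ, realize_conj, Formula.Realize]
  simp only [List.mem_map, List.mem_finRange, true_and, forall_exists_index,
    forall_apply_eq_imp_iff, realize_eqVar, Sum.elim_inl, Sum.elim_inr]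
  rw [Subsingleton.elim (fun j => _) (default : Fin 0 → M)]

end Renaming

/-! ### Diagrams, compactness, and the semantic characterization of covers. -/

section Models

variable {L : FirstOrder.Language.{u, v}} {T : L.Theory}

/-- A model in any universe will do: unsatisfiability in the official universe is the entailment T ⊨
¬φ, which then holds in models of every size. -/
theorem satisfiableIn_of_realize {n : ℕ} {φ : L.Formula (Fin n)} (M : Type*) [L.Structure M]
    [M ⊨ T] [Nonempty M] (x : Fin n → M) (h : φ.Realize x) : SatisfiableIn T φ := by
  by_contra hc
  have h1 : T ⊨ᵇ φ.not := by
    rw [Theory.models_formula_iff]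
    intro N y
    rw [Formula.realize_not]
    exact fun hy => hc ⟨N, y, hy⟩
  exact (Formula.realize_not.1 (h1.realize_formula M (v := x))) h

/-- Compactness for formulas: the elements of `C` become new constants, and finite subsets of the
resulting theory are satisfied by hypothesis. -/
theorem exists_realize_of_finite {T : L.Theory} {C : Type w} {I : Type*} (G : I → L.Formula C)
    (h : ∀ I₀ : Finset I, ∃ (M : Theory.ModelType.{u, v, w'} T) (x : C → M),
      ∀ i ∈ I₀, (G i).Realize x) :
    ∃ (M : Theory.ModelType.{u, v, max u v w} T) (x : C → M), ∀ i, (G i).Realize x := by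
  classical
  have hs : ((L.lhomWithConstants C).onTheory T ∪
      Set.range fun i => Formula.equivSentence (G i)).IsSatisfiable := by
    rw [Theory.isSatisfiable_iff_isFinitelySatisfiable]
    intro T₀ hT₀
    -- A finite set of sentences involves only finitely many of the `G i`.
    obtain ⟨I₀, hI₀⟩ : ∃ I₀ : Finset I, ∀ φ ∈ T₀, φ ∈ (L.lhomWithConstants C).onTheory T ∨
        ∃ i ∈ I₀, Formula.equivSentence (G i) = φ := by
      induction T₀ using Finset.induction_on with
      | empty => exact ⟨∅, by simp⟩
      | insert φ T₁ _ ih =>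
        obtain ⟨I₁, h₁⟩ := ih ((Finset.coe_subset.2 (Finset.subset_insert _ _)).trans hT₀)
        rcases hT₀ (Finset.mem_coe.2 (Finset.mem_insert_self φ T₁)) with hφ | ⟨i, hi⟩
        · exact ⟨I₁, fun ψ hψ => (Finset.mem_insert.1 hψ).elim (fun e => Or.inl (e ▸ hφ)) (h₁ ψ)⟩
        · refine ⟨insert i I₁, fun ψ hψ => ?_⟩
          rcases Finset.mem_insert.1 hψ with rfl | hψ
          · exact Or.inr ⟨i, by simp, hi⟩
          · rcases h₁ ψ hψ with h | ⟨j, hj, hj'⟩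
            · exact Or.inl h
            · exact Or.inr ⟨j, by simp [hj], hj'⟩
    obtain ⟨M, x, hM⟩ := h I₀
    let : (constantsOn C).Structure M := constantsOn.structure x
    have hT : M ⊨ (L.lhomWithConstants C).onTheory T := (LHom.onTheory_model _ _).2 inferInstance
    have : M ⊨ (T₀ : (L[[C]]).Theory) := by
      rw [Theory.model_iff]
      intro φ hφ
      rcases hI₀ φ hφ with h | ⟨i, hi, rfl⟩
      · exact Theory.realize_sentence_of_mem _ h
      · exact (Formula.realize_equivSentence M (G i)).2 (hM i hi)
    exact Theory.Model.isSatisfiable M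
  obtain ⟨N⟩ := hs
  let := (L.lhomWithConstants C).reduct N
  have h1 : N ⊨ (L.lhomWithConstants C).onTheory T :=
    Theory.Model.mono N.is_model Set.subset_union_left
  have h2 : N ⊨ T := (LHom.onTheory_model _ _).1 h1
  refine ⟨Theory.ModelType.of T N, fun a => (L.con a : N), fun i => ?_⟩
  exact (Formula.realize_equivSentence N (G i)).1
    (N.is_model.realize_of_mem _ (Or.inr ⟨i, rfl⟩))

/-- Compactness in the presence of the diagram of a structure. -/
theorem exists_extension {T : L.Theory} (M : Type w) [L.Structure M] {C : Type w} (j : M → C)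
    {I : Type*} (G : I → L.Formula C)
    (h : ∀ I₀ : Finset I, ∃ F : Finset M, ∀ (N : ℕ) (b : Fin N → M) (δ : L.Formula (Fin N)),
      Function.Injective b → (∀ m ∈ F, ∃ i, b i = m) → IsConstraint δ → δ.Realize b →
      ∃ (M' : Theory.ModelType.{u, v, w'} T) (x : C → M'), δ.Realize (fun i => x (j (b i))) ∧
        ∀ i ∈ I₀, (G i).Realize x) :
    ∃ (M' : Theory.ModelType.{u, v, max u v w} T) (x : C → M') (f : M ↪[L] M'),
      (∀ m, f m = x (j m)) ∧ ∀ i, (G i).Realize x := by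
  classical
  -- `D` indexes the constraints true in `M` at some tuple, that is, the diagram of `M`.
  let D := Σ N : ℕ, {p : (Fin N → M) × L.Formula (Fin N) // IsConstraint p.2 ∧ p.2.Realize p.1}
  let G' : I ⊕ D → L.Formula C := Sum.elim G fun d =>
    renF (fun i => j (d.2.1.1 i)) d.2.1.2
  have key : ∃ (M' : Theory.ModelType.{u, v, max u v w} T) (x : C → M'),
      ∀ i, (G' i).Realize x := by
    refine exists_realize_of_finite G' fun I₀ => ?_
    obtain ⟨F, hF⟩ := h (I₀.toLeft)
    -- All elements mentioned by the selected part of the diagram are adjoined to `F`, so that this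
    -- part becomes a single constraint on one injective tuple.
    let F' : Finset M := F ∪ I₀.toRight.biUnion fun d => Finset.univ.image d.2.1.1
    let e := F'.equivFin
    have hmem : ∀ d ∈ I₀.toRight, ∀ i, d.2.1.1 i ∈ F' := fun d hd i =>
      Finset.mem_union_right _ (Finset.mem_biUnion.2 ⟨d, hd, Finset.mem_image_of_mem _ (by simp)⟩)
    -- The value `⊤` is a dummy; the condition holds for every selected `d`.
    let δd : D → L.Formula (Fin F'.card) := fun d =>
      if hd : ∀ i, d.2.1.1 i ∈ F' then
        renF (fun i => e ⟨_, hd i⟩) d.2.1.2 else ⊤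
    have hδc : ∀ d, IsConstraint (δd d) := by
      intro d
      simp only [δd]
      split_ifs
      · exact isConstraint_ren _ d.2.2.1
      · exact IsConstraint.top
    obtain ⟨M', x, hx, hx'⟩ := hF F'.card (fun i => (e.symm i : M))
      (conj (I₀.toRight.toList.map δd)) (Subtype.val_injective.comp e.symm.injective)
      (fun m hm => ⟨e ⟨m, Finset.mem_union_left _ hm⟩, by simp⟩)
      (isConstraint_conj (by simp only [List.mem_map]; rintro _ ⟨d, -, rfl⟩; exact hδc d)) (by
        rw [Formula.Realize, realize_conj]
        simp only [List.mem_map, Finset.mem_toList]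
        rintro _ ⟨d, hd, rfl⟩
        simp only [δd, dif_pos (hmem d hd)]
        exact (realize_renF _ d.2.2.1.isQF _).2 (by simpa using d.2.2.2))
    refine ⟨M', x, fun i hi => ?_⟩
    rcases i with i | d
    · exact hx' i (by simpa using hi)
    · have hd : d ∈ I₀.toRight := by simpa using hi
      rw [Formula.Realize, realize_conj] at hx
      have h3 := hx _ (List.mem_map.2 ⟨d, by simpa using hd, rfl⟩)
      simp only [δd, dif_pos (hmem d hd)] at h3
      have h4 := (realize_renF _ d.2.2.1.isQF _).1 h3
      exact (realize_renF _ d.2.2.1.isQF _).2 (by simpa using h4)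
  obtain ⟨M', x, hx⟩ := key
  have hd : ∀ (N : ℕ) (b : Fin N → M) (δ : L.Formula (Fin N)), IsConstraint δ → δ.Realize b →
      δ.Realize fun i => x (j (b i)) := fun N b δ h₁ h₂ =>
    (realize_renF _ h₁.isQF x).1 (hx (Sum.inr ⟨N, ⟨(b, δ), h₁, h₂⟩⟩))
  -- Inequations of the diagram give injectivity, equations between a function value and its name
  -- give compatibility with functions, and positive and negative atoms give that with relations.
  refine ⟨M', x, ⟨⟨fun m => x (j m), fun a b hab => ?_⟩, fun {n} f y => ?_, fun {n} R y => ?_⟩,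
    fun m => rfl, fun i => hx (Sum.inl i)⟩
  · by_contra hne
    have := hd 2 ![a, b] (eqVar (Sum.inl 0) (Sum.inl 1)).not
      (IsConstraint.literal (isLiteral_not_eqVar _ _)) (by
        rw [Formula.Realize, realize_not, realize_eqVar]; simpa using hne)
    rw [Formula.Realize, realize_not, realize_eqVar] at this
    exact this (by simpa using hab)
  · have := hd (n + 1) (Fin.snoc y (Structure.funMap f y))
      (equal (Term.func f fun i => Term.var (Sum.inl i.castSucc)) (Term.var (Sum.inl (Fin.last n))))
      (IsConstraint.literal (Or.inl (IsAtomic.equal _ _))) (by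
        simp [Formula.Realize, Realize])
    simp only [Formula.Realize, Realize, Term.realize_func, Term.realize_var, Sum.elim_inl,
      Fin.snoc_castSucc, Fin.snoc_last] at this
    exact this.symm
  · constructor
    · intro h'
      by_contra hn
      have := hd n y (rel R fun i => Term.var (Sum.inl i)).not
        (IsConstraint.literal (Or.inr ⟨_, IsAtomic.rel _ _, rfl⟩)) (by
          simpa [Formula.Realize, Realize] using hn)
      simp only [Formula.Realize, Realize, Term.realize_var, Sum.elim_inl] at this
      exact this h'
    · intro h'
      have := hd n y (rel R fun i => Term.var (Sum.inl i))
        (IsConstraint.literal (Or.inl (IsAtomic.rel _ _))) (by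
          simpa [Formula.Realize, Realize] using h')
      simpa only [Formula.Realize, Realize, Term.realize_var, Sum.elim_inl] using! this

/-- An interpretation of an injective tuple of elements of `M` extends to an assignment on the whole
of `M`. -/
theorem exists_comp_eq {A B C : Type*} [Nonempty C] {b : A → B} (hb : Function.Injective b)
    (x : A → C) : ∃ y : B → C, ∀ a, y (b a) = x a := by
  classical
  exact ⟨Function.extend b x fun _ => Classical.arbitrary C, fun a => hb.extend_apply _ _ _⟩

/-- Each finite part of the diagram of `M` is a constraint satisfiable in T, hence in T*;
compactness realizes the whole diagram in one model of T*. -/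
theorem IsModelCompletion.exists_embedding {Tstar : L.Theory} (h : IsModelCompletion T Tstar)
    (M : Type w) [L.Structure M] [M ⊨ T] [Nonempty M] :
    ∃ M' : Theory.ModelType.{u, v, max u v w} Tstar, Nonempty (M ↪[L] M') := by
  obtain ⟨M', _, f, -⟩ := exists_extension.{u, v, w, max u v} (T := Tstar) M (id : M → M)
    (I := Empty) (fun i => i.elim) fun _ => ⟨∅, fun N b δ hb _ hδ hδb => by
      obtain ⟨M', x, hx⟩ := h.satisfiable N δ hδ (satisfiableIn_of_realize M b hδb)
      obtain ⟨y, hy⟩ := exists_comp_eq hb x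
      exact ⟨M', y, by simpa [hy] using hx, by simp⟩⟩
  exact ⟨M', ⟨f⟩⟩

theorem IsResidue.realize {n k m : ℕ} {φ : L.BoundedFormula (Fin n) k}
    {θ : L.BoundedFormula (Fin n) m} (h : IsResidue T φ θ) {M : Type*} [L.Structure M] [M ⊨ T]
    [Nonempty M] {x : Fin n → M} {e : Fin k → M} (he : φ.Realize x e) (z : Fin m → M) :
    θ.Realize x z := by
  have := h.2.realize_formula M (v := x)
  rw [Formula.Realize, realize_imp] at this
  exact realize_alls.1 (this (realize_exs.2 ⟨e, he⟩)) z

theorem isResidue_iff {n k m : ℕ} {φ : L.BoundedFormula (Fin n) k}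
    {θ : L.BoundedFormula (Fin n) m} : IsResidue T φ θ ↔ θ.IsQF ∧
      ∀ (M : Theory.ModelType.{u, v, max u v} T) (x : Fin n → M) (e : Fin k → M) (z : Fin m → M),
        φ.Realize x e → θ.Realize x z := by
  refine and_congr_right fun _ => ⟨fun h M x e z he => ?_, fun h => ?_⟩
  · have := h.realize_formula M (v := x)
    rw [Formula.Realize, realize_imp] at this
    exact realize_alls.1 (this (realize_exs.2 ⟨e, he⟩)) z
  · rw [Theory.models_formula_iff]
    intro M x
    rw [Formula.Realize, realize_imp]
    intro h1
    obtain ⟨e, he⟩ := realize_exs.1 h1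
    exact realize_alls.2 fun z => h M x e z he

theorem IsCover.realize {n k : ℕ} {φ : L.BoundedFormula (Fin n) k} {ψ : L.Formula (Fin n)}
    (h : IsCover T φ ψ) {M : Type*} [L.Structure M] [M ⊨ T]
    [Nonempty M] {x : Fin n → M} {e : Fin k → M} (he : φ.Realize x e) : ψ.Realize x :=
  h.1.realize he _

/-- A quantifier-free formula implied by `∃ e, φ` and true only at tuples that satisfy `∃ e, φ` in
some extension is a cover. -/
theorem isCover_of_extension {n k : ℕ} {φ : L.BoundedFormula (Fin n) k} {ψ : L.Formula (Fin n)}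
    (hψ : ψ.IsQF)
    (h1 : ∀ (M : Theory.ModelType.{u, v, max u v} T) (x : Fin n → M) (e : Fin k → M),
      φ.Realize x e → ψ.Realize x)
    (h2 : ∀ (M : Theory.ModelType.{u, v, max u v} T) (x : Fin n → M), ψ.Realize x →
      ∃ (M' : Theory.ModelType.{u, v, w} T) (f : M ↪[L] M') (e : Fin k → M'),
        φ.Realize (f ∘ x) e) : IsCover T φ ψ := by
  refine ⟨isResidue_iff.2 ⟨hψ, fun M x e z he => ?_⟩, fun m θ hθ => ?_⟩
  · have := h1 M x e he
    rwa [Formula.Realize, Subsingleton.elim default z] at this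
  · rw [Theory.models_formula_iff]
    intro M x
    rw [Formula.Realize, realize_imp]
    intro hx
    obtain ⟨M', f, e, he⟩ := h2 M x hx
    refine realize_alls.2 fun z => ?_
    exact (hθ.1.realize_embedding f).1 (hθ.realize he (f ∘ z))

/-- If no extension realizes φ at `a`, compactness yields a finite part δ(b) of the diagram
incompatible with φ. Then ¬δ is a residue, so the cover implies it, although δ(b) holds in `M`. -/
theorem IsCover.exists_extension {n k : ℕ} {φ : L.BoundedFormula (Fin n) k}
    {ψ : L.Formula (Fin n)} (h : IsCover T φ ψ) (hφ : φ.IsQF) (M : Type w) [L.Structure M] [M ⊨ T]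
    [Nonempty M] {a : Fin n → M} (ha : ψ.Realize a) :
    ∃ (M' : Theory.ModelType.{u, v, max u v w} T) (f : M ↪[L] M') (e : Fin k → M'),
        φ.Realize (f ∘ a) e := by
  classical
  obtain ⟨M', x, f, hf, hx⟩ := Covers.exists_extension.{u, v, w, max u v} (T := T) M
    (C := M ⊕ ULift.{w} (Fin k)) Sum.inl
    (I := Unit) (fun _ => ren (Sum.elim (fun i => Sum.inl (Sum.inl (a i)))
      (fun t => Sum.inl (Sum.inr ⟨t⟩))) φ)
    fun _ => ⟨Finset.univ.image a, fun N b δ hb hF hδ hδb => by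
      choose idx hidx using fun i => hF (a i) (Finset.mem_image_of_mem _ (Finset.mem_univ i))
      by_contra hc
      -- The tuple `b` instantiates the extra variables of the residue; the equations tie each
      -- parameter to its position in `b`.
      let θ : L.BoundedFormula (Fin n) N := (withParams δ idx).not
      have hθ : IsResidue T φ θ := by
        refine isResidue_iff.2 ⟨(isConstraint_withParams hδ idx).isQF.not, ?_⟩
        intro M' x e z he
        rw [realize_not, realize_withParams hδ.isQF]
        rintro ⟨h1, h2⟩
        obtain ⟨y, hy⟩ := exists_comp_eq hb z
        refine hc ⟨M', Sum.elim y fun t => e t.down, ?_, fun _ _ => ?_⟩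
        · simpa [hy] using h1
        · rw [Formula.Realize, realize_ren _ hφ]
          convert! he using 1
          funext i
          simp [← hidx, hy, h2]
      have h3 := (h.2 N θ hθ).realize_formula M (v := a)
      rw [Formula.Realize, realize_imp] at h3
      exact realize_not.1 (realize_alls.1 (h3 ha) b)
        ((realize_withParams hδ.isQF _ _ _).2 ⟨hδb, fun i => (hidx i).symm⟩)⟩
  refine ⟨M', f, fun t => x (Sum.inr ⟨t⟩), ?_⟩
  have := hx ()
  rw [Formula.Realize, realize_ren _ hφ] at this
  convert! this using 1
  funext i
  simp [hf]

/-- In a model completion, a cover of an existential formula is equivalent to it. -/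
theorem IsModelCompletion.realize_iff_of_isQFEquivalent [T.IsUniversal] {Tstar : L.Theory}
    (h : IsModelCompletion T Tstar) {n k : ℕ} {φ : L.BoundedFormula (Fin n) k} (hφ : φ.IsQF)
    {ψ : L.Formula (Fin n)} (hψ : IsQFEquivalent Tstar φ.exs ψ) : IsCover T φ ψ := by
  have hr : ∀ (M : Type (max u v)) [L.Structure M] [M ⊨ Tstar] [Nonempty M] (x : Fin n → M),
      (∃ e, φ.Realize x e) ↔ ψ.Realize x := by
    intro M _ _ _ x
    have := hψ.2.realize_formula M (v := x)
    rw [Formula.Realize, realize_iff] at this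
    exact realize_exs.symm.trans this
  have hT : ∀ M : Theory.ModelType.{u, v, max u v} Tstar, M ⊨ T := fun M =>
    Theory.Model.mono M.is_model h.subset
  have hq : ∀ {M N : Type (max u v)} [L.Structure M] [L.Structure N] (f : M ↪[L] N)
      (x : Fin n → M), ψ.Realize (f ∘ x) ↔ ψ.Realize x := by
    intro M N _ _ f x
    rw [Formula.Realize, Formula.Realize, ← hψ.1.realize_embedding f]
    exact iff_of_eq (congrArg _ (Subsingleton.elim _ _))
  -- Both conditions are checked in a model of T* extending `M`: there ψ and ∃e φ agree, and
  -- quantifier-free truth passes along the embedding in both directions.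
  refine isCover_of_extension.{u, v, max u v} hψ.1 (fun M x e he => ?_) fun M x hx => ?_
  · obtain ⟨M', ⟨f⟩⟩ := h.exists_embedding M
    refine (hq f x).1 ((hr M' _).1 ⟨f ∘ e, (hφ.realize_embedding f).2 he⟩)
  · obtain ⟨M', ⟨f⟩⟩ := h.exists_embedding M
    obtain ⟨e, he⟩ := (hr M' _).2 ((hq f x).2 hx)
    have := hT M'
    exact ⟨Theory.ModelType.of T M', f, e, he⟩

theorem IsModelCompletion.hasCovers [T.IsUniversal] {Tstar : L.Theory}
    (h : IsModelCompletion T Tstar) : HasCovers T := fun n _ φ hφ =>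
  let ⟨ψ, hψ⟩ := h.qe n φ.exs
  ⟨ψ, h.realize_iff_of_isQFEquivalent hφ hψ⟩

/-- Covers are unique modulo T, each being a residue that the other must imply. -/
theorem IsCover.realize_imp {n k : ℕ} {φ : L.BoundedFormula (Fin n) k} {ψ ψ' : L.Formula (Fin n)}
    (h : IsCover T φ ψ) (h' : IsCover T φ ψ') {M : Type*} [L.Structure M] [M ⊨ T]
    [Nonempty M] {x : Fin n → M} (hx : ψ.Realize x) : ψ'.Realize x := by
  have := (h.2 0 ψ' h'.1).realize_formula M (v := x)
  rw [Formula.Realize, BoundedFormula.realize_imp] at this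
  exact this hx

/-- By uniqueness of covers it suffices to treat the one obtained from quantifier elimination in T*.
-/
theorem IsModelCompletion.realize_cover_iff [T.IsUniversal] {Tstar : L.Theory}
    (h : IsModelCompletion T Tstar) {n k : ℕ} {φ : L.BoundedFormula (Fin n) k} (hφ : φ.IsQF)
    {ψ : L.Formula (Fin n)} (hψ : IsCover T φ ψ) (M : Type*) [L.Structure M] [M ⊨ Tstar]
    [Nonempty M] (x : Fin n → M) : ψ.Realize x ↔ ∃ e, φ.Realize x e := by
  obtain ⟨ψ', hψ'⟩ := h.qe n φ.exs
  have h' := h.realize_iff_of_isQFEquivalent hφ hψ'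
  have : M ⊨ T := Theory.Model.mono (T' := Tstar) inferInstance h.subset
  have := hψ'.2.realize_formula M (v := x)
  rw [Formula.Realize, realize_iff] at this
  rw [← realize_exs]
  refine Iff.trans ?_ this.symm
  exact ⟨hψ.realize_imp h', h'.realize_imp hψ⟩

end Models

/-! ### Realizing terminal constraints by new elements on a prescribed carrier. -/

section Terminal

variable {L : FirstOrder.Language.{u, v}} {T : L.Theory}

/-- If `ψ` is terminal and `a` satisfies a cover of `∃ e, ψ`, then `ψ` is realized in an infinite
extension by elements that are new. -/
theorem exists_fresh_extension (hconv : IsConvex T) (hsi : IsStablyInfinite T)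
    (hei : IsEqualityInterpolating T) {n k : ℕ} {ψ : L.BoundedFormula (Fin n) k}
    (hterm : IsTerminalFor T ψ) {θ : L.Formula (Fin n)} (hθ : IsCover T ψ θ) (M : Type w)
    [L.Structure M] [M ⊨ T] [Nonempty M] {a : Fin n → M} (ha : θ.Realize a) :
    ∃ (M' : Theory.ModelType.{u, v, max u v w} T) (f : M ↪[L] M') (e : Fin k → M'),
      Infinite M' ∧ ψ.Realize (f ∘ a) e ∧ ∀ j m, e j ≠ f m := by
  classical
  obtain ⟨hψ, -, himpl⟩ := hterm
  obtain ⟨M₀, f₀, e₀, he₀⟩ := hθ.exists_extension hψ.isQF M ha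
  -- Index `none` asks for ψ(a, e); index `some (t, m)` asks for e_t ≠ m.
  let G : Option (Fin k × M) → L.Formula (M ⊕ ULift.{w} (Fin k)) := fun o => o.elim
    (ren (Sum.elim (fun i => Sum.inl (Sum.inl (a i))) (fun t => Sum.inl (Sum.inr ⟨t⟩))) ψ)
    (fun p => (eqVar (Sum.inl (Sum.inr ⟨p.1⟩)) (Sum.inl (Sum.inl p.2))).not)
  -- Axioms of infinity are added to the theory, so that compactness itself returns an infinite
  -- model.
  obtain ⟨M', x, f, hf, hx⟩ := Covers.exists_extension.{u, v, w, max u v}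
    (T := T ∪ L.infiniteTheory) M Sum.inl G fun I₀ => by
      refine ⟨Finset.univ.image a ∪ I₀.biUnion fun o => o.elim ∅ fun p => {p.2},
        fun N b δ hb hF hδ hδb => ?_⟩
      choose idx hidx using fun i => hF (a i)
        (Finset.mem_union_left _ (Finset.mem_image_of_mem _ (Finset.mem_univ i)))
      -- The first `N` variables stand for the tuple `b`, which contains the parameters `a` at the
      -- positions `idx`; the last `k` stand for the existential variables.
      let δ₀ : L.Formula (Fin (N + k)) := renF (Fin.castAdd k) δ ⊓
        ren (Sum.elim (fun i => Sum.inl (Fin.castAdd k (idx i)))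
          fun t => Sum.inl (Fin.natAdd N t)) ψ
      have hδ₀c : IsConstraint δ₀ :=
        IsConstraint.inf (isConstraint_ren _ hδ) (isConstraint_ren _ hψ)
      have hδ₀ : ∀ (M' : Theory.ModelType.{u, v, max u v} T) (y : Fin (N + k) → M'),
          δ₀.Realize y ↔ δ.Realize (fun i => y (Fin.castAdd k i)) ∧
            ψ.Realize (fun i => y (Fin.castAdd k (idx i))) fun t => y (Fin.natAdd N t) := by
        intro M' y
        rw [Formula.Realize, realize_inf, ← Formula.Realize, realize_renF _ hδ.isQF,
          realize_ren _ hψ.isQF]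
        rfl
      let prs : List (Fin (N + k) × Fin (N + k)) := (List.finRange k).flatMap fun t =>
        (List.finRange N).map fun i => (Fin.natAdd N t, Fin.castAdd k i)
      have hprs : ∀ p, p ∈ prs ↔ ∃ t i, p = (Fin.natAdd N t, Fin.castAdd k i) := by
        intro p
        simp [prs, eq_comm]
      have hsat₀ : SatisfiableIn T δ₀ := by
        refine satisfiableIn_of_realize M₀ (Fin.append (f₀ ∘ b) e₀) ?_
        rw [Formula.Realize, realize_inf, ← Formula.Realize, realize_renF _ hδ.isQF,
          realize_ren _ hψ.isQF]
        simp only [Fin.append_left, Sum.elim_inl, Function.comp_apply, hidx]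
        refine ⟨?_, by convert! he₀ using 1; funext t; exact Fin.append_right _ _ t⟩
        have h1 := (hδ.isQF.realize_embedding f₀ (v := b) (xs := default)).2 hδb
        rw [Formula.Realize]
        convert! h1
      -- The heart of the argument: δ₀ is compatible with all the inequations between existential
      -- variables and elements of `b`.
      have hsat : SatisfiableIn T
          (δ₀ ⊓ conj (prs.map fun p => (eqVar (Sum.inl p.1) (Sum.inl p.2)).not)) := by
        by_contra hc
        have h1 : ∀ (M' : Theory.ModelType.{u, v, max u v} T) (y : Fin (N + k) → M'),
            δ₀.Realize y → ∃ p ∈ prs, y p.1 = y p.2 := by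
          intro M' y hy
          by_contra hc'
          push Not at hc'
          refine hc ⟨M', y, ?_⟩
          rw [Formula.Realize, realize_inf, realize_conj]
          refine ⟨hy, ?_⟩
          simp only [List.mem_map]
          rintro _ ⟨p, hp, rfl⟩
          rw [realize_not, realize_eqVar]
          exact hc' p hp
        -- Convexity applies to nonempty disjunctions only; an empty one would contradict the
        -- satisfiability of δ₀.
        have hne : prs ≠ [] := by
          rintro h
          obtain ⟨M', y, hy⟩ := hsat₀
          obtain ⟨p, hp, -⟩ := h1 M' y hy
          simp [h] at hp
        obtain ⟨p, hp, h2⟩ := hconv _ δ₀ hδ₀c prs hne h1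
        obtain ⟨t, i, rfl⟩ := (hprs p).1 hp
        -- Only the parameters are shared between the diagram part and ψ, so the common value of x_i
        -- and e_t is a term `s` in the parameters.
        obtain ⟨s, hs⟩ := hei n N k (withParams δ idx) ψ i t (isConstraint_withParams hδ idx) hψ
          (by
            intro M' y z₁ z₂ hz₁ hz₂
            rw [realize_withParams hδ.isQF] at hz₁
            have := h2 M' (Fin.append z₁ z₂) ((hδ₀ M' _).2 (by
              simp only [Fin.append_left, Fin.append_right, ← hz₁.2]
              exact ⟨hz₁.1, hz₂⟩))
            simpa using this.symm)
        -- In a model of T* satisfying δ₀, the term `s` forces uniqueness of e_t at these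
        -- parameters, so ImplDef holds there; but terminality negates it wherever ψ is realized.
        obtain ⟨D, ⟨-, Tstar, hmc, hD⟩, hDn⟩ := himpl t
        obtain ⟨M', y, hy⟩ := hmc.satisfiable _ δ₀ hδ₀c hsat₀
        have hM' : M' ⊨ T := Theory.Model.mono M'.is_model hmc.subset
        have hy' := (hδ₀ (Theory.ModelType.of T M') y).1 hy
        have h3 := hDn.realize_formula M' (v := fun i => y (Fin.castAdd k (idx i)))
        rw [Formula.Realize, realize_imp, realize_not] at h3
        refine h3 (realize_exs.2 ⟨_, hy'.2⟩) ((hD M' _).2 fun z z' hz hz' => ?_)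
        have h4 : ∀ z : Fin k → M', ψ.Realize (fun i => y (Fin.castAdd k (idx i))) z →
            z t = s.realize fun i => y (Fin.castAdd k (idx i)) := fun z hz =>
          (hs (Theory.ModelType.of T M') _ (fun i => y (Fin.castAdd k i)) z
            ((realize_withParams hδ.isQF _ _ _).2 ⟨hy'.1, fun _ => rfl⟩) hz).2
        rw [h4 z hz, h4 z' hz']
      -- Stable infiniteness is applied after the inequations have been included, so that they
      -- survive in the infinite model.
      obtain ⟨M', y, hinf, hy⟩ := hsi _ _ (IsConstraint.inf hδ₀c (isConstraint_conj (by
        simp only [List.mem_map]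
        rintro _ ⟨p, -, rfl⟩
        exact IsConstraint.literal (isLiteral_not_eqVar _ _)))) hsat
      rw [Formula.Realize, realize_inf, realize_conj] at hy
      have hy₀ := (hδ₀ M' y).1 hy.1
      obtain ⟨g, hg⟩ := exists_comp_eq hb fun i => y (Fin.castAdd k i)
      have : M' ⊨ L.infiniteTheory := (model_infiniteTheory_iff L).2 hinf
      have : M' ⊨ T ∪ L.infiniteTheory := Theory.Model.union M'.is_model this
      refine ⟨Theory.ModelType.of _ M', Sum.elim g fun t => y (Fin.natAdd N t.down), ?_, ?_⟩
      · have := hy₀.1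
        rw [← (funext hg : (fun i => g (b i)) = _)] at this
        exact this
      · rintro (_ | ⟨t, m⟩) hi
        · change (ren _ ψ).Realize _ _
          rw [realize_ren _ hψ.isQF]
          convert! hy₀.2 using 1
          funext i
          simp [← hidx, hg]
        · obtain ⟨i, rfl⟩ := hF m (Finset.mem_union_right _
            (Finset.mem_biUnion.2 ⟨_, hi, by simp⟩))
          have := hy.2 _ (List.mem_map_of_mem ((hprs _).2 ⟨t, i, rfl⟩))
          rw [realize_not, realize_eqVar] at this
          change ¬ (y (Fin.natAdd N t) = g (b i))
          rw [hg]
          exact this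
  have h1 : M' ⊨ T := Theory.Model.mono M'.is_model Set.subset_union_left
  have h2 : M' ⊨ L.infiniteTheory := Theory.Model.mono M'.is_model Set.subset_union_right
  refine ⟨Theory.ModelType.of T M', f, fun t => x (Sum.inr ⟨t⟩), (model_infiniteTheory_iff L).1 h2,
    ?_, fun t m hm => ?_⟩
  · have := hx none
    change (ren _ ψ).Realize _ _ at this
    rw [realize_ren _ hψ.isQF] at this
    have hfa : ⇑f ∘ a = fun i => x (Sum.inl (a i)) := funext fun i => hf (a i)
    replace this : ψ.Realize (fun i => x (Sum.inl (a i))) fun t => x (Sum.inr ⟨t⟩) := this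
    rw [← hfa] at this
    exact this
  · have := hx (some (t, m))
    change ¬ (x (Sum.inr ⟨t⟩) = x (Sum.inl m)) at this
    exact this (hm.trans (hf m))

/-- Distinctness is postulated for structures of one universe; expressed as an entailment between
formulas, it passes to all structures. -/
theorem IsTerminalFor.injective {n k : ℕ} {ψ : L.BoundedFormula (Fin n) k}
    (h : IsTerminalFor T ψ) {M : Type*} [L.Structure M] [Nonempty M] {x : Fin n → M} {e : Fin k → M}
    (he : ψ.Realize x e) : Function.Injective e := by
  intro i j hij
  by_contra hne
  have h1 : (∅ : L.Theory) ⊨ᵇ ψ.imp (eqVar (Sum.inr i) (Sum.inr j)).not := by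
    intro M' y z
    rw [BoundedFormula.realize_imp, BoundedFormula.realize_not, realize_eqVar]
    exact fun hz hz' => hne (h.2.1 M' y z hz hz')
  have h2 := h1.realize_boundedFormula M (v := x) (xs := e)
  rw [BoundedFormula.realize_imp, BoundedFormula.realize_not, realize_eqVar] at h2
  exact h2 he hij

/-- Cantor's theorem provides one set K strictly larger than the carriers of both extensions to be
glued. -/
theorem lift_mk_lt_lift_mk_set {A : Type u} {B : Type v} (i : A ↪ B) :
    Cardinal.lift.{v} (Cardinal.mk A) < Cardinal.lift.{u} (Cardinal.mk (Set B)) :=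
  lt_of_le_of_lt (Cardinal.lift_mk_le'.2 ⟨i⟩) (by
    rw [Cardinal.lift_lt, Cardinal.mk_set]
    exact Cardinal.cantor _)

/-- The range of `f` is smaller than the infinite set `N`, so its complement is equipotent with `N`,
hence with `K`. -/
theorem exists_equiv_sum_of_embedding {A : Type u} {K N : Type v} [Infinite K]
    (hA : Cardinal.lift.{v} (Cardinal.mk A) < Cardinal.lift.{u} (Cardinal.mk K)) (f : A → N)
    (hf : Function.Injective f) (hN : Cardinal.mk N = Cardinal.mk K) :
    ∃ g : A ⊕ K ≃ N, ∀ a, g (Sum.inl a) = f a := by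
  classical
  have hNinf : Infinite N := by
    rw [Cardinal.infinite_iff, hN]; exact Cardinal.aleph0_le_mk K
  have hr : Cardinal.mk (Set.range f) < Cardinal.mk N := by
    rw [hN, ← Cardinal.lift_lt.{v, u}]
    refine lt_of_eq_of_lt ?_ hA
    exact Cardinal.mk_range_eq_of_injective hf
  have h1 := Cardinal.mk_compl_of_infinite _ hr
  rw [hN] at h1
  obtain ⟨e⟩ := Cardinal.eq.1 h1
  refine ⟨(Equiv.sumCongr (Equiv.ofInjective f hf) e.symm).trans
    (Equiv.Set.sumCompl (Set.range f)), fun a => by simp⟩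

/-- The extension of `exists_fresh_extension`, on a prescribed carrier. -/
theorem exists_structure_on_sum [Countable L.Symbols] (M : Type w) {k : ℕ} [L.Structure M]
    (M' : Type w') [L.Structure M'] [M' ⊨ T] [Infinite M'] (f : M ↪[L] M') (e : Fin k → M')
    (he : Function.Injective e) (hne : ∀ j m, e j ≠ f m) {K : Type u₁} [Infinite K]
    (hK : Cardinal.lift.{u₁} (Cardinal.mk M') < Cardinal.lift.{w'} (Cardinal.mk K)) :
    ∃ (_ : L.Structure ((M ⊕ Fin k) ⊕ K)) (_ : Theory.Model ((M ⊕ Fin k) ⊕ K) T)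
      (g : M ↪[L] (M ⊕ Fin k) ⊕ K), (∀ m, g m = Sum.inl (Sum.inl m)) ∧
      ∀ {n : ℕ} (φ : L.BoundedFormula (Fin n) k) (a : Fin n → M), φ.Realize (f ∘ a) e →
        φ.Realize (g ∘ a) fun j => Sum.inl (Sum.inr j) := by
  -- Upward Löwenheim–Skolem for the countable signature gives an elementary extension of
  -- cardinality exactly |K|.
  obtain ⟨N, ⟨i⟩, hN⟩ := L.exists_elementaryEmbedding_card_eq_of_ge M' (Cardinal.mk K) (by
      refine le_trans (b := Cardinal.aleph0) ?_ ?_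
      · rw [Cardinal.lift_le_aleph0]
        exact Cardinal.mk_le_aleph0 (α := L.Symbols)
      · simp) hK.le
  have hNT : N ⊨ T := (i.theory_model_iff T).1 inferInstance
  let F : M ⊕ Fin k → N := Sum.elim (fun m => i (f m)) fun j => i (e j)
  have hF' : Function.Injective (Sum.elim f e : M ⊕ Fin k → M') :=
    f.injective.sumElim he fun m j h => hne j m h.symm
  have hF : Function.Injective F := by
    have : F = i ∘ Sum.elim f e := by
      funext x; rcases x with x | x <;> rfl
    rw [this]
    exact i.injective.comp hF'
  -- The sum M + Fin k embeds into M' because the `e j` are distinct and lie outside the image of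
  -- `M`.
  have hA : Cardinal.lift.{u₁} (Cardinal.mk (M ⊕ Fin k)) <
      Cardinal.lift.{w} (Cardinal.mk K) := by
    have h1 := Cardinal.mk_le_of_injective (α := ULift.{max w' u₁} (M ⊕ Fin k))
      (β := ULift.{max w u₁} M') (f := fun x => ⟨Sum.elim f e x.down⟩)
      (fun x y h => ULift.ext _ _ (hF' (congrArg ULift.down h)))
    simp only [Cardinal.mk_uLift] at h1
    rw [← Cardinal.lift_lt.{_, w'}, Cardinal.lift_lift, Cardinal.lift_lift]
    rw [← Cardinal.lift_lt.{_, w}, Cardinal.lift_lift, Cardinal.lift_lift] at hK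
    refine lt_of_le_of_lt ?_ (lt_of_lt_of_eq hK ?_)
    · simpa using h1
    · rfl
  obtain ⟨g, hg⟩ := exists_equiv_sum_of_embedding hA F hF hN
  -- The structure is transported along a bijection that sends each `m` and each `e j` to its
  -- canonical position.
  let : L.Structure ((M ⊕ Fin k) ⊕ K) := g.symm.inducedStructure
  let g' : N ≃[L] (M ⊕ Fin k) ⊕ K := g.symm.inducedStructureEquiv
  have hg' : ∀ p, g' (F p) = Sum.inl p := fun p => by
    rw [← hg]; exact g.symm_apply_apply _
  refine ⟨inferInstance, StrongHomClass.theory_model g',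
    g'.toEmbedding.comp (i.toEmbedding.comp f), fun m => hg' (Sum.inl m), fun {n} φ a h => ?_⟩
  have h1 := (i.map_boundedFormula φ (f ∘ a) e).2 h
  have h2 := (StrongHomClass.realize_boundedFormula g' φ (v := i ∘ f ∘ a) (xs := i ∘ e)).2 h1
  convert! h2 using 1
  funext j
  exact (hg' (Sum.inr j)).symm

end Terminal

/-! ### Amalgamation over disjoint signatures, and covers of terminal working formulas. -/

section Combination

variable {L₁ : FirstOrder.Language.{u₁, v₁}} {L₂ : FirstOrder.Language.{u₂, v₂}}
  {T₁ : L₁.Theory} {T₂ : L₂.Theory}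

theorem model_unionTheory_iff {M : Type*} [L₁.Structure M] [L₂.Structure M]
    [(L₁.sum L₂).Structure M] [(LHom.sumInl : L₁ →ᴸ L₁.sum L₂).IsExpansionOn M]
    [(LHom.sumInr : L₂ →ᴸ L₁.sum L₂).IsExpansionOn M] :
    M ⊨ unionTheory T₁ T₂ ↔ M ⊨ T₁ ∧ M ⊨ T₂ := by
  rw [unionTheory, Theory.model_union_iff, LHom.onTheory_model, LHom.onTheory_model]

theorem realize_subst_onBoundedFormula {L : FirstOrder.Language.{u, v}}
    {L' : FirstOrder.Language.{u₁, v₁}} (g : L →ᴸ L') {M : Type*} [L.Structure M] [L'.Structure M]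
    [g.IsExpansionOn M] {α β : Type*} {k : ℕ} (φ : L.BoundedFormula α k) (s : α → L'.Term β)
    (x : β → M) (z : Fin k → M) :
    ((g.onBoundedFormula φ).subst s).Realize x z ↔ φ.Realize (fun a => (s a).realize x) z := by
  rw [realize_subst, LHom.realize_onBoundedFormula]

theorem WorkingFormula.realize_combine {n : ℕ} (W : WorkingFormula L₁ L₂ n) {l : ℕ}
    (θ₁ : L₁.BoundedFormula (Fin W.m) l) (θ₂ : L₂.BoundedFormula (Fin W.m) l) {M : Type*}
    [L₁.Structure M] [L₂.Structure M]
    [(L₁.sum L₂).Structure M] [(LHom.sumInl : L₁ →ᴸ L₁.sum L₂).IsExpansionOn M]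
    [(LHom.sumInr : L₂ →ᴸ L₁.sum L₂).IsExpansionOn M] (x : Fin n → M) (z : Fin l → M) :
    (W.combine θ₁ θ₂).Realize x z ↔ θ₁.Realize (fun i => (W.terms i).realize x) z ∧
      θ₂.Realize (fun i => (W.terms i).realize x) z := by
  rw [WorkingFormula.combine, realize_inf, realize_subst_onBoundedFormula,
    realize_subst_onBoundedFormula]

theorem isQF_onBoundedFormula {L : FirstOrder.Language.{u, v}}
    {L' : FirstOrder.Language.{u₁, v₁}} (g : L →ᴸ L') {α : Type*} {k : ℕ}
    {φ : L.BoundedFormula α k} (h : φ.IsQF) : (g.onBoundedFormula φ).IsQF := by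
  induction h with
  | falsum => exact IsQF.falsum
  | of_isAtomic h =>
    cases h with
    | equal t₁ t₂ => exact (IsAtomic.equal _ _).isQF
    | rel R ts => exact (IsAtomic.rel _ _).isQF
  | imp _ _ h₁ h₂ => exact h₁.imp h₂

theorem isQF_subst {L : FirstOrder.Language.{u, v}} {α β : Type*} {k : ℕ}
    {φ : L.BoundedFormula α k} (h : φ.IsQF) (s : α → L.Term β) : (φ.subst s).IsQF := by
  induction h with
  | falsum => exact IsQF.falsum
  | of_isAtomic h =>
    cases h with
    | equal t₁ t₂ => exact (IsAtomic.equal _ _).isQF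
    | rel R ts => exact (IsAtomic.rel _ _).isQF
  | imp _ _ h₁ h₂ => exact h₁.imp h₂

theorem WorkingFormula.isQF_combine {n : ℕ} (W : WorkingFormula L₁ L₂ n) {l : ℕ}
    {θ₁ : L₁.BoundedFormula (Fin W.m) l} {θ₂ : L₂.BoundedFormula (Fin W.m) l} (h₁ : θ₁.IsQF)
    (h₂ : θ₂.IsQF) : (W.combine θ₁ θ₂).IsQF :=
  (isQF_subst (isQF_onBoundedFormula _ h₁) _).inf (isQF_subst (isQF_onBoundedFormula _ h₂) _)

/-- Each signature has its own extension of `M` realizing its pure part by new elements. On the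
common carrier both have `M` and the existential variables at the same positions, so they form a
structure for the combined signature that realizes both pure parts by one tuple. -/
theorem isCover_combine [Countable L₁.Symbols] [Countable L₂.Symbols]
    (hconv₁ : IsConvex T₁) (hconv₂ : IsConvex T₂)
    (hsi₁ : IsStablyInfinite T₁) (hsi₂ : IsStablyInfinite T₂)
    (hei₁ : IsEqualityInterpolating T₁) (hei₂ : IsEqualityInterpolating T₂)
    {n : ℕ} (W : WorkingFormula L₁ L₂ n) (hW : W.IsTerminal T₁ T₂)
    {θ₁ : L₁.Formula (Fin W.m)} {θ₂ : L₂.Formula (Fin W.m)}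
    (h₁ : IsCover T₁ W.ψ₁ θ₁) (h₂ : IsCover T₂ W.ψ₂ θ₂) :
    IsCover (unionTheory T₁ T₂) W.matrix (W.combine θ₁ θ₂) := by
  refine isCover_of_extension (W.isQF_combine h₁.1.1 h₂.1.1) (fun M x e he => ?_)
    fun M x hx => ?_
  · let : L₁.Structure M := (LHom.sumInl : L₁ →ᴸ L₁.sum L₂).reduct M
    let : L₂.Structure M := (LHom.sumInr : L₂ →ᴸ L₁.sum L₂).reduct M
    obtain ⟨hM₁, hM₂⟩ := model_unionTheory_iff.1 M.is_model
    rw [WorkingFormula.matrix, W.realize_combine] at he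
    exact (W.realize_combine _ _ _ _).2 ⟨h₁.realize he.1, h₂.realize he.2⟩
  · let : L₁.Structure M := (LHom.sumInl : L₁ →ᴸ L₁.sum L₂).reduct M
    let : L₂.Structure M := (LHom.sumInr : L₂ →ᴸ L₁.sum L₂).reduct M
    obtain ⟨hM₁, hM₂⟩ := model_unionTheory_iff.1 M.is_model
    obtain ⟨hx₁, hx₂⟩ := (W.realize_combine _ _ _ _).1 hx
    obtain ⟨N₁, f₁, e₁, _, he₁, hne₁⟩ := exists_fresh_extension hconv₁ hsi₁ hei₁ hW.1 h₁ M hx₁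
    obtain ⟨N₂, f₂, e₂, _, he₂, hne₂⟩ := exists_fresh_extension hconv₂ hsi₂ hei₂ hW.2 h₂ M hx₂
    -- The filling set is strictly larger than either extension; this makes the complements of the
    -- prescribed parts equipotent.
    have hK : Infinite (Set (N₁ ⊕ N₂)) := inferInstance
    obtain ⟨S₁, hS₁, g₁, hg₁, hr₁⟩ := exists_structure_on_sum (T := T₁) M N₁ f₁ e₁
      (hW.1.injective he₁) hne₁ (K := Set (N₁ ⊕ N₂))
      (lift_mk_lt_lift_mk_set Function.Embedding.inl)
    obtain ⟨S₂, hS₂, g₂, hg₂, hr₂⟩ := exists_structure_on_sum (T := T₂) M N₂ f₂ e₂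
      (hW.2.injective he₂) hne₂ (K := Set (N₁ ⊕ N₂))
      (lift_mk_lt_lift_mk_set Function.Embedding.inr)
    have hU : Theory.Model ((M ⊕ Fin W.k) ⊕ Set (N₁ ⊕ N₂)) (unionTheory T₁ T₂) :=
      model_unionTheory_iff.2 ⟨hS₁, hS₂⟩
    have hg : ⇑g₂ = ⇑g₁ := funext fun m => (hg₂ m).trans (hg₁ m).symm
    -- The two pure embeddings have the same underlying map, and each takes care of the symbols of
    -- its own signature.
    let g : M ↪[L₁.sum L₂] (M ⊕ Fin W.k) ⊕ Set (N₁ ⊕ N₂) :=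
      { toFun := g₁
        inj' := g₁.injective
        map_fun' := by
          rintro l (f | f) y
          · exact g₁.map_fun f y
          · rw [← hg]
            exact g₂.map_fun f y
        map_rel' := by
          rintro l (R | R) y
          · exact g₁.map_rel R y
          · rw [← hg]
            exact g₂.map_rel R y }
    refine ⟨Theory.ModelType.of _ ((M ⊕ Fin W.k) ⊕ Set (N₁ ⊕ N₂)), g,
      fun j => Sum.inl (Sum.inr j), ?_⟩
    -- The defining terms are mixed, and their values are preserved because `g` is an embedding for
    -- the combined signature.
    have ht : (fun i => (W.terms i).realize (⇑g ∘ x)) = ⇑g ∘ fun i => (W.terms i).realize x :=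
      funext fun i => HomClass.realize_term g
    have h := W.realize_combine W.ψ₁ W.ψ₂ (⇑g ∘ x) fun j : Fin W.k =>
      (Sum.inl (Sum.inr j) : (M ⊕ Fin W.k) ⊕ Set (N₁ ⊕ N₂))
    rw [ht] at h
    refine h.2 ⟨hr₁ _ _ he₁, ?_⟩
    have := hr₂ _ _ he₂
    rw [hg] at this
    exact this

end Combination

/-! ### Models of the cover axioms as limits of chains. -/

section Completion

variable {L : FirstOrder.Language.{u, v}} {T : L.Theory}

/-- A tuple satisfying a cover of an existential formula. -/
structure Request (T : L.Theory) (M : Type w) [L.Structure M] where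
  n : ℕ
  k : ℕ
  φ : L.BoundedFormula (Fin n) k
  ψ : L.Formula (Fin n)
  isQF : φ.IsQF
  isCover : IsCover T φ ψ
  a : Fin n → M
  realize : ψ.Realize a

theorem realize_formula_embedding {α : Type*} {ψ : L.Formula α} (hψ : ψ.IsQF) {M : Type w}
    {M' : Type w'} [L.Structure M] [L.Structure M'] (f : M ↪[L] M') (x : α → M) :
    ψ.Realize (f ∘ x) ↔ ψ.Realize x := by
  rw [Formula.Realize, Formula.Realize, ← hψ.realize_embedding f]
  exact iff_of_eq (congrArg _ (Subsingleton.elim _ _))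

/-- Finitely many requests are met one after another: covers are quantifier-free, hence remain true
in extensions, and so do the witnesses already found. Compactness then meets all of them at once,
without raising the universe. -/
theorem exists_extension_of_requests (M : Theory.ModelType.{u, v, max u v} T) :
    ∃ (M' : Theory.ModelType.{u, v, max u v} T) (f : M ↪[L] M'),
      ∀ r : Request T M, ∃ e : Fin r.k → M', r.φ.Realize (f ∘ r.a) e := by
  classical
  have hfin : ∀ I₀ : Finset (Request T M), ∃ (M' : Theory.ModelType.{u, v, max u v} T)
      (f : M ↪[L] M'), ∀ r ∈ I₀, ∃ e : Fin r.k → M', r.φ.Realize (f ∘ r.a) e := by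
    intro I₀
    induction I₀ using Finset.induction_on with
    | empty => exact ⟨M, Embedding.refl L M, by simp⟩
    | insert r I₀ _ ih =>
      obtain ⟨M₁, f₁, h₁⟩ := ih
      obtain ⟨M₂, f₂, e, he⟩ := r.isCover.exists_extension r.isQF M₁
        ((realize_formula_embedding r.isCover.1.1 f₁ _).2 r.realize)
      refine ⟨M₂, f₂.comp f₁, fun r' hr' => ?_⟩
      rcases Finset.mem_insert.1 hr' with rfl | hr'
      · exact ⟨e, he⟩
      · obtain ⟨e', he'⟩ := h₁ r' hr'
        exact ⟨f₂ ∘ e', (r'.isQF.realize_embedding f₂).2 he'⟩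
  obtain ⟨M', x, f, hf, hx⟩ := exists_extension.{u, v, max u v, max u v} (T := T) M (id : M → M)
    (fun r : Request T M => Formula.relabel r.a r.φ.exs) fun I₀ => by
      obtain ⟨M', f, h⟩ := hfin I₀
      refine ⟨∅, fun N b δ _ _ hδ hδb => ⟨M', f, ?_, fun r hr => ?_⟩⟩
      · exact (realize_formula_embedding hδ.isQF f b).2 hδb
      · rw [Formula.realize_relabel]
        exact realize_exs.2 (h r hr)
  refine ⟨M', f, fun r => ?_⟩
  have := hx r
  rw [Formula.realize_relabel] at this
  have h' : ⇑f = x := funext hf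
  rw [h']
  exact realize_exs.1 this

/-- An element of the limit that instantiates a universal quantifier already occurs at some stage,
where the formula is true. -/
theorem IsUniversal.realize_directLimit {G : ℕ → Type w} [∀ i, L.Structure (G i)]
    (f : ∀ i, G i ↪[L] G (i + 1)) {n : ℕ} {α : Type*} [Finite α] {φ : L.BoundedFormula α n}
    (hφ : φ.IsUniversal) {i : ℕ} {x : α → G i} {z : Fin n → G i}
    (h : ∀ j (hij : i ≤ j), φ.Realize (DirectedSystem.natLERec f i j hij ∘ x)
      (DirectedSystem.natLERec f i j hij ∘ z)) :
    φ.Realize (Language.DirectLimit.of L ℕ G (DirectedSystem.natLERec f) i ∘ x)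
      (Language.DirectLimit.of L ℕ G (DirectedSystem.natLERec f) i ∘ z) := by
  induction hφ generalizing i with
  | of_isQF hq =>
    rw [hq.realize_embedding]
    have := h i le_rfl
    rwa [hq.realize_embedding] at this
  | all hu ih =>
    rw [realize_all]
    intro u
    obtain ⟨j, y, rfl⟩ := Language.DirectLimit.exists_of u
    -- The tuple and the new element are compared at a common later stage.
    let m := max i j
    have him : i ≤ m := le_max_left _ _
    have hjm : j ≤ m := le_max_right _ _
    have h1 : ∀ (l : ℕ) (hil : i ≤ l) (hml : m ≤ l) (y : G i),
        DirectedSystem.natLERec f m l hml (DirectedSystem.natLERec f i m him y) =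
        DirectedSystem.natLERec f i l hil y := fun l hil hml y =>
      DirectedSystem.map_map' (f := fun i j h => DirectedSystem.natLERec f i j h) him hml y
    have h1' : ∀ (l : ℕ) (hil : i ≤ l) (hml : m ≤ l) {β : Type _} (y : β → G i),
        DirectedSystem.natLERec f m l hml ∘ DirectedSystem.natLERec f i m him ∘ y =
        DirectedSystem.natLERec f i l hil ∘ y := fun l hil hml _ y =>
      funext fun b => h1 l hil hml (y b)
    have h1'' : ∀ (l : ℕ) (hil : i ≤ l) (hml : m ≤ l) {β : Type} (y : β → G i),
        DirectedSystem.natLERec f m l hml ∘ DirectedSystem.natLERec f i m him ∘ y =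
        DirectedSystem.natLERec f i l hil ∘ y := fun l hil hml _ y =>
      funext fun b => h1 l hil hml (y b)
    have h2 := ih (i := m) (x := DirectedSystem.natLERec f i m him ∘ x)
      (z := Fin.snoc (DirectedSystem.natLERec f i m him ∘ z) (DirectedSystem.natLERec f j m hjm y))
      (fun l hml => by
        have h3 := h l (him.trans hml)
        rw [realize_all] at h3
        have h4 := h3 (DirectedSystem.natLERec f m l hml (DirectedSystem.natLERec f j m hjm y))
        rw [Fin.comp_snoc]
        rw [h1' l (him.trans hml) hml x, h1'' l (him.trans hml) hml z]
        exact h4)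
    rw [Fin.comp_snoc] at h2
    have h5 : ∀ (p q : ℕ) (hpq : p ≤ q) (y : G p),
        Language.DirectLimit.of L ℕ G (DirectedSystem.natLERec f) q (DirectedSystem.natLERec f p q hpq y) =
        Language.DirectLimit.of L ℕ G (DirectedSystem.natLERec f) p y := fun p q hpq y =>
      Language.DirectLimit.of_f (f := DirectedSystem.natLERec f)
    have h6 : Language.DirectLimit.of L ℕ G (DirectedSystem.natLERec f) m ∘
        DirectedSystem.natLERec f i m him ∘ x =
        Language.DirectLimit.of L ℕ G (DirectedSystem.natLERec f) i ∘ x := funext fun a => h5 _ _ _ _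
    have h7 : Language.DirectLimit.of L ℕ G (DirectedSystem.natLERec f) m ∘
        DirectedSystem.natLERec f i m him ∘ z =
        Language.DirectLimit.of L ℕ G (DirectedSystem.natLERec f) i ∘ z := funext fun a => h5 _ _ _ _
    rw [h6, h7, h5] at h2
    exact h2

/-- The extension of `T` by the axioms `ψ → ∃ e, φ`, for all covers `ψ`. -/
def coverTheory (T : L.Theory) : L.Theory :=
  T ∪ {σ | ∃ (n k : ℕ) (φ : L.BoundedFormula (Fin n) k) (ψ : L.Formula (Fin n)), φ.IsQF ∧
    IsCover T φ ψ ∧ σ = (BoundedFormula.relabel (Sum.inr : Fin n → Empty ⊕ Fin n)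
      (ψ.imp φ.exs)).alls}

theorem realize_coverAxiom {n k : ℕ} {φ : L.BoundedFormula (Fin n) k} {ψ : L.Formula (Fin n)}
    {M : Type*} [L.Structure M] : M ⊨ ((BoundedFormula.relabel
      (Sum.inr : Fin n → Empty ⊕ Fin n) (ψ.imp φ.exs)).alls : L.Sentence) ↔
      ∀ a : Fin n → M, ψ.Realize a → ∃ e, φ.Realize a e := by
  rw [Sentence.Realize, realize_alls]
  refine forall_congr' fun a => ?_
  refine Iff.trans (Formula.realize_relabel_sumInr (ψ.imp φ.exs)) ?_
  rw [Formula.Realize, realize_imp]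
  exact imp_congr Iff.rfl realize_exs

theorem realize_cover_iff_of_coverTheory {n k : ℕ} {φ : L.BoundedFormula (Fin n) k}
    (hφ : φ.IsQF) {ψ : L.Formula (Fin n)} (hψ : IsCover T φ ψ) (M : Type*) [L.Structure M]
    [hM : M ⊨ coverTheory T] [Nonempty M] (x : Fin n → M) :
    ψ.Realize x ↔ ∃ e, φ.Realize x e := by
  have hT : M ⊨ T := Theory.Model.mono hM Set.subset_union_left
  exact ⟨realize_coverAxiom.1 (hM.realize_of_mem _ (Or.inr ⟨n, k, φ, ψ, hφ, hψ, rfl⟩)) x,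
    fun ⟨e, he⟩ => hψ.realize he⟩

theorem exists_chain (M : Theory.ModelType.{u, v, max u v} T) :
    ∃ (G : ℕ → Theory.ModelType.{u, v, max u v} T) (f : ∀ i : ℕ, Embedding L (G i) (G (i + 1))),
      G 0 = M ∧ ∀ (i : ℕ) (r : Request T (G i)), ∃ e : Fin r.k → G (i + 1),
        r.φ.Realize (f i ∘ r.a) e := by
  choose S g hg using exists_extension_of_requests (T := T)
  exact ⟨fun n => n.rec M fun _ N => S N, fun i => g _, rfl, fun i => hg _⟩

/-- The limit is a model of T because T is universal. A tuple of the limit comes from some stage,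
where the cover still holds by quantifier-freeness; its request is met at the next stage. -/
theorem exists_embedding_coverTheory [hu : T.IsUniversal] (M : Theory.ModelType.{u, v, max u v} T) :
    ∃ M' : Theory.ModelType.{u, v, max u v} (coverTheory T), Nonempty (M ↪[L] M') := by
  classical
  obtain ⟨G, f, rfl, hf⟩ := exists_chain M
  let D := Language.DirectLimit (fun i => (G i : Type (max u v))) (DirectedSystem.natLERec f)
  let o : ∀ i, G i ↪[L] D := Language.DirectLimit.of L ℕ (fun i => (G i : Type (max u v)))
    (DirectedSystem.natLERec f)
  have ho : ∀ i (y : G i), o (i + 1) (f i y) = o i y := by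
    intro i y
    have := Language.DirectLimit.of_f (f := DirectedSystem.natLERec f) (hij := i.le_succ) (x := y)
    rw [← this]
    congr 1
    rw [DirectedSystem.coe_natLERec]
    exact (Nat.leRecOn_succ' (C := fun i => (G i : Type (max u v)))
      (next := fun {k} => f k) y).symm
  have hD : Nonempty D := (inferInstance : Nonempty (G 0)).map (o 0)
  have hDT : D ⊨ T := by
    rw [Theory.model_iff]
    intro φ hφ
    have := IsUniversal.realize_directLimit (G := fun i => (G i : Type (max u v))) f
      (hu.isUniversal_of_mem hφ) (i := 0) (x := default) (z := default) fun j hj => by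
        have h1 : (G j) ⊨ φ := Theory.realize_sentence_of_mem T hφ
        rw [Sentence.Realize, Formula.Realize] at h1
        convert! h1
    rw [Sentence.Realize, Formula.Realize]
    convert! this
  have hDc : D ⊨ coverTheory T := by
    refine Theory.Model.union hDT ?_
    rw [Theory.model_iff]
    rintro _ ⟨n, k, φ, ψ, hφ, hψ, rfl⟩
    refine realize_coverAxiom.2 fun a ha => ?_
    obtain ⟨i, y, rfl⟩ : ∃ (i : ℕ) (y : Fin n → G i), a = o i ∘ y :=
      Language.DirectLimit.exists_quotient_mk'_sigma_mk'_eq (fun i => (G i : Type (max u v)))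
        (DirectedSystem.natLERec f) a
    obtain ⟨e, he⟩ := hf i ⟨n, k, φ, ψ, hφ, hψ, y,
      (realize_formula_embedding hψ.1.1 (o i) y).1 ha⟩
    refine ⟨o (i + 1) ∘ e, ?_⟩
    have := (hφ.realize_embedding (o (i + 1))).2 he
    convert! this using 1
    funext t
    exact (ho i (y t)).symm
  exact ⟨Theory.ModelType.of _ D, ⟨o 0⟩⟩

theorem satisfiableIn_coverTheory [T.IsUniversal] {n : ℕ} {δ : L.Formula (Fin n)}
    (hδ : IsConstraint δ) (h : SatisfiableIn T δ) : SatisfiableIn (coverTheory T) δ := by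
  obtain ⟨M, x, hx⟩ := h
  obtain ⟨M', ⟨f⟩⟩ := exists_embedding_coverTheory M
  exact ⟨M', f ∘ x, (realize_formula_embedding hδ.isQF f x).2 hx⟩

end Completion

/-! ### Oracles, and quantifier elimination from covers. -/

section Elimination

variable {L : FirstOrder.Language.{u, v}}

/-- `F s` is an algorithm with fuel `s` which computes covers. -/
def CoverOracle (c : SymbolCoding L) (T : L.Theory) (F : ℕ → ℕ × ℕ × ℕ → Option ℕ) : Prop :=
  ∀ (n k : ℕ) (φ : L.BoundedFormula (Fin n) k), φ.IsQF →
    ∃ ψ : L.Formula (Fin n), IsCover T φ ψ ∧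
      Conv (fun s => F s (n, k, codeFormula c φ)) (codeFormula c ψ)

/-- `F s` is an algorithm with fuel `s` which computes explicit definitions. -/
def BethOracle (c : SymbolCoding L) (T : L.Theory) (F : ℕ → ℕ × ℕ × ℕ × ℕ → Option ℕ) : Prop :=
  ∀ (n k : ℕ) (φ : L.BoundedFormula (Fin n) k) (i : Fin k), IsConstraint φ →
    ImplicitlyDefines T φ i →
      ∃ t : L.Term (Fin n), ExplicitlyDefines T φ i t ∧
        Conv (fun s => F s (n, k, (i : ℕ), codeFormula c φ)) (codeTerm c t)

theorem HasComputableCovers.exists_oracle {c : SymbolCoding L} {T : L.Theory}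
    (h : HasComputableCovers c T) : ∃ F, CoverOracle c T F ∧
      Primrec fun p : ℕ × ℕ × ℕ × ℕ => F p.1 p.2 := by
  obtain ⟨f, hf, h⟩ := h
  obtain ⟨A, hA, hA'⟩ := exists_fuel_of_partrec hf
  exact ⟨A, fun n k φ hφ => let ⟨ψ, h1, h2⟩ := h n k φ hφ; ⟨ψ, h1, hA' _ _ h2⟩, hA⟩

theorem HasComputableBethTerms.exists_oracle {c : SymbolCoding L} {T : L.Theory}
    (h : HasComputableBethTerms c T) : ∃ F, BethOracle c T F ∧
      Primrec fun p : ℕ × ℕ × ℕ × ℕ × ℕ => F p.1 p.2 := by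
  obtain ⟨f, hf, h⟩ := h
  obtain ⟨A, hA, hA'⟩ := exists_fuel_of_partrec hf
  exact ⟨A, fun n k φ i hφ hi => let ⟨ψ, h1, h2⟩ := h n k φ i hφ hi; ⟨ψ, h1, hA' _ _ h2⟩, hA⟩

/-- Choice gives an oracle that ignores its fuel and need not be computable; the existence
statements follow by running the algorithms on it. -/
theorem HasCovers.exists_oracle (c : SymbolCoding L) {T : L.Theory} (h : HasCovers T) :
    ∃ F, CoverOracle c T F := by
  classical
  choose ψ hψ using h
  refine ⟨fun _ p => if h : ∃ φ : L.BoundedFormula (Fin p.1) p.2.1, φ.IsQF ∧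
      codeFormula c φ = p.2.2 then some (codeFormula c (ψ _ _ h.choose h.choose_spec.1)) else none,
    fun n k φ hφ => ⟨ψ n k φ hφ, hψ n k φ hφ, ?_⟩⟩
  have h : ∃ φ' : L.BoundedFormula (Fin n) k, φ'.IsQF ∧ codeFormula c φ' = codeFormula c φ :=
    ⟨φ, hφ, rfl⟩
  have h' : h.choose = φ := codeFormula_injective c h.choose_spec.2
  simp only [dif_pos h]
  convert! Conv.const _ using 4
  exact h'.symm

/-- The Beth property: interpolate the equality between the values of slot `i` in two copies of φ
over the same parameters. -/
theorem IsEqualityInterpolating.exists_explicitlyDefines {T : L.Theory}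
    (h : IsEqualityInterpolating T) {n k : ℕ} {φ : L.BoundedFormula (Fin n) k}
    (hφ : IsConstraint φ) {i : Fin k} (hi : ImplicitlyDefines T φ i) :
    ∃ t, ExplicitlyDefines T φ i t := by
  obtain ⟨t, ht⟩ := h n k k φ φ i i hφ hφ hi
  exact ⟨t, fun M x z hz => (ht M x z z hz hz).1⟩

/-- The input numbers determine the constraint and the slot, so a chosen Beth term defines the
intended slot. -/
theorem IsEqualityInterpolating.exists_oracle (c : SymbolCoding L) {T : L.Theory}
    (h : IsEqualityInterpolating T) : ∃ F, BethOracle c T F := by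
  classical
  have h0 : ∀ (p : ℕ × ℕ × ℕ × ℕ), (∃ (φ : L.BoundedFormula (Fin p.1) p.2.1) (i : Fin p.2.1),
      IsConstraint φ ∧ ImplicitlyDefines T φ i ∧ (i : ℕ) = p.2.2.1 ∧
      codeFormula c φ = p.2.2.2) → ∃ (t : L.Term (Fin p.1)),
      ∀ (φ : L.BoundedFormula (Fin p.1) p.2.1) (i : Fin p.2.1), (i : ℕ) = p.2.2.1 →
      codeFormula c φ = p.2.2.2 → ExplicitlyDefines T φ i t := by
    rintro p ⟨φ, i, h1, h2, h3, h4⟩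
    obtain ⟨t, ht⟩ := h.exists_explicitlyDefines h1 h2
    refine ⟨t, fun φ' i' h3' h4' => ?_⟩
    obtain rfl := codeFormula_injective c (h4.trans h4'.symm)
    obtain rfl := Fin.ext (h3.trans h3'.symm)
    exact ht
  choose t ht using h0
  refine ⟨fun _ p => if h : _ then some (codeTerm c (t p h)) else none, fun n k φ i hφ hi => ?_⟩
  have h1 : ∃ (φ' : L.BoundedFormula (Fin n) k) (i' : Fin k),
      IsConstraint φ' ∧ ImplicitlyDefines T φ' i' ∧ (i' : ℕ) = i ∧
      codeFormula c φ' = codeFormula c φ := ⟨φ, i, hφ, hi, rfl, rfl⟩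
  refine ⟨t (n, k, i, codeFormula c φ) h1, ht (n, k, i, codeFormula c φ) h1 φ i rfl rfl, ?_⟩
  simp only [dif_pos h1]
  exact Conv.const _

/-- In formulas the free variable i thus has number 2i and the bound slot j has number 2j + 1, which
explains the arithmetic in the code-level renamings. Terms outside formulas number the variable i by
i itself. -/
theorem encode_fin {n : ℕ} (i : Fin n) : Encodable.encode i = (i : ℕ) := rfl

theorem codeFormula_ren (c : SymbolCoding L) {α β : Type*} [Encodable α] [Encodable β] {k l : ℕ}
    {g : α ⊕ Fin k → β ⊕ Fin l} {V : ℕ → ℕ}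
    (hV : ∀ x, cVar (Encodable.encode (g x)) = V (Encodable.encode x))
    {φ : L.BoundedFormula α k} (hφ : φ.IsQF) :
    codeFormula c (ren g φ) = cTransQF 1 0 V (codeFormula c φ) :=
  codeFormula_transQF (tracks_id c) (fun x => by rw [codeTerm_var, hV]) hφ

/-- Turn all bound variable slots but the last into free variables. -/
def freeInit (n k : ℕ) : Fin n ⊕ Fin (k + 1) → Fin (n + k) ⊕ Fin 1 :=
  Sum.elim (fun i => Sum.inl (i.castAdd k)) (Fin.lastCases (Sum.inr 0) fun j => Sum.inl (j.natAdd n))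

/-- Turn the last `k` free variables into bound variable slots. -/
def bindLast (n k : ℕ) : Fin (n + k) ⊕ Fin 0 → Fin n ⊕ Fin k :=
  Sum.elim (Fin.addCases Sum.inl Sum.inr) Fin.elim0

/-- `freeInit` on Gödel numbers. -/
def cFreeInit (n k v : ℕ) : ℕ :=
  if v % 2 = 0 then cVar v else if v / 2 < k then cVar (2 * (n + v / 2)) else cVar 1

/-- `bindLast` on Gödel numbers. -/
def cBindLast (n v : ℕ) : ℕ := if v / 2 < n then cVar v else cVar (2 * (v / 2 - n) + 1)

@[fun_prop] theorem primrec_cFreeInit {P : Type*} [Primcodable P] {n k v : P → ℕ} (hn : Primrec n)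
    (hk : Primrec k) (hv : Primrec v) : Primrec fun p => cFreeInit (n p) (k p) (v p) := by
  unfold cFreeInit; fun_prop

@[fun_prop] theorem primrec_cBindLast {P : Type*} [Primcodable P] {n v : P → ℕ} (hn : Primrec n)
    (hv : Primrec v) : Primrec fun p => cBindLast (n p) (v p) := by
  unfold cBindLast; fun_prop

/-- Quantifier elimination on Gödel numbers: the list of the outputs for a formula with
`k = 0, …, s` bound variable slots. -/
def cElim (F : ℕ × ℕ × ℕ → Option ℕ) (s n φ : ℕ) : List (Option ℕ) :=
  formFold ((List.range (s + 1)).map fun _ => some cFalsum)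
    (fun a b => (List.range (s + 1)).map fun _ => some (cEq a b))
    (fun R l => (List.range (s + 1)).map fun _ => some (cRel R l))
    (fun p q => (List.range (s + 1)).map fun k =>
      (p.getD k none).bind fun a => (q.getD k none).map fun b => cImp a b)
    -- A code does not reveal the number of slots, so all values up to the fuel are carried along. ∀
    -- is treated as ¬∃¬: entry `k` uses entry `k + 1` of the body, with the innermost slot as the
    -- single existential variable and the other slots made free.
    (fun p => (List.range (s + 1)).map fun k =>
      (p.getD (k + 1) none).bind fun a =>
        (F (n + k, 1, cTransQF 1 0 (cFreeInit n k) (cNot a))).map fun q =>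
        cNot (cTransQF 1 0 (cBindLast n) q))
    φ

theorem getD_map_range {β : Type*} (f : ℕ → Option β) (s k : ℕ) :
    ((List.range s).map f).getD k none = if k < s then f k else none := by
  rw [List.getD_eq_getElem?_getD, List.getElem?_map]
  split_ifs with h
  · simp [List.getElem?_range h]
  · rw [List.getElem?_eq_none (by simpa using h)]
    rfl

/-- The fuel also bounds the number of slots considered; any fixed number is eventually within the
bound. -/
theorem Conv.guard {β : Type*} {F : ℕ → Option β} {y : β} (h : Conv F y) (k : ℕ) :
    Conv (fun s => if k < s + 1 then F s else none) y := by
  obtain ⟨h1, s0, h2⟩ := h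
  refine ⟨fun s => ?_, max s0 k, fun s hs => ?_⟩
  · dsimp only
    split_ifs
    exacts [h1 s, Or.inl rfl]
  · dsimp only
    rw [if_pos (by omega), h2 s (by omega)]

@[fun_prop] theorem primrec_cElim {P : Type*} [Primcodable P] {F : P → ℕ × ℕ × ℕ → Option ℕ}
    {s n φ : P → ℕ} (hF : Primrec fun p : P × ℕ × ℕ × ℕ => F p.1 p.2) (hs : Primrec s)
    (hn : Primrec n) (hφ : Primrec φ) : Primrec fun p => cElim (F p) (s p) (n p) (φ p) := by
  have h2 : Primrec fun p : ((P × List (Option ℕ)) × ℕ) × ℕ => F p.1.1.1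
      (n p.1.1.1 + p.1.2, 1, cTransQF 1 0 (cFreeInit (n p.1.1.1) p.1.2) (cNot p.2)) :=
    hF.comp (g := fun p : ((P × List (Option ℕ)) × ℕ) × ℕ => (p.1.1.1,
      n p.1.1.1 + p.1.2, 1, cTransQF 1 0 (cFreeInit (n p.1.1.1) p.1.2) (cNot p.2)))
      (by fun_prop)
  unfold cElim
  fun_prop

/-- In models of the cover axioms a cover of ∃¬φ is equivalent to it, so its negation is equivalent
to ∀φ. -/
theorem realize_all_iff_not_exists {T : L.Theory} {n k : ℕ} {φ : L.BoundedFormula (Fin n) (k + 1)}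
    (hφ : φ.IsQF) {q : L.Formula (Fin (n + k))} {M : Type*} [L.Structure M] [M ⊨ coverTheory T]
    [Nonempty M] (hq : IsCover T (ren (freeInit n k) φ.not) q) (x : Fin n → M) (z : Fin k → M) :
    (ren (bindLast n k) q).not.Realize x z ↔ φ.all.Realize x z := by
  rw [realize_not, realize_ren _ hq.1.1, realize_all, not_iff_comm]
  refine Iff.trans ?_ (Iff.trans (realize_cover_iff_of_coverTheory (isQF_ren _ hφ.not) hq M
    (fun a => Sum.elim x z (bindLast n k (Sum.inl a)))).symm
    (iff_of_eq (congrArg (BoundedFormula.Realize q _) (Subsingleton.elim _ _))))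
  rw [not_forall]
  have key : ∀ e : Fin 1 → M, (ren (freeInit n k) φ.not).Realize
      (fun a => Sum.elim x z (bindLast n k (Sum.inl a))) e ↔ ¬ φ.Realize x (Fin.snoc z (e 0)) := by
    intro e
    rw [realize_ren _ hφ.not, realize_not]
    refine not_congr (iff_of_eq (congrArg₂ _ ?_ ?_))
    · funext i
      simp [freeInit, bindLast]
    · funext j
      refine Fin.lastCases ?_ (fun j => ?_) j
      · simp [freeInit]
      · simp [freeInit, bindLast]
  constructor
  · rintro ⟨a, ha⟩
    exact ⟨fun _ => a, (key _).2 ha⟩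
  · rintro ⟨e, he⟩
    exact ⟨e 0, (key _).1 he⟩

theorem exists_conv_cElim {c : SymbolCoding L} {T : L.Theory} {F : ℕ → ℕ × ℕ × ℕ → Option ℕ}
    (hF : CoverOracle c T F) {n k : ℕ} (φ : L.BoundedFormula (Fin n) k) :
    ∃ φ' : L.BoundedFormula (Fin n) k, φ'.IsQF ∧
      (∀ (M : Type (max u v)) [L.Structure M] [M ⊨ coverTheory T] [Nonempty M] (x : Fin n → M)
        (z : Fin k → M), φ'.Realize x z ↔ φ.Realize x z) ∧
      Conv (fun s => (cElim (F s) s n (codeFormula c φ)).getD k none) (codeFormula c φ') := by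
  induction φ with
  | falsum =>
    refine ⟨falsum, IsQF.falsum, fun _ _ _ _ _ _ => Iff.rfl, ?_⟩
    simp only [cElim, codeFormula_falsum, formFold_cFalsum, getD_map_range]
    exact (Conv.const _).guard _
  | equal s t =>
    refine ⟨equal s t, (IsAtomic.equal _ _).isQF, fun _ _ _ _ _ _ => Iff.rfl, ?_⟩
    simp only [cElim, codeFormula_equal, formFold_cEq, getD_map_range]
    exact (Conv.const _).guard _
  | rel R ts =>
    refine ⟨rel R ts, (IsAtomic.rel _ _).isQF, fun _ _ _ _ _ _ => Iff.rfl, ?_⟩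
    simp only [cElim, codeFormula_rel, formFold_cRel, getD_map_range]
    exact (Conv.const _).guard _
  | imp φ ψ ih₁ ih₂ =>
    obtain ⟨φ', hφ, hφr, hφc⟩ := ih₁
    obtain ⟨ψ', hψ, hψr, hψc⟩ := ih₂
    refine ⟨φ'.imp ψ', hφ.imp hψ, fun M _ _ _ x z => ?_, ?_⟩
    · rw [realize_imp, realize_imp, hφr, hψr]
    · simp only [cElim, codeFormula_imp, formFold_cImp, getD_map_range] at hφc hψc ⊢
      exact (hφc.bind (hψc.map _)).guard _
  | @all k φ ih =>
    obtain ⟨φ', hφ, hφr, hφc⟩ := ih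
    obtain ⟨q, hq, hqc⟩ := hF _ _ _ (isQF_ren (freeInit n k) hφ.not)
    refine ⟨(ren (bindLast n k) q).not, (isQF_ren _ hq.1.1).not, fun M _ _ _ x z => ?_, ?_⟩
    · rw [realize_all_iff_not_exists hφ hq, realize_all, realize_all]
      exact forall_congr' fun a => hφr M _ _
    · rw [codeFormula_ren c (V := cFreeInit n k) _ hφ.not,
          codeFormula_not] at hqc
      · rw [codeFormula_not, codeFormula_ren c (V := cBindLast n) _ hq.1.1]
        · simp only [cElim, codeFormula_all, formFold_cAll, getD_map_range]
          refine Conv.guard (Conv.bind hφc ?_) _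
          exact hqc.map _
        · rintro (a | a)
          · refine Fin.addCases (fun i => ?_) (fun j => ?_) a
            · simp [bindLast, cBindLast, encode_fin]
            · simp [bindLast, cBindLast, encode_fin]
          · exact a.elim0
      · rintro (a | a)
        · simp [freeInit, cFreeInit, encode_fin]
        · refine Fin.lastCases ?_ (fun j => ?_) a
          · have h1 : (2 * k + 1) / 2 = k := by omega
            simp [freeInit, cFreeInit, encode_fin, h1]
          · have h1 : (2 * (j : ℕ) + 1) / 2 = j := by omega
            simp [freeInit, cFreeInit, encode_fin, h1]

theorem isQFEquivalent_of_realize_iff {T : L.Theory} {n : ℕ} {φ φ' : L.Formula (Fin n)}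
    (h : φ'.IsQF) (hr : ∀ (M : Type (max u v)) [L.Structure M] [M ⊨ T] [Nonempty M]
      (x : Fin n → M) (z : Fin 0 → M), BoundedFormula.Realize φ' x z ↔ BoundedFormula.Realize φ x z) :
    IsQFEquivalent T φ φ' :=
  ⟨h, fun M x z => by rw [realize_iff]; exact (hr M x z).symm⟩

theorem hasQE_coverTheory (c : SymbolCoding L) {T : L.Theory} (h : HasCovers T) :
    HasQE (coverTheory T) := fun n φ => by
  obtain ⟨F, hF⟩ := h.exists_oracle c
  obtain ⟨φ', h1, h2, -⟩ := exists_conv_cElim hF φ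
  exact ⟨φ', isQFEquivalent_of_realize_iff h1 h2⟩

theorem isModelCompletion_coverTheory (c : SymbolCoding L) {T : L.Theory} [T.IsUniversal]
    (h : HasCovers T) : IsModelCompletion T (coverTheory T) where
  subset := Set.subset_union_left
  satisfiable _ _ := satisfiableIn_coverTheory
  qe := hasQE_coverTheory c h

theorem hasComputableQE_coverTheory {c : SymbolCoding L} {T : L.Theory}
    (h : HasComputableCovers c T) : HasComputableQE c (coverTheory T) := by
  obtain ⟨F, hF, hFp⟩ := h.exists_oracle
  have h1 {Q : Type _} [Primcodable Q] (f : Q → ℕ) (g : Q → ℕ × ℕ × ℕ) (hf : Primrec f)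
    (hg : Primrec g) : Primrec fun q => F (f q) (g q) := hFp.comp (hf.pair hg)
  obtain ⟨f, hf, hf'⟩ := exists_partrec_of_conv
    (A := fun s (p : ℕ × ℕ) => (cElim (F s) s p.1 p.2).getD 0 none) (by
      have h2 : Primrec fun p : (ℕ × ℕ × ℕ) × ℕ × ℕ × ℕ => F p.1.1 p.2 :=
        h1 _ _ (by fun_prop) (by fun_prop)
      fun_prop)
  refine ⟨f, hf, fun n φ => ?_⟩
  obtain ⟨φ', h1, h2, h3⟩ := exists_conv_cElim hF φ
  exact ⟨φ', isQFEquivalent_of_realize_iff h1 h2, hf' (n, codeFormula c φ) _ h3⟩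

end Elimination

/-- Outputs are known only up to a property relating them to their inputs, so the chosen outputs are
recorded in pairs with the inputs. -/
theorem Conv.exists_optMapM {ι α β Y : Type*} {F : ℕ → α → Option β} (l : List ι) (x : ι → α)
    (P : ι → Y → Prop) (y : ι → Y → β)
    (h : ∀ i ∈ l, ∃ a, P i a ∧ Conv (fun s => F s (x i)) (y i a)) :
    ∃ ys : List (ι × Y), (∀ q ∈ ys, q.1 ∈ l ∧ P q.1 q.2) ∧ (∀ i ∈ l, ∃ a, (i, a) ∈ ys) ∧
      Conv (fun s => Covers.optMapM (F s) (l.map x)) (ys.map fun q => y q.1 q.2) := by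
  choose a ha hc using h
  refine ⟨l.attach.map fun i => (i.1, a i.1 i.2), ?_, fun i hi => ⟨a i hi, ?_⟩, ?_⟩
  · intro q hq
    obtain ⟨i, -, rfl⟩ := List.mem_map.1 hq
    exact ⟨i.2, ha _ _⟩
  · exact List.mem_map.2 ⟨⟨i, hi⟩, List.mem_attach _ _, rfl⟩
  · have := Conv.optMapM (F := F) l.attach (fun i => x i.1) (fun i => y i.1 (a i.1 i.2))
      fun i _ => hc i.1 i.2
    simpa [List.map_map, Function.comp_def] using this

/-! ### Splitting a constraint by implicit definability of its slots. -/

section Splits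

variable {L : FirstOrder.Language.{u, v}}

/-- `φ` forces the values of the bound variable slots to be distinct. -/
def ForcesInjective {m k : ℕ} (φ : L.BoundedFormula (Fin m) k) : Prop :=
  ∀ (M : Theory.ModelType.{u, v, max u v} (∅ : L.Theory)) (x : Fin m → M) (z : Fin k → M),
    φ.Realize x z → Function.Injective z

/-- Two copies of `ψ` with distinct values in slot `i`. -/
def double {m k : ℕ} (i : Fin k) (ψ : L.BoundedFormula (Fin m) k) :
    L.BoundedFormula (Fin m) (k + k) :=
  ren (Sum.map id (Fin.castAdd k)) ψ ⊓ ren (Sum.map id (Fin.natAdd k)) ψ ⊓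
    (eqVar (Sum.inr (i.castAdd k)) (Sum.inr (i.natAdd k))).not

/-- `ψ` restricted by a conjunction of literals in the free variables. -/
def restrict {m k : ℕ} (ψ : L.BoundedFormula (Fin m) k) (ls : List (L.Formula (Fin m))) :
    L.BoundedFormula (Fin m) k :=
  ψ ⊓ ren (Sum.map id Fin.elim0) (conj ls)

theorem isQF_double {m k : ℕ} (i : Fin k) {ψ : L.BoundedFormula (Fin m) k} (h : ψ.IsQF) :
    (double i ψ).IsQF :=
  ((isQF_ren _ h).inf (isQF_ren _ h)).inf (isLiteral_not_eqVar _ _).isQF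

theorem exists_realize_double {m k : ℕ} (i : Fin k) {ψ : L.BoundedFormula (Fin m) k} (h : ψ.IsQF)
    {M : Type*} [L.Structure M] (x : Fin m → M) :
    (∃ e, (double i ψ).Realize x e) ↔ ∃ z z', ψ.Realize x z ∧ ψ.Realize x z' ∧ z i ≠ z' i := by
  have key : ∀ e : Fin (k + k) → M, (double i ψ).Realize x e ↔
      ψ.Realize x (fun j => e (j.castAdd k)) ∧ ψ.Realize x (fun j => e (j.natAdd k)) ∧
        e (i.castAdd k) ≠ e (i.natAdd k) := by
    intro e
    rw [double, realize_inf, realize_inf, realize_ren _ h, realize_ren _ h, realize_not,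
      realize_eqVar, and_assoc]
    rfl
  constructor
  · rintro ⟨e, he⟩
    obtain ⟨h1, h2, h3⟩ := (key e).1 he
    exact ⟨_, _, h1, h2, h3⟩
  · rintro ⟨z, z', h1, h2, h3⟩
    exact ⟨Fin.append z z', (key _).2 (by
      simpa only [Fin.append_left, Fin.append_right] using ⟨h1, h2, h3⟩)⟩

theorem isConstraint_restrict {m k : ℕ} {ψ : L.BoundedFormula (Fin m) k} (h : IsConstraint ψ)
    {ls : List (L.Formula (Fin m))} (hls : ∀ φ ∈ ls, IsLiteral φ) :
    IsConstraint (restrict ψ ls) :=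
  h.inf (isConstraint_ren _ (isConstraint_conj fun φ hφ => .literal (hls φ hφ)))

theorem realize_restrict {m k : ℕ} {ψ : L.BoundedFormula (Fin m) k}
    {ls : List (L.Formula (Fin m))} (hls : ∀ φ ∈ ls, IsLiteral φ) {M : Type*} [L.Structure M]
    (x : Fin m → M) (z : Fin k → M) :
    (restrict ψ ls).Realize x z ↔ ψ.Realize x z ∧ ∀ φ ∈ ls, φ.Realize x := by
  rw [restrict, realize_inf, realize_ren _ (isQF_conj fun φ hφ => (hls φ hφ).isQF), realize_conj]
  refine and_congr_right fun _ => forall₂_congr fun φ _ => ?_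
  exact iff_of_eq (congrArg (BoundedFormula.Realize φ _) (Subsingleton.elim _ _))

/-- `double` on Gödel numbers. -/
def cDouble (k i ψ : ℕ) : ℕ :=
  cAnd (cAnd (cTransQF 1 0 cVar ψ)
    (cTransQF 1 0 (fun v => if v % 2 = 0 then cVar v else cVar (v + 2 * k)) ψ))
    (cNot (cEq (cVar (2 * i + 1)) (cVar (2 * (k + i) + 1))))

/-- `restrict` on Gödel numbers. -/
def cRestrict (ψ : ℕ) (ls : List ℕ) : ℕ := cAnd ψ (cTransQF 1 0 cVar (cConj ls))

@[fun_prop] theorem primrec_cDouble {P : Type*} [Primcodable P] {k i ψ : P → ℕ} (hk : Primrec k)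
    (hi : Primrec i) (hψ : Primrec ψ) : Primrec fun p => cDouble (k p) (i p) (ψ p) := by
  unfold cDouble; fun_prop

@[fun_prop] theorem primrec_cRestrict {P : Type*} [Primcodable P] {ψ : P → ℕ} {ls : P → List ℕ}
    (hψ : Primrec ψ) (hls : Primrec ls) : Primrec fun p => cRestrict (ψ p) (ls p) := by
  unfold cRestrict; fun_prop

theorem codeFormula_double (c : SymbolCoding L) {m k : ℕ} (i : Fin k)
    {ψ : L.BoundedFormula (Fin m) k} (h : ψ.IsQF) :
    codeFormula c (double i ψ) = cDouble k i (codeFormula c ψ) := by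
  rw [double, codeFormula_inf, codeFormula_inf, codeFormula_not, eqVar, codeFormula_equal,
    codeFormula_ren c (V := cVar) _ h,
    codeFormula_ren c (V := fun v => if v % 2 = 0 then cVar v else cVar (v + 2 * k)) _ h]
  · simp [cDouble, encode_fin, add_comm]
  · rintro (a | a)
    · simp
    · have : 2 * ((a : ℕ) + k) + 1 = 2 * a + 1 + 2 * k := by ring
      simp [encode_fin, this]
  · rintro (a | a) <;> simp [encode_fin]

theorem codeFormula_restrict (c : SymbolCoding L) {m k : ℕ}
    (ψ : L.BoundedFormula (Fin m) k) {ls : List (L.Formula (Fin m))}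
    (hls : ∀ φ ∈ ls, IsLiteral φ) :
    codeFormula c (restrict ψ ls) = cRestrict (codeFormula c ψ) (ls.map (codeFormula c)) := by
  rw [restrict, codeFormula_inf,
    codeFormula_ren c (V := cVar) _ (isQF_conj fun φ hφ => (hls φ hφ).isQF), codeFormula_conj]
  · rfl
  · rintro (a | a)
    · simp
    · exact a.elim0

theorem ExplicitlyDefines.realize {T : L.Theory} {m k : ℕ} {φ : L.BoundedFormula (Fin m) k}
    {i : Fin k} {t : L.Term (Fin m)} (h : ExplicitlyDefines T φ i t) {M : Type*} [L.Structure M]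
    [M ⊨ T] [Nonempty M] {x : Fin m → M} {z : Fin k → M} (hz : φ.Realize x z) :
    z i = t.realize x := by
  have h1 : T ⊨ᵇ φ.imp (equal (Term.var (Sum.inr i)) (t.relabel Sum.inl)) := fun M x z => by
    rw [realize_imp]
    intro hz
    simpa [Realize, Function.comp_def] using h M x z hz
  have := h1.realize_boundedFormula M (v := x) (xs := z)
  rw [realize_imp] at this
  simpa [Realize, Function.comp_def] using this hz

/-- Split a constraint into constraints which define one of the slots, together with the
definition, and constraints which define none of the slots. -/
def cSplits (Fc : ℕ × ℕ × ℕ → Option ℕ) (Fb : ℕ × ℕ × ℕ × ℕ → Option ℕ) (m k ψ : ℕ) :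
    Option (List (ℕ × ℕ × ℕ) × List ℕ) :=
  (optMapM (fun i => Fc (m, k + k, cDouble k i ψ)) (List.range k)).bind fun Cs =>
    (optMapM (fun p : ℕ × ℕ => (Fb (m, k, p.1, p.2)).map fun t => (p.1, p.2, t))
      ((List.range k).flatMap fun i => (cDnf (Cs.getD i 0)).2.map fun ls =>
        (i, cRestrict ψ ls))).map fun conts =>
      (conts, (cDnf (cConj Cs)).1.map fun ls => cRestrict ψ ls)

@[fun_prop] theorem primrec_cSplits {P : Type*} [Primcodable P] {Fc : P → ℕ × ℕ × ℕ → Option ℕ}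
    {Fb : P → ℕ × ℕ × ℕ × ℕ → Option ℕ} {m k ψ : P → ℕ}
    (hFc : Primrec fun p : P × ℕ × ℕ × ℕ => Fc p.1 p.2)
    (hFb : Primrec fun p : P × ℕ × ℕ × ℕ × ℕ => Fb p.1 p.2) (hm : Primrec m) (hk : Primrec k)
    (hψ : Primrec ψ) : Primrec fun p => cSplits (Fc p) (Fb p) (m p) (k p) (ψ p) := by
  have h1 : Primrec fun p : P × ℕ => Fc p.1 (m p.1, k p.1 + k p.1, cDouble (k p.1) p.2 (ψ p.1)) :=
    hFc.comp (g := fun p : P × ℕ => (p.1, m p.1, k p.1 + k p.1, cDouble (k p.1) p.2 (ψ p.1)))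
      (by fun_prop)
  have h2 : Primrec fun p : (P × List ℕ) × ℕ × ℕ => Fb p.1.1 (m p.1.1, k p.1.1, p.2.1, p.2.2) :=
    hFb.comp (g := fun p : (P × List ℕ) × ℕ × ℕ => (p.1.1, m p.1.1, k p.1.1, p.2.1, p.2.2))
      (by fun_prop)
  unfold cSplits
  fun_prop

/-- Let C i be a cover of "ψ has two realizations that differ at slot i". Disjuncts of ¬C i restrict
ψ to a constraint that implicitly defines slot i, for which a Beth term exists. Disjuncts of the
conjunction of all C i restrict it to terminal constraints. -/
theorem exists_conv_cSplits {c : SymbolCoding L} {T : L.Theory} [T.IsUniversal]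
    (hmc : HasModelCompletion T)
    {Fc : ℕ → ℕ × ℕ × ℕ → Option ℕ} {Fb : ℕ → ℕ × ℕ × ℕ × ℕ → Option ℕ} (hFc : CoverOracle c T Fc)
    (hFb : BethOracle c T Fb) {m k : ℕ} {ψ : L.BoundedFormula (Fin m) k} (hψ : IsConstraint ψ)
    (hψd : ForcesInjective ψ) :
    ∃ (conts : List ((Fin k × L.BoundedFormula (Fin m) k) × L.Term (Fin m)))
      (terms : List (L.BoundedFormula (Fin m) k)),
      (∀ q ∈ conts, IsConstraint q.1.2 ∧ ForcesInjective q.1.2 ∧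
        ExplicitlyDefines T q.1.2 q.1.1 q.2) ∧
      (∀ ψ' ∈ terms, IsTerminalFor T ψ') ∧
      (∀ (M : Type w) [L.Structure M] (x : Fin m → M) (z : Fin k → M), ψ.Realize x z ↔
        (∃ q ∈ conts, q.1.2.Realize x z) ∨ ∃ ψ' ∈ terms, ψ'.Realize x z) ∧
      Conv (fun s => cSplits (Fc s) (Fb s) m k (codeFormula c ψ))
        (conts.map fun q => ((q.1.1 : ℕ), codeFormula c q.1.2, codeTerm c q.2),
          terms.map (codeFormula c)) := by
  choose C hC hCc using fun i => hFc _ _ _ (isQF_double i hψ.isQF)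
  have hCq : (conj ((List.finRange k).map C)).IsQF := isQF_conj fun φ hφ => by
    obtain ⟨i, -, rfl⟩ := List.mem_map.1 hφ
    exact (hC i).1.1
  have hdist : ∀ ls : List (L.Formula (Fin m)), (∀ φ ∈ ls, IsLiteral φ) →
      ForcesInjective (restrict ψ ls) := fun ls hls M x z h =>
    hψd M x z ((realize_restrict hls _ _).1 h).1
  let l : List (Fin k × L.BoundedFormula (Fin m) k) :=
    (List.finRange k).flatMap fun i => (dnf (C i)).2.map fun ls => (i, restrict ψ ls)
  have hmem : ∀ p, p ∈ l ↔ ∃ ls ∈ (dnf (C p.1)).2, p.2 = restrict ψ ls := by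
    rintro ⟨i, φ⟩
    simp only [l, List.mem_flatMap, List.mem_finRange, true_and, List.mem_map, Prod.mk.injEq]
    constructor
    · rintro ⟨_, ls, h, rfl, rfl⟩
      exact ⟨ls, h, rfl⟩
    · rintro ⟨ls, h, rfl⟩
      exact ⟨i, ls, h, rfl, rfl⟩
  -- Two realizations differing at `i` would make the cover C i true, while `ls` implies its
  -- negation.
  have himpl : ∀ (i : Fin k), ∀ ls ∈ (dnf (C i)).2, ImplicitlyDefines T (restrict ψ ls) i := by
    intro i ls hls M x z z' hz hz'
    rw [realize_restrict (isLiteral_of_mem_dnf.2 ls hls)] at hz hz'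
    by_contra hne
    obtain ⟨e, he⟩ := (exists_realize_double i hψ.isQF x).2 ⟨z, z', hz.1, hz'.1, hne⟩
    exact (realize_dnf (hC i).1.1 x default).2.2
      ⟨ls, hls, fun φ hφ => hz.2 φ hφ⟩ ((hC i).realize he)
  obtain ⟨conts, h1, h2, h3⟩ := Conv.exists_optMapM
    (F := fun s (p : ℕ × ℕ) => (Fb s (m, k, p.1, p.2)).map fun t => (p.1, p.2, t)) l
    (fun p => ((p.1 : ℕ), codeFormula c p.2)) (fun p t => ExplicitlyDefines T p.2 p.1 t)
    (fun p t => ((p.1 : ℕ), codeFormula c p.2, codeTerm c t)) fun p hp => by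
      obtain ⟨ls, hls, h⟩ := (hmem p).1 hp
      obtain ⟨t, ht, htc⟩ := hFb m k p.2 p.1
        (h ▸ isConstraint_restrict hψ (isLiteral_of_mem_dnf.2 ls hls)) (h ▸ himpl _ ls hls)
      exact ⟨t, ht, htc.map _⟩
  refine ⟨conts, (dnf (conj ((List.finRange k).map C))).1.map (restrict ψ), ?_, ?_, ?_, ?_⟩
  · intro q hq
    obtain ⟨hql, hqe⟩ := h1 q hq
    obtain ⟨ls, hls, h⟩ := (hmem _).1 hql
    rw [h] at hqe ⊢
    have hlit := isLiteral_of_mem_dnf.2 ls hls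
    exact ⟨isConstraint_restrict hψ hlit, hdist ls hlit, hqe⟩
  · intro ψ' hψ'
    obtain ⟨ls, hls, rfl⟩ := List.mem_map.1 hψ'
    have hlit := isLiteral_of_mem_dnf.1 ls hls
    -- The negation of `ls` serves as ImplDef for every slot. Where `ls` fails, the restricted
    -- constraint has no realizations; where it holds, so does C i, which in T* supplies two
    -- realizations differing at `i`.
    refine ⟨isConstraint_restrict hψ hlit, hdist ls hlit, fun i => ⟨(conj ls).not,
      ⟨(isQF_conj fun φ hφ => (hlit φ hφ).isQF).not, ?_⟩, ?_⟩⟩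
    · obtain ⟨Tstar, hT⟩ := hmc
      refine ⟨Tstar, hT, fun M x => ?_⟩
      rw [Formula.realize_not, Formula.Realize, realize_conj]
      constructor
      · intro h z z' hz
        exact absurd (fun φ hφ => ((realize_restrict hlit _ _).1 hz).2 φ hφ) h
      · intro h hls'
        have h4 : ∀ φ ∈ (List.finRange k).map C, BoundedFormula.Realize φ x default :=
          (realize_conj _ _ _).1 ((realize_dnf hCq x default).1.2 ⟨ls, hls, hls'⟩)
        have h5 := h4 (C i) (List.mem_map.2 ⟨i, List.mem_finRange _, rfl⟩)
        obtain ⟨z, z', hz, hz', hne⟩ := (exists_realize_double i hψ.isQF x).1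
          ((hT.realize_cover_iff (isQF_double i hψ.isQF) (hC i) M x).1 h5)
        exact hne (h z z' ((realize_restrict hlit _ _).2 ⟨hz, fun φ hφ => hls' φ hφ⟩)
          ((realize_restrict hlit _ _).2 ⟨hz', fun φ hφ => hls' φ hφ⟩))
    · intro M x z
      obtain rfl : z = default := Subsingleton.elim _ _
      rw [realize_imp]
      intro h
      obtain ⟨z', hz'⟩ := realize_exs.1 h
      rw [realize_not, realize_not, not_not, realize_conj]
      intro φ hφ
      have := ((realize_restrict hlit _ _).1 hz').2 φ hφ
      exact (iff_of_eq (congrArg (BoundedFormula.Realize φ _) (Subsingleton.elim _ _))).1 this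
  · intro M _ x z
    constructor
    · intro h
      by_cases h4 : (conj ((List.finRange k).map C)).Realize x default
      · obtain ⟨ls, hls, h5⟩ := (realize_dnf hCq x default).1.1 h4
        exact Or.inr ⟨_, List.mem_map.2 ⟨ls, hls, rfl⟩,
          (realize_restrict (isLiteral_of_mem_dnf.1 ls hls) _ _).2 ⟨h, fun φ hφ => h5 φ hφ⟩⟩
      · rw [realize_conj] at h4
        push Not at h4
        obtain ⟨φ, hφ, h5⟩ := h4
        obtain ⟨i, -, rfl⟩ := List.mem_map.1 hφ
        obtain ⟨ls, hls, h6⟩ := (realize_dnf (hC i).1.1 x default).2.1 h5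
        obtain ⟨t, ht⟩ := h2 (i, restrict ψ ls) ((hmem _).2 ⟨ls, hls, rfl⟩)
        exact Or.inl ⟨_, ht,
          (realize_restrict (isLiteral_of_mem_dnf.2 ls hls) _ _).2 ⟨h, fun φ hφ => h6 φ hφ⟩⟩
    · rintro (⟨q, hq, h⟩ | ⟨ψ', hψ', h⟩)
      · obtain ⟨ls, hls, h4⟩ := (hmem _).1 (h1 q hq).1
        rw [h4] at h
        exact ((realize_restrict (isLiteral_of_mem_dnf.2 ls hls) _ _).1 h).1
      · obtain ⟨ls, hls, rfl⟩ := List.mem_map.1 hψ'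
        exact ((realize_restrict (isLiteral_of_mem_dnf.1 ls hls) _ _).1 h).1
  · refine Conv.bind (x := (List.finRange k).map fun i => codeFormula c (C i)) ?_ ?_
    · have := Conv.optMapM (F := fun s i => Fc s (m, k + k, cDouble k i (codeFormula c ψ)))
        (List.finRange k) (fun i => (i : ℕ)) (fun i => codeFormula c (C i)) fun i _ => by
          rw [← codeFormula_double c i hψ.isQF]
          exact hCc i
      rwa [List.map_coe_finRange_eq_range] at this
    · have h4 : ((List.range k).flatMap fun i => (cDnf (((List.finRange k).map fun i =>
          codeFormula c (C i)).getD i 0)).2.map fun ls => (i, cRestrict (codeFormula c ψ) ls)) =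
          l.map fun p => ((p.1 : ℕ), codeFormula c p.2) := by
        rw [← List.map_coe_finRange_eq_range, List.flatMap_map, List.map_flatMap]
        refine congrArg List.flatten (List.map_congr_left fun i _ => ?_)
        -- The list has exactly `k` entries, so the default value 0 is never used.
        have h5 : ((List.finRange k).map fun i => codeFormula c (C i)).getD i 0 =
            codeFormula c (C i) := by
          rw [List.getD_eq_getElem _ _ (by simp)]
          simp
        rw [h5, cDnf_codeFormula, List.map_map, List.map_map]
        refine List.map_congr_left fun ls hls => ?_
        simp only [Function.comp_apply, codeFormula_restrict c ψ (isLiteral_of_mem_dnf.2 ls hls)]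
      simp only [h4]
      convert! h3.map _ using 3
      have h6 : cConj ((List.finRange k).map fun i => codeFormula c (C i)) =
          codeFormula c (conj ((List.finRange k).map C)) := by
        rw [codeFormula_conj, List.map_map]
        rfl
      rw [h6, cDnf_codeFormula, List.map_map, List.map_map]
      refine List.map_congr_left fun ls hls => ?_
      simp only [Function.comp_apply, codeFormula_restrict c ψ (isLiteral_of_mem_dnf.1 ls hls)]

end Splits

/-! ### Turning one existential variable into a free variable. -/

section DropSlot

variable {L : FirstOrder.Language.{u, v}}

/-- The slots other than slot `i`. -/
def skip {k : ℕ} (i : Fin k) (j : Fin (k - 1)) : Fin k :=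
  if (j : ℕ) < i then ⟨j, by omega⟩ else ⟨j + 1, by omega⟩

/-- Turn slot `i` into a new free variable. -/
def dropSlot (m : ℕ) {k : ℕ} (i : Fin k) : Fin m ⊕ Fin k → Fin (m + 1) ⊕ Fin (k - 1) :=
  Sum.elim (fun j => Sum.inl j.castSucc) fun j =>
    if h : (j : ℕ) < i then Sum.inr ⟨j, by omega⟩
    else if h' : (i : ℕ) < j then Sum.inr ⟨j - 1, by omega⟩ else Sum.inl (Fin.last m)

/-- `dropSlot` on Gödel numbers. -/
def cDropSlot (m i v : ℕ) : ℕ :=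
  if v % 2 = 0 then cVar v else if v / 2 < i then cVar v else if i < v / 2 then cVar (v - 2)
    else cVar (2 * m)

@[fun_prop] theorem primrec_cDropSlot {P : Type*} [Primcodable P] {m i v : P → ℕ} (hm : Primrec m)
    (hi : Primrec i) (hv : Primrec v) : Primrec fun p => cDropSlot (m p) (i p) (v p) := by
  unfold cDropSlot; fun_prop

theorem skip_injective {k : ℕ} (i : Fin k) : Function.Injective (skip i) := by
  intro a b h
  unfold skip at h
  split_ifs at h <;> simp only [Fin.mk.injEq] at h <;> ext <;> omega

theorem dropSlot_skip {m k : ℕ} (i : Fin k) (j : Fin (k - 1)) :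
    dropSlot m i (Sum.inr (skip i j)) = Sum.inr j := by
  simp only [dropSlot, Sum.elim_inr]
  by_cases h : (j : ℕ) < i
  · have h0 : skip i j = ⟨j, by omega⟩ := if_pos h
    rw [h0, dif_pos h]
  · have h0 : skip i j = ⟨j + 1, by omega⟩ := if_neg h
    rw [h0, dif_neg (by simp only; omega), dif_pos (by simp only; omega)]
    rfl

theorem dropSlot_self {m k : ℕ} (i : Fin k) :
    dropSlot m i (Sum.inr i) = Sum.inl (Fin.last m) := by
  simp [dropSlot]

theorem eq_or_exists_skip {k : ℕ} (i j : Fin k) : j = i ∨ ∃ l, j = skip i l := by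
  rcases lt_trichotomy (j : ℕ) i with h | h | h
  · refine Or.inr ⟨⟨j, by omega⟩, ?_⟩
    simp [skip, h]
  · exact Or.inl (Fin.ext h)
  · refine Or.inr ⟨⟨j - 1, by omega⟩, ?_⟩
    have h1 : ¬ ((j : ℕ) - 1 < i) := by omega
    ext
    simp only [skip, h1, if_false]
    omega

theorem codeFormula_dropSlot (c : SymbolCoding L) {m k : ℕ} (i : Fin k)
    {ψ : L.BoundedFormula (Fin m) k} (h : ψ.IsQF) :
    codeFormula c (ren (dropSlot m i) ψ) = cTransQF 1 0 (cDropSlot m i) (codeFormula c ψ) := by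
  refine codeFormula_ren c ?_ h
  rintro (a | a)
  · simp [dropSlot, cDropSlot, encode_fin]
  · have h1 : (2 * (a : ℕ) + 1) / 2 = a := by omega
    simp only [dropSlot, cDropSlot, Sum.elim_inr, Encodable.encode_inr, encode_fin, h1]
    rw [if_neg (by omega)]
    split_ifs with h2 h3
    · simp [encode_fin]
    · simp only [Encodable.encode_inr, encode_fin]
      congr 1
      omega
    · simp [encode_fin]

theorem ForcesInjective.dropSlot {m k : ℕ} (i : Fin k) {ψ : L.BoundedFormula (Fin m) k}
    (hq : ψ.IsQF) (h : ForcesInjective ψ) : ForcesInjective (ren (dropSlot m i) ψ) := by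
  intro M x z hz
  have h1 := h M _ _ ((realize_ren _ hq x z).1 hz)
  have h2 := h1.comp (skip_injective i)
  convert! h2 using 1
  funext j
  simp [dropSlot_skip]

theorem realize_dropSlot {m k : ℕ} (i : Fin k) {ψ : L.BoundedFormula (Fin m) k} (hq : ψ.IsQF)
    {M : Type*} [L.Structure M] (y : Fin m → M) (a : M) (z : Fin (k - 1) → M) :
    (ren (dropSlot m i) ψ).Realize (Fin.snoc y a) z ↔
      ψ.Realize y fun j => Sum.elim (Fin.snoc y a) z (dropSlot m i (Sum.inr j)) := by
  rw [realize_ren _ hq]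
  refine iff_of_eq (congrArg₂ _ (funext fun j => ?_) rfl)
  simp [Covers.dropSlot]

theorem realize_dropSlot_skip {m k : ℕ} (i : Fin k) {ψ : L.BoundedFormula (Fin m) k} (hq : ψ.IsQF)
    {M : Type*} [L.Structure M] (y : Fin m → M) (z : Fin k → M) :
    (ren (dropSlot m i) ψ).Realize (Fin.snoc y (z i)) (z ∘ skip i) ↔ ψ.Realize y z := by
  rw [realize_dropSlot i hq]
  refine iff_of_eq (congrArg _ (funext fun j => ?_))
  rcases eq_or_exists_skip i j with rfl | ⟨l, rfl⟩
  · simp [dropSlot_self]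
  · simp [dropSlot_skip]

end DropSlot

/-! ### Repeated splitting of working formulas. -/

section Loop

variable {L₁ : FirstOrder.Language.{u₁, v₁}} {L₂ : FirstOrder.Language.{u₂, v₂}} {n : ℕ}

/-- The working formula is true. -/
def WorkingFormula.Holds (W : WorkingFormula L₁ L₂ n) {M : Type*} [L₁.Structure M]
    [L₂.Structure M] [(L₁.sum L₂).Structure M] (x : Fin n → M) : Prop :=
  ∃ e, W.ψ₁.Realize (fun i => (W.terms i).realize x) e ∧
    W.ψ₂.Realize (fun i => (W.terms i).realize x) e

/-- The pure parts are constraints forcing the existential variables to be distinct. -/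
structure WorkingFormula.IsProper (W : WorkingFormula L₁ L₂ n) : Prop where
  isConstraint₁ : IsConstraint W.ψ₁
  isConstraint₂ : IsConstraint W.ψ₂
  forcesInjective₁ : ForcesInjective W.ψ₁
  forcesInjective₂ : ForcesInjective W.ψ₂

/-- Turn the existential variable `i` into a defined variable. -/
def WorkingFormula.define (W : WorkingFormula L₁ L₂ n) (i : Fin W.k)
    (t : (L₁.sum L₂).Term (Fin n)) (φ₁ : L₁.BoundedFormula (Fin W.m) W.k)
    (φ₂ : L₂.BoundedFormula (Fin W.m) W.k) : WorkingFormula L₁ L₂ n :=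
  ⟨W.m + 1, W.k - 1, Fin.snoc W.terms t, ren (dropSlot W.m i) φ₁, ren (dropSlot W.m i) φ₂⟩

theorem WorkingFormula.IsProper.define {W : WorkingFormula L₁ L₂ n} {i : Fin W.k}
    {t : (L₁.sum L₂).Term (Fin n)} {φ₁ : L₁.BoundedFormula (Fin W.m) W.k}
    {φ₂ : L₂.BoundedFormula (Fin W.m) W.k} (h₁ : IsConstraint φ₁) (h₂ : IsConstraint φ₂)
    (hi₁ : ForcesInjective φ₁) (hi₂ : ForcesInjective φ₂) : (W.define i t φ₁ φ₂).IsProper :=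
  ⟨isConstraint_ren _ h₁, isConstraint_ren _ h₂, hi₁.dropSlot i h₁.isQF, hi₂.dropSlot i h₂.isQF⟩

theorem snoc_terms_realize {L : FirstOrder.Language.{u, v}} {M : Type*} [L.Structure M]
    {x : Fin n → M} {m : ℕ} (s : Fin m → L.Term (Fin n)) (t : L.Term (Fin n)) :
    (fun j => Term.realize x ((Fin.snoc s t : Fin (m + 1) → L.Term (Fin n)) j)) =
      (Fin.snoc (fun j => (s j).realize x) (t.realize x) : Fin (m + 1) → M) := by
  funext j
  refine Fin.lastCases ?_ (fun j => ?_) j <;> simp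

section
variable {M : Type*} [L₁.Structure M] [L₂.Structure M] [(L₁.sum L₂).Structure M]
  {W : WorkingFormula L₁ L₂ n} {i : Fin W.k} {t : (L₁.sum L₂).Term (Fin n)}
  {φ₁ : L₁.BoundedFormula (Fin W.m) W.k} {φ₂ : L₂.BoundedFormula (Fin W.m) W.k} {x : Fin n → M}

/-- This direction puts no condition on `t`: its value is the witness for slot `i`. -/
theorem WorkingFormula.Holds.of_define (h₁ : φ₁.IsQF) (h₂ : φ₂.IsQF)
    (h : (W.define i t φ₁ φ₂).Holds x) :
    ∃ e, φ₁.Realize (fun i => (W.terms i).realize x) e ∧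
      φ₂.Realize (fun i => (W.terms i).realize x) e := by
  obtain ⟨e, he₁, he₂⟩ := h
  simp only [WorkingFormula.define, snoc_terms_realize] at he₁ he₂
  exact ⟨_, (realize_dropSlot i h₁ _ _ e).1 he₁, (realize_dropSlot i h₂ _ _ e).1 he₂⟩

/-- Here the witness for slot `i` must agree with `t`; the explicit definition ensures this in the
application. -/
theorem WorkingFormula.Holds.define (h₁ : φ₁.IsQF) (h₂ : φ₂.IsQF) {e : Fin W.k → M}
    (he₁ : φ₁.Realize (fun i => (W.terms i).realize x) e)
    (he₂ : φ₂.Realize (fun i => (W.terms i).realize x) e) (ht : e i = t.realize x) :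
    (W.define i t φ₁ φ₂).Holds x := by
  refine ⟨e ∘ skip i, ?_, ?_⟩
  · simp only [WorkingFormula.define, snoc_terms_realize, ← ht]
    exact (realize_dropSlot_skip i h₁ _ e).2 he₁
  · simp only [WorkingFormula.define, snoc_terms_realize, ← ht]
    exact (realize_dropSlot_skip i h₂ _ e).2 he₂
end

/-- Codes of the components of a working formula. -/
abbrev WorkingCode := ℕ × ℕ × List ℕ × ℕ × ℕ

/-- The codes of the components of a working formula. -/
def WorkingFormula.code (c₁ : SymbolCoding L₁) (c₂ : SymbolCoding L₂)
    (W : WorkingFormula L₁ L₂ n) : WorkingCode :=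
  (W.m, W.k, List.ofFn fun i => codeTerm (c₁.sum c₂) (W.terms i), codeFormula c₁ W.ψ₁,
    codeFormula c₂ W.ψ₂)

/-- `WorkingFormula.define` on Gödel numbers. -/
def cDefine (W : WorkingCode) (i t φ₁ φ₂ : ℕ) : WorkingCode :=
  (W.1 + 1, W.2.1 - 1, W.2.2.1 ++ [t], cTransQF 1 0 (cDropSlot W.1 i) φ₁,
    cTransQF 1 0 (cDropSlot W.1 i) φ₂)

@[fun_prop] theorem primrec_cDefine {P : Type*} [Primcodable P] {W : P → WorkingCode}
    {i t φ₁ φ₂ : P → ℕ} (hW : Primrec W) (hi : Primrec i) (ht : Primrec t) (h₁ : Primrec φ₁)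
    (h₂ : Primrec φ₂) : Primrec fun p => cDefine (W p) (i p) (t p) (φ₁ p) (φ₂ p) := by
  unfold cDefine; fun_prop

theorem code_define (c₁ : SymbolCoding L₁) (c₂ : SymbolCoding L₂) {W : WorkingFormula L₁ L₂ n}
    {i : Fin W.k} {t : (L₁.sum L₂).Term (Fin n)} {φ₁ : L₁.BoundedFormula (Fin W.m) W.k}
    {φ₂ : L₂.BoundedFormula (Fin W.m) W.k} (h₁ : φ₁.IsQF) (h₂ : φ₂.IsQF) :
    (W.define i t φ₁ φ₂).code c₁ c₂ = cDefine (W.code c₁ c₂) i (codeTerm (c₁.sum c₂) t)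
      (codeFormula c₁ φ₁) (codeFormula c₂ φ₂) := by
  have h3 : (List.ofFn fun j => codeTerm (c₁.sum c₂)
      ((Fin.snoc W.terms t : Fin (W.m + 1) → (L₁.sum L₂).Term (Fin n)) j)) =
      (List.ofFn fun j => codeTerm (c₁.sum c₂) (W.terms j)) ++ [codeTerm (c₁.sum c₂) t] := by
    rw [List.ofFn_succ', List.concat_eq_append]
    simp
  exact Prod.ext rfl (Prod.ext rfl (Prod.ext h3
    (Prod.ext (codeFormula_dropSlot c₁ i h₁) (codeFormula_dropSlot c₂ i h₂))))

/-- `S s` is an algorithm with fuel `s` which splits constraints into constraints which define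
one of the slots, together with the definition, and terminal constraints. -/
def SplitOracle {L : FirstOrder.Language.{u, v}} (c : SymbolCoding L) (T : L.Theory)
    (S : ℕ → ℕ × ℕ × ℕ → Option (List (ℕ × ℕ × ℕ) × List ℕ)) : Prop :=
  ∀ (m k : ℕ) (ψ : L.BoundedFormula (Fin m) k), IsConstraint ψ → ForcesInjective ψ →
    ∃ (conts : List ((Fin k × L.BoundedFormula (Fin m) k) × L.Term (Fin m)))
      (terms : List (L.BoundedFormula (Fin m) k)),
      (∀ q ∈ conts, IsConstraint q.1.2 ∧ ForcesInjective q.1.2 ∧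
        ExplicitlyDefines T q.1.2 q.1.1 q.2) ∧
      (∀ ψ' ∈ terms, IsTerminalFor T ψ') ∧
      (∀ (M : Type w) [L.Structure M] (x : Fin m → M) (z : Fin k → M), ψ.Realize x z ↔
        (∃ q ∈ conts, q.1.2.Realize x z) ∨ ∃ ψ' ∈ terms, ψ'.Realize x z) ∧
      Conv (fun s => S s (m, k, codeFormula c ψ))
        (conts.map fun q => ((q.1.1 : ℕ), codeFormula c q.1.2, codeTerm c q.2),
          terms.map (codeFormula c))

/-- Split a working formula into working formulas with fewer existential variables and
terminal working formulas. -/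
def cStep (S₁ S₂ : ℕ × ℕ × ℕ → Option (List (ℕ × ℕ × ℕ) × List ℕ)) (W : WorkingCode) :
    Option (List WorkingCode × List WorkingCode) :=
  (S₁ (W.1, W.2.1, W.2.2.2.1)).bind fun p => (S₂ (W.1, W.2.1, W.2.2.2.2)).map fun q =>
    ((p.1.map fun a => cDefine W a.1 (cTransTerm 2 0 (fun v => W.2.2.1.getD v 0) a.2.2) a.2.1
        W.2.2.2.2) ++
      (q.1.map fun a => cDefine W a.1 (cTransTerm 2 1 (fun v => W.2.2.1.getD v 0) a.2.2)
        W.2.2.2.1 a.2.1),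
      p.2.flatMap fun a => q.2.map fun b => (W.1, W.2.1, W.2.2.1, a, b))

@[fun_prop] theorem primrec_cStep {P : Type*} [Primcodable P]
    {S₁ S₂ : P → ℕ × ℕ × ℕ → Option (List (ℕ × ℕ × ℕ) × List ℕ)} {W : P → WorkingCode}
    (h₁ : Primrec fun p : P × ℕ × ℕ × ℕ => S₁ p.1 p.2)
    (h₂ : Primrec fun p : P × ℕ × ℕ × ℕ => S₂ p.1 p.2) (hW : Primrec W) :
    Primrec fun p => cStep (S₁ p) (S₂ p) (W p) := by
  have h3 : Primrec fun p : P => S₁ p ((W p).1, (W p).2.1, (W p).2.2.2.1) :=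
    h₁.comp (g := fun p : P => (p, (W p).1, (W p).2.1, (W p).2.2.2.1)) (by fun_prop)
  have h4 : Primrec fun p : P × List (ℕ × ℕ × ℕ) × List ℕ =>
      S₂ p.1 ((W p.1).1, (W p.1).2.1, (W p.1).2.2.2.2) :=
    h₂.comp (g := fun p : P × List (ℕ × ℕ × ℕ) × List ℕ =>
      (p.1, (W p.1).1, (W p.1).2.1, (W p.1).2.2.2.2)) (by fun_prop)
  unfold cStep
  fun_prop

theorem codeTerm_transTerm_terms (c₁ : SymbolCoding L₁) (c₂ : SymbolCoding L₂)
    {L : FirstOrder.Language.{u, v}} {c : SymbolCoding L} {g : L →ᴸ L₁.sum L₂} {a b m : ℕ}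
    (hg : Tracks g c (c₁.sum c₂) a b) (s : Fin m → (L₁.sum L₂).Term (Fin n)) (t : L.Term (Fin m)) :
    codeTerm (c₁.sum c₂) (transTerm g s t) = cTransTerm a b
      (fun v => (List.ofFn fun i => codeTerm (c₁.sum c₂) (s i)).getD v 0) (codeTerm c t) :=
  codeTerm_transTerm hg (fun i => by
    rw [encode_fin, List.getD_eq_getElem _ _ (by simp)]
    simp) t

/-- A realization falls into a defining piece of ψ₁, or into one of ψ₂, or into terminal pieces of
both. In the defining cases one slot disappears and the other pure part is kept whole; the new
definition is the Beth term with the earlier mixed definitions substituted. The remaining case is a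
terminal working formula. -/
theorem exists_conv_cStep {c₁ : SymbolCoding L₁} {c₂ : SymbolCoding L₂} {T₁ : L₁.Theory}
    {T₂ : L₂.Theory} {S₁ S₂ : ℕ → ℕ × ℕ × ℕ → Option (List (ℕ × ℕ × ℕ) × List ℕ)}
    (hS₁ : SplitOracle.{u₁, v₁, w} c₁ T₁ S₁) (hS₂ : SplitOracle.{u₂, v₂, w} c₂ T₂ S₂)
    {W : WorkingFormula L₁ L₂ n} (hW : W.IsProper) :
    ∃ conts terms : List (WorkingFormula L₁ L₂ n),
      (∀ W' ∈ conts, W'.IsProper ∧ W'.k < W.k) ∧ (∀ W' ∈ terms, W'.IsTerminal T₁ T₂) ∧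
      (∀ (M : Type w) [L₁.Structure M] [L₂.Structure M] [(L₁.sum L₂).Structure M]
        [(LHom.sumInl : L₁ →ᴸ L₁.sum L₂).IsExpansionOn M]
        [(LHom.sumInr : L₂ →ᴸ L₁.sum L₂).IsExpansionOn M] [M ⊨ T₁] [M ⊨ T₂] [Nonempty M]
        (x : Fin n → M), W.Holds x ↔ (∃ W' ∈ conts, W'.Holds x) ∨ ∃ W' ∈ terms, W'.Holds x) ∧
      Conv (fun s => cStep (S₁ s) (S₂ s) (W.code c₁ c₂))
        (conts.map fun W => W.code c₁ c₂, terms.map fun W => W.code c₁ c₂) := by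
  obtain ⟨d₁, e₁, hd₁, he₁, hr₁, hc₁⟩ := hS₁ _ _ _ hW.1 hW.3
  obtain ⟨d₂, e₂, hd₂, he₂, hr₂, hc₂⟩ := hS₂ _ _ _ hW.2 hW.4
  refine ⟨(d₁.map fun q => W.define q.1.1 (transTerm LHom.sumInl W.terms q.2) q.1.2 W.ψ₂) ++
    (d₂.map fun q => W.define q.1.1 (transTerm LHom.sumInr W.terms q.2) W.ψ₁ q.1.2),
    e₁.flatMap fun a => e₂.map fun b => ⟨W.m, W.k, W.terms, a, b⟩, ?_, ?_, ?_, ?_⟩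
  · intro W' hW'
    rw [List.mem_append, List.mem_map, List.mem_map] at hW'
    rcases hW' with ⟨q, hq, rfl⟩ | ⟨q, hq, rfl⟩
    · refine ⟨.define (hd₁ q hq).1 hW.2 (hd₁ q hq).2.1 hW.4, ?_⟩
      have := q.1.1.2
      simp only [WorkingFormula.define]
      omega
    · refine ⟨.define hW.1 (hd₂ q hq).1 hW.3 (hd₂ q hq).2.1, ?_⟩
      have := q.1.1.2
      simp only [WorkingFormula.define]
      omega
  · intro W' hW'
    simp only [List.mem_flatMap, List.mem_map] at hW'
    obtain ⟨a, ha, b, hb, rfl⟩ := hW'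
    exact ⟨he₁ a ha, he₂ b hb⟩
  · intro M _ _ _ _ _ _ _ _ x
    simp only [List.mem_append, List.mem_flatMap, List.mem_map]
    constructor
    · rintro ⟨e, h₁, h₂⟩
      rcases (hr₁ M _ _).1 h₁ with ⟨q, hq, h⟩ | ⟨a, ha, h₁'⟩
      · refine Or.inl ⟨_, Or.inl ⟨q, hq, rfl⟩, .define (hd₁ q hq).1.isQF hW.2.isQF h h₂ ?_⟩
        rw [realize_transTerm]
        exact (hd₁ q hq).2.2.realize h
      rcases (hr₂ M _ _).1 h₂ with ⟨q, hq, h⟩ | ⟨b, hb, h₂'⟩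
      · refine Or.inl ⟨_, Or.inr ⟨q, hq, rfl⟩, .define hW.1.isQF (hd₂ q hq).1.isQF h₁ h ?_⟩
        rw [realize_transTerm]
        exact (hd₂ q hq).2.2.realize h
      exact Or.inr ⟨_, ⟨a, ha, b, hb, rfl⟩, e, h₁', h₂'⟩
    · rintro (⟨W', ⟨q, hq, rfl⟩ | ⟨q, hq, rfl⟩, h⟩ | ⟨W', ⟨a, ha, b, hb, rfl⟩, e, h₁, h₂⟩)
      · obtain ⟨e, h₁, h₂⟩ := h.of_define (hd₁ q hq).1.isQF hW.2.isQF
        exact ⟨e, (hr₁ M _ _).2 (Or.inl ⟨q, hq, h₁⟩), h₂⟩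
      · obtain ⟨e, h₁, h₂⟩ := h.of_define hW.1.isQF (hd₂ q hq).1.isQF
        exact ⟨e, h₁, (hr₂ M _ _).2 (Or.inl ⟨q, hq, h₂⟩)⟩
      · exact ⟨e, (hr₁ M _ _).2 (Or.inr ⟨a, ha, h₁⟩), (hr₂ M _ _).2 (Or.inr ⟨b, hb, h₂⟩)⟩
  · refine Conv.bind hc₁ ?_
    convert! hc₂.map _ using 1
    simp only [List.map_append, List.map_map, List.map_flatMap, List.flatMap_map]
    refine Prod.ext ?_ ?_
    · refine congrArg₂ _ (List.map_congr_left fun q hq => ?_) (List.map_congr_left fun q hq => ?_)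
      · simp only [Function.comp_apply, code_define c₁ c₂ (hd₁ q hq).1.isQF hW.2.isQF,
          codeTerm_transTerm_terms c₁ c₂ (tracks_inl c₁ c₂)]
        rfl
      · simp only [Function.comp_apply, code_define c₁ c₂ hW.1.isQF (hd₂ q hq).1.isQF,
          codeTerm_transTerm_terms c₁ c₂ (tracks_inr c₁ c₂)]
        rfl
    · rfl

/-- Split repeatedly, collecting the terminal working formulas. -/
def cLoop (S₁ S₂ : ℕ × ℕ × ℕ → Option (List (ℕ × ℕ × ℕ) × List ℕ)) (r : ℕ)
    (Ws : List WorkingCode) : Option (List WorkingCode × List WorkingCode) :=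
  (fun st : Option (List WorkingCode × List WorkingCode) => st.bind fun p =>
    (optMapM (fun W => cStep S₁ S₂ W) p.2).map fun rs =>
      (p.1 ++ rs.flatMap (fun q => q.2), rs.flatMap fun q => q.1))^[r] (some ([], Ws))

@[fun_prop] theorem primrec_cLoop {P : Type*} [Primcodable P]
    {S₁ S₂ : P → ℕ × ℕ × ℕ → Option (List (ℕ × ℕ × ℕ) × List ℕ)} {r : P → ℕ}
    {Ws : P → List WorkingCode} (h₁ : Primrec fun p : P × ℕ × ℕ × ℕ => S₁ p.1 p.2)
    (h₂ : Primrec fun p : P × ℕ × ℕ × ℕ => S₂ p.1 p.2) (hr : Primrec r) (hW : Primrec Ws) :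
    Primrec fun p => cLoop (S₁ p) (S₂ p) (r p) (Ws p) := by
  have h3 : Primrec fun p : ((P × Option (List WorkingCode × List WorkingCode)) ×
      (List WorkingCode × List WorkingCode)) × WorkingCode => cStep (S₁ p.1.1.1) (S₂ p.1.1.1) p.2 :=
    primrec_cStep (h₁.comp (g := fun p : (((P × Option (List WorkingCode × List WorkingCode)) ×
      (List WorkingCode × List WorkingCode)) × WorkingCode) × ℕ × ℕ × ℕ => (p.1.1.1.1, p.2))
      (by fun_prop)) (h₂.comp (g := fun p : (((P × Option (List WorkingCode × List WorkingCode)) ×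
      (List WorkingCode × List WorkingCode)) × WorkingCode) × ℕ × ℕ × ℕ => (p.1.1.1.1, p.2))
      (by fun_prop)) (by fun_prop)
  unfold cLoop
  fun_prop

/-- Invariant: the collected terminal formulas together with the pending ones are equivalent to the
input, and each pending formula has at least `r` fewer existential variables than some input
formula. -/
theorem exists_conv_cLoop {c₁ : SymbolCoding L₁} {c₂ : SymbolCoding L₂} {T₁ : L₁.Theory}
    {T₂ : L₂.Theory} {S₁ S₂ : ℕ → ℕ × ℕ × ℕ → Option (List (ℕ × ℕ × ℕ) × List ℕ)}
    (hS₁ : SplitOracle.{u₁, v₁, w} c₁ T₁ S₁) (hS₂ : SplitOracle.{u₂, v₂, w} c₂ T₂ S₂)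
    {todo : List (WorkingFormula L₁ L₂ n)} (hW : ∀ W ∈ todo, W.IsProper) (r : ℕ) :
    ∃ Ws todo' : List (WorkingFormula L₁ L₂ n), (∀ W ∈ Ws, W.IsTerminal T₁ T₂) ∧
      (∀ W ∈ todo', W.IsProper ∧ ∃ W' ∈ todo, W.k + r ≤ W'.k) ∧
      (∀ (M : Type w) [L₁.Structure M] [L₂.Structure M] [(L₁.sum L₂).Structure M]
        [(LHom.sumInl : L₁ →ᴸ L₁.sum L₂).IsExpansionOn M]
        [(LHom.sumInr : L₂ →ᴸ L₁.sum L₂).IsExpansionOn M] [M ⊨ T₁] [M ⊨ T₂] [Nonempty M]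
        (x : Fin n → M), (∃ W ∈ todo, W.Holds x) ↔
          (∃ W ∈ Ws, W.Holds x) ∨ ∃ W ∈ todo', W.Holds x) ∧
      Conv (fun s => cLoop (S₁ s) (S₂ s) r (todo.map fun W => W.code c₁ c₂))
        (Ws.map fun W => W.code c₁ c₂, todo'.map fun W => W.code c₁ c₂) := by
  induction r with
  | zero =>
    refine ⟨[], todo, by simp, fun W h => ⟨hW W h, W, h, le_rfl⟩, ?_, Conv.const _⟩
    intro M _ _ _ _ _ _ _ _ x
    simp
  | succ r ih =>
    obtain ⟨Ws, todo', h1, h2, h3, h4⟩ := ih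
    obtain ⟨ys, h5, h6, h7⟩ := Conv.exists_optMapM (F := fun s W => cStep (S₁ s) (S₂ s) W) todo'
      (fun W => W.code c₁ c₂)
      (fun W (p : List (WorkingFormula L₁ L₂ n) × List (WorkingFormula L₁ L₂ n)) =>
        (∀ W' ∈ p.1, W'.IsProper ∧ W'.k < W.k) ∧ (∀ W' ∈ p.2, W'.IsTerminal T₁ T₂) ∧
        ∀ (M : Type w) [L₁.Structure M] [L₂.Structure M] [(L₁.sum L₂).Structure M]
        [(LHom.sumInl : L₁ →ᴸ L₁.sum L₂).IsExpansionOn M]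
        [(LHom.sumInr : L₂ →ᴸ L₁.sum L₂).IsExpansionOn M] [M ⊨ T₁] [M ⊨ T₂] [Nonempty M]
        (x : Fin n → M), W.Holds x ↔ (∃ W' ∈ p.1, W'.Holds x) ∨ ∃ W' ∈ p.2, W'.Holds x)
      (fun _ p => (p.1.map fun W => W.code c₁ c₂, p.2.map fun W => W.code c₁ c₂)) fun W h => by
        obtain ⟨conts, terms, h1, h2, h3, h4⟩ := exists_conv_cStep hS₁ hS₂ (h2 W h).1
        exact ⟨(conts, terms), ⟨h1, h2, h3⟩, h4⟩
    refine ⟨Ws ++ ys.flatMap fun q => q.2.2, ys.flatMap fun q => q.2.1, ?_, ?_, ?_, ?_⟩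
    · intro W h
      rcases List.mem_append.1 h with h | h
      · exact h1 W h
      · obtain ⟨q, hq, h⟩ := List.mem_flatMap.1 h
        exact (h5 q hq).2.2.1 W h
    · intro W h
      obtain ⟨q, hq, h⟩ := List.mem_flatMap.1 h
      obtain ⟨hq1, hq2, -⟩ := h5 q hq
      obtain ⟨-, W', hW', hle⟩ := h2 _ hq1
      have := hq2 W h
      exact ⟨this.1, W', hW', by omega⟩
    · intro M _ _ _ _ _ _ _ _ x
      rw [h3 M x]
      constructor
      · rintro (⟨W, hW, h⟩ | ⟨W, hW, h⟩)
        · exact Or.inl ⟨W, List.mem_append_left _ hW, h⟩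
        · obtain ⟨p, hp⟩ := h6 W hW
          rcases ((h5 _ hp).2.2.2 M x).1 h with ⟨W', hW', h⟩ | ⟨W', hW', h⟩
          · exact Or.inr ⟨W', List.mem_flatMap.2 ⟨_, hp, hW'⟩, h⟩
          · exact Or.inl ⟨W', List.mem_append_right _ (List.mem_flatMap.2 ⟨_, hp, hW'⟩), h⟩
      · rintro (⟨W, hW, h⟩ | ⟨W, hW, h⟩)
        · rcases List.mem_append.1 hW with hW | hW
          · exact Or.inl ⟨W, hW, h⟩
          · obtain ⟨q, hq, hW⟩ := List.mem_flatMap.1 hW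
            exact Or.inr ⟨q.1, (h5 q hq).1, ((h5 q hq).2.2.2 M x).2 (Or.inr ⟨W, hW, h⟩)⟩
        · obtain ⟨q, hq, hW⟩ := List.mem_flatMap.1 hW
          exact Or.inr ⟨q.1, (h5 q hq).1, ((h5 q hq).2.2.2 M x).2 (Or.inl ⟨W, hW, h⟩)⟩
    · unfold cLoop at h4 ⊢
      simp only [Function.iterate_succ_apply']
      refine h4.bind ?_
      convert! h7.map _ using 1
      simp only [List.map_append, List.map_flatMap, List.flatMap_map]

end Loop

/-! ### Naming subterms and extracting pure literals. -/

section Flattening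

variable {L : FirstOrder.Language.{u, v}} {L' : FirstOrder.Language.{u₁, v₁}} {n k K : ℕ}

/-- A partial projection of the symbols of `L` to those of `L'`. Its symbols are those with
numbers congruent to `index` modulo `2`. Equations go to the side with index `0`. -/
structure Side (L : FirstOrder.Language.{u, v}) (L' : FirstOrder.Language.{u₁, v₁}) where
  func : ∀ {l : ℕ}, L.Functions l → Option (L'.Functions l)
  rel : ∀ {l : ℕ}, L.Relations l → Option (L'.Relations l)
  index : ℕ

/-- The projection is given on symbol numbers by division by `2`. -/
structure Side.Tracks (p : Side L L') (c : SymbolCoding L) (c' : SymbolCoding L') : Prop where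
  func : ∀ {l : ℕ} (f : L.Functions l), (p.func f).toList.map (fun f' => c'.func ⟨l, f'⟩) =
    if c.func ⟨l, f⟩ % 2 = p.index then [c.func ⟨l, f⟩ / 2] else []
  rel : ∀ {l : ℕ} (R : L.Relations l), (p.rel R).toList.map (fun R' => c'.rel ⟨l, R'⟩) =
    if c.rel ⟨l, R⟩ % 2 = p.index then [c.rel ⟨l, R⟩ / 2] else []

/-- The defining equation of the name of a term, in terms of the names of its immediate
subterms. -/
def flatDef (p : Side L L') (nm : L.Term (Fin n ⊕ Fin k) → Fin K) :
    L.Term (Fin n ⊕ Fin k) → List (L'.BoundedFormula (Fin n) K)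
  | Term.var (Sum.inl i) =>
    if p.index = 0 then [eqVar (Sum.inr (nm (Term.var (Sum.inl i)))) (Sum.inl i)] else []
  -- An existential variable needs no equation: the value of its slot is taken as its value.
  | Term.var (Sum.inr _) => []
  | Term.func f ts => (p.func f).toList.map fun f' =>
      equal (Term.var (Sum.inr (nm (Term.func f ts))))
        (Term.func f' fun i => Term.var (Sum.inr (nm (ts i))))

/-- A literal with names instead of terms. -/
def flatLit (p : Side L L') : {k : ℕ} → (L.Term (Fin n ⊕ Fin k) → Fin K) →
    L.BoundedFormula (Fin n) k → List (L'.BoundedFormula (Fin n) K)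
  | _, _, falsum => []
  | _, nm, equal s t => if p.index = 0 then [eqVar (Sum.inr (nm s)) (Sum.inr (nm t))] else []
  | _, nm, rel R ts => (p.rel R).toList.map fun R' =>
      rel R' fun i => Term.var (Sum.inr (nm (ts i)))
  -- Only literals are flattened, and for these an implication is a negation.
  | _, nm, imp φ _ => (flatLit p nm φ).map BoundedFormula.not
  | _, _, all _ => []

/-- The inequations between distinct slots. -/
def distinct (L' : FirstOrder.Language.{u₁, v₁}) (n K : ℕ) : List (L'.BoundedFormula (Fin n) K) :=
  (List.finRange K).flatMap fun i : Fin K => (List.finRange K).flatMap fun j : Fin K =>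
    if (i : ℕ) < j then [(eqVar (Sum.inr i) (Sum.inr j)).not] else []

/-- The subterms of a term. -/
def subterms {α : Type*} : L.Term α → List (L.Term α)
  | Term.var a => [Term.var a]
  | Term.func f ts => Term.func f ts :: (List.ofFn fun i => subterms (ts i)).flatten

/-- The subterms of the terms in a quantifier-free formula. -/
def formTerms {α : Type*} : {k : ℕ} → L.BoundedFormula α k → List (L.Term (α ⊕ Fin k))
  | _, falsum => []
  | _, equal s t => subterms s ++ subterms t
  | _, rel _ ts => (List.ofFn fun i => subterms (ts i)).flatten
  | _, imp φ ψ => formTerms φ ++ formTerms ψ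
  | _, all _ => []

/-- The pure part on one side of a conjunction of literals, with existential variables naming
the terms in `S`. -/
def purePart (p : Side L L') (nm : L.Term (Fin n ⊕ Fin k) → Fin K)
    (S : List (L.Term (Fin n ⊕ Fin k))) (ls : List (L.BoundedFormula (Fin n) k)) :
    L'.BoundedFormula (Fin n) K :=
  conj (S.flatMap (flatDef p nm) ++ ls.flatMap (flatLit p nm) ++ distinct L' n K)

theorem mem_subterms_self {α : Type*} (t : L.Term α) : t ∈ subterms t := by
  cases t <;> simp [subterms]

theorem mem_subterms_of_func {α : Type*} {l : ℕ} {f : L.Functions l} {ts : Fin l → L.Term α}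
    {t : L.Term α} (h : Term.func f ts ∈ subterms t) (i : Fin l) : ts i ∈ subterms t := by
  induction t with
  | var a => simp [subterms] at h
  | @func l' f' ts' ih =>
    simp only [subterms, List.mem_cons, List.mem_flatten, List.mem_ofFn] at h ⊢
    rcases h with h | ⟨_, ⟨j, rfl⟩, h⟩
    · cases h
      exact Or.inr ⟨_, ⟨i, rfl⟩, mem_subterms_self _⟩
    · exact Or.inr ⟨_, ⟨j, rfl⟩, ih j h⟩

theorem mem_formTerms_of_func {α : Type*} {k l : ℕ} {f : L.Functions l}
    {ts : Fin l → L.Term (α ⊕ Fin k)} {φ : L.BoundedFormula α k}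
    (h : Term.func f ts ∈ formTerms φ) (i : Fin l) : ts i ∈ formTerms φ := by
  induction φ with
  | falsum => simp [formTerms] at h
  | equal s t =>
    simp only [formTerms, List.mem_append] at h ⊢
    exact h.imp (fun h => mem_subterms_of_func h i) fun h => mem_subterms_of_func h i
  | rel R us =>
    simp only [formTerms, List.mem_flatten, List.mem_ofFn] at h ⊢
    obtain ⟨_, ⟨j, rfl⟩, h⟩ := h
    exact ⟨_, ⟨j, rfl⟩, mem_subterms_of_func h i⟩
  | imp φ ψ ih₁ ih₂ =>
    simp only [formTerms, List.mem_append] at h ⊢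
    exact h.imp ih₁ ih₂
  | all φ ih => simp [formTerms] at h

theorem isLiteral_of_mem_flatDef {p : Side L L'} {nm : L.Term (Fin n ⊕ Fin k) → Fin K}
    {t : L.Term (Fin n ⊕ Fin k)} {θ : L'.BoundedFormula (Fin n) K} (h : θ ∈ flatDef p nm t) :
    IsLiteral θ := by
  rcases t with (i | j) | ⟨f, ts⟩
  · simp only [flatDef] at h
    split_ifs at h
    · rw [List.mem_singleton.1 h]
      exact isLiteral_eqVar _ _
    · simp at h
  · simp [flatDef] at h
  · obtain ⟨f', -, rfl⟩ := List.mem_map.1 h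
    exact Or.inl (IsAtomic.equal _ _)

theorem isAtomic_of_mem_flatLit {p : Side L L'} {nm : L.Term (Fin n ⊕ Fin k) → Fin K}
    {φ : L.BoundedFormula (Fin n) k} (hφ : φ.IsAtomic) {θ : L'.BoundedFormula (Fin n) K}
    (h : θ ∈ flatLit p nm φ) : θ.IsAtomic := by
  cases hφ with
  | equal s t =>
    simp only [Term.bdEqual, flatLit] at h
    split_ifs at h
    · rw [List.mem_singleton.1 h]
      exact IsAtomic.equal _ _
    · simp at h
  | rel R ts =>
    simp only [Relations.boundedFormula, flatLit] at h
    obtain ⟨f', -, rfl⟩ := List.mem_map.1 h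
    exact IsAtomic.rel _ _

theorem isLiteral_of_mem_flatLit {p : Side L L'} {nm : L.Term (Fin n ⊕ Fin k) → Fin K}
    {φ : L.BoundedFormula (Fin n) k} (hφ : IsLiteral φ) {θ : L'.BoundedFormula (Fin n) K}
    (h : θ ∈ flatLit p nm φ) : IsLiteral θ := by
  rcases hφ with hφ | ⟨φ, hφ, rfl⟩
  · exact Or.inl (isAtomic_of_mem_flatLit hφ h)
  · obtain ⟨θ, hθ, rfl⟩ := List.mem_map.1 h
    exact Or.inr ⟨θ, isAtomic_of_mem_flatLit hφ hθ, rfl⟩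

theorem isLiteral_of_mem_distinct {θ : L'.BoundedFormula (Fin n) K} (h : θ ∈ distinct L' n K) :
    IsLiteral θ := by
  simp only [distinct, List.mem_flatMap] at h
  obtain ⟨i, -, j, -, h⟩ := h
  split_ifs at h
  · rw [List.mem_singleton.1 h]
    exact isLiteral_not_eqVar _ _
  · simp at h

theorem realize_distinct {M : Type*} [L'.Structure M] (x : Fin n → M) (z : Fin K → M) :
    (∀ θ ∈ distinct L' n K, θ.Realize x z) ↔ Function.Injective z := by
  constructor
  · intro h
    have key : ∀ i j : Fin K, (i : ℕ) < j → z i ≠ z j := fun i j hij => by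
      have := h (eqVar (Sum.inr i) (Sum.inr j)).not (by
        simp only [distinct, List.mem_flatMap]
        exact ⟨i, List.mem_finRange _, j, List.mem_finRange _, by simp [hij]⟩)
      simpa using this
    intro i j hij
    rcases lt_trichotomy (i : ℕ) j with h' | h' | h'
    · exact absurd hij (key i j h')
    · exact Fin.ext h'
    · exact absurd hij.symm (key j i h')
  · intro hz θ hθ
    simp only [distinct, List.mem_flatMap] at hθ
    obtain ⟨i, -, j, -, h⟩ := hθ
    split_ifs at h with hij
    · rw [List.mem_singleton.1 h]
      simp only [realize_not, realize_eqVar, Sum.elim_inr]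
      exact fun h => hij.ne (congrArg Fin.val (hz h))
    · simp at h

theorem isConstraint_purePart (p : Side L L') (nm : L.Term (Fin n ⊕ Fin k) → Fin K)
    (S : List (L.Term (Fin n ⊕ Fin k))) {ls : List (L.BoundedFormula (Fin n) k)}
    (hls : ∀ φ ∈ ls, IsLiteral φ) : IsConstraint (purePart p nm S ls) := by
  refine isConstraint_conj fun θ hθ => .literal ?_
  simp only [List.mem_append, List.mem_flatMap] at hθ
  rcases hθ with (⟨t, -, h⟩ | ⟨φ, hφ, h⟩) | h
  · exact isLiteral_of_mem_flatDef h
  · exact isLiteral_of_mem_flatLit (hls φ hφ) h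
  · exact isLiteral_of_mem_distinct h

theorem realize_purePart {p : Side L L'} {nm : L.Term (Fin n ⊕ Fin k) → Fin K}
    {S : List (L.Term (Fin n ⊕ Fin k))} {ls : List (L.BoundedFormula (Fin n) k)}
    {M : Type*} [L'.Structure M] {x : Fin n → M} {z : Fin K → M} :
    (purePart p nm S ls).Realize x z ↔ (∀ t ∈ S, ∀ θ ∈ flatDef p nm t, θ.Realize x z) ∧
      (∀ φ ∈ ls, ∀ θ ∈ flatLit p nm φ, θ.Realize x z) ∧ Function.Injective z := by
  rw [purePart, realize_conj, ← realize_distinct (L' := L') x z]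
  simp only [List.mem_append, List.mem_flatMap]
  constructor
  · exact fun h => ⟨fun t ht θ hθ => h θ (Or.inl (Or.inl ⟨t, ht, hθ⟩)),
      fun φ hφ θ hθ => h θ (Or.inl (Or.inr ⟨φ, hφ, hθ⟩)), fun θ hθ => h θ (Or.inr hθ)⟩
  · rintro ⟨h1, h2, h3⟩ θ ((⟨t, ht, h⟩ | ⟨φ, hφ, h⟩) | h)
    exacts [h1 t ht θ h, h2 φ hφ θ h, h3 θ h]

theorem forcesInjective_purePart (p : Side L L') (nm : L.Term (Fin n ⊕ Fin k) → Fin K)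
    (S : List (L.Term (Fin n ⊕ Fin k))) (ls : List (L.BoundedFormula (Fin n) k)) :
    ForcesInjective (purePart p nm S ls) := fun _ _ _ h => (realize_purePart.1 h).2.2

/-- `flatDef` on Gödel numbers. -/
def cFlatDef (r : ℕ) (nm : ℕ → ℕ) (t : ℕ) : List ℕ :=
  termFold (fun v => if v % 2 = 0 then if r = 0 then [cEq (cVar (2 * nm (cVar v) + 1)) (cVar v)]
      else [] else [])
    (fun f l => if f % 2 = r then [cEq (cVar (2 * nm (cFun f (l.map fun q => q.1)) + 1))
      (cFun (f / 2) (l.map fun q => cVar (2 * nm q.1 + 1)))] else []) t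

/-- `flatLit` on Gödel numbers. -/
def cFlatLit (r : ℕ) (nm : ℕ → ℕ) (φ : ℕ) : List ℕ :=
  formFold [] (fun s t => if r = 0 then [cEq (cVar (2 * nm s + 1)) (cVar (2 * nm t + 1))] else [])
    (fun R l => if R % 2 = r then [cRel (R / 2) (l.map fun t => cVar (2 * nm t + 1))] else [])
    (fun a _ => a.map fun θ => cNot θ) (fun _ => []) φ

/-- `distinct` on Gödel numbers. -/
def cDistinct (K : ℕ) : List ℕ :=
  (List.range K).flatMap fun i => (List.range K).flatMap fun j =>
    if i < j then [cNot (cEq (cVar (2 * i + 1)) (cVar (2 * j + 1)))] else []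

/-- `subterms` on Gödel numbers. -/
def cSubterms (t : ℕ) : List ℕ :=
  termFold (fun v => [cVar v])
    (fun f l => cFun f (l.map fun q => q.1) :: (l.map fun q => q.2).flatten) t

/-- `formTerms` on Gödel numbers. -/
def cFormTerms (φ : ℕ) : List ℕ :=
  formFold [] (fun s t => cSubterms s ++ cSubterms t) (fun _ l => (l.map fun t => cSubterms t).flatten)
    (fun a b => a ++ b) (fun _ => []) φ

/-- `purePart` on Gödel numbers. -/
def cPurePart (r : ℕ) (nm : ℕ → ℕ) (K : ℕ) (S ls : List ℕ) : ℕ :=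
  cConj (S.flatMap (fun t => cFlatDef r nm t) ++ ls.flatMap (fun φ => cFlatLit r nm φ) ++
    cDistinct K)

section
variable {P : Type*} [Primcodable P] {r K t φ : P → ℕ} {nm : P → ℕ → ℕ} {S ls : P → List ℕ}

@[fun_prop] theorem primrec_cFlatDef (hr : Primrec r) (hnm : Primrec fun p : P × ℕ => nm p.1 p.2)
    (ht : Primrec t) : Primrec fun p => cFlatDef (r p) (nm p) (t p) := by
  have h {Q : Type _} [Primcodable Q] (f : Q → P) (g : Q → ℕ) (hf : Primrec f) (hg : Primrec g) :
      Primrec fun q => nm (f q) (g q) := hnm.comp (hf.pair hg)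
  have h1 : Primrec fun q : P × ℕ => nm q.1 (cVar q.2) := h _ _ (by fun_prop) (by fun_prop)
  have h2 : Primrec fun q : P × ℕ × List (ℕ × List ℕ) =>
      nm q.1 (cFun q.2.1 (q.2.2.map fun q => q.1)) := h _ _ (by fun_prop) (by fun_prop)
  have h3 : Primrec fun q : (P × ℕ × List (ℕ × List ℕ)) × ℕ × List ℕ => nm q.1.1 q.2.1 :=
    h _ _ (by fun_prop) (by fun_prop)
  unfold cFlatDef
  fun_prop

@[fun_prop] theorem primrec_cFlatLit (hr : Primrec r) (hnm : Primrec fun p : P × ℕ => nm p.1 p.2)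
    (hφ : Primrec φ) : Primrec fun p => cFlatLit (r p) (nm p) (φ p) := by
  have h {Q : Type _} [Primcodable Q] (f : Q → P) (g : Q → ℕ) (hf : Primrec f) (hg : Primrec g) :
      Primrec fun q => nm (f q) (g q) := hnm.comp (hf.pair hg)
  have h1 : Primrec fun q : P × ℕ × ℕ => nm q.1 q.2.1 := h _ _ (by fun_prop) (by fun_prop)
  have h2 : Primrec fun q : P × ℕ × ℕ => nm q.1 q.2.2 := h _ _ (by fun_prop) (by fun_prop)
  have h3 : Primrec fun q : (P × ℕ × List ℕ) × ℕ => nm q.1.1 q.2 :=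
    h _ _ (by fun_prop) (by fun_prop)
  unfold cFlatLit
  fun_prop

@[fun_prop] theorem primrec_cDistinct (hK : Primrec K) : Primrec fun p => cDistinct (K p) := by
  unfold cDistinct; fun_prop

@[fun_prop] theorem primrec_cSubterms (ht : Primrec t) : Primrec fun p => cSubterms (t p) := by
  unfold cSubterms; fun_prop

@[fun_prop] theorem primrec_cFormTerms (hφ : Primrec φ) : Primrec fun p => cFormTerms (φ p) := by
  unfold cFormTerms; fun_prop

@[fun_prop] theorem primrec_cPurePart (hr : Primrec r) (hnm : Primrec fun p : P × ℕ => nm p.1 p.2)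
    (hK : Primrec K) (hS : Primrec S) (hls : Primrec ls) :
    Primrec fun p => cPurePart (r p) (nm p) (K p) (S p) (ls p) := by
  have h1 : Primrec fun q : P × ℕ => cFlatDef (r q.1) (nm q.1) q.2 :=
    primrec_cFlatDef (by fun_prop) (hnm.comp (g := fun q : (P × ℕ) × ℕ => (q.1.1, q.2))
      (by fun_prop)) (by fun_prop)
  have h2 : Primrec fun q : P × ℕ => cFlatLit (r q.1) (nm q.1) q.2 :=
    primrec_cFlatLit (by fun_prop) (hnm.comp (g := fun q : (P × ℕ) × ℕ => (q.1.1, q.2))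
      (by fun_prop)) (by fun_prop)
  unfold cPurePart
  fun_prop
end

variable {c : SymbolCoding L} {c' : SymbolCoding L'} {p : Side L L'}
  {nm : L.Term (Fin n ⊕ Fin k) → Fin K} {nmC : ℕ → ℕ}

theorem codeFormula_flatDef (hp : p.Tracks c c') (hnm : ∀ t, (nm t : ℕ) = nmC (codeTerm c t))
    (t : L.Term (Fin n ⊕ Fin k)) :
    (flatDef p nm t).map (codeFormula c') = cFlatDef p.index nmC (codeTerm c t) := by
  rcases t with (i | j) | ⟨f, ts⟩
  · have := hnm (Term.var (Sum.inl i))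
    simp only [codeTerm_var, Encodable.encode_inl, encode_fin] at this
    by_cases h : p.index = 0 <;>
      simp [flatDef, cFlatDef, h, eqVar, encode_fin, this]
  · simp [flatDef, cFlatDef]
  · have h1 := hnm (Term.func f ts)
    have h2 : ∀ q, codeFormula c' (equal (Term.var (Sum.inr (nm (Term.func f ts))))
        (Term.func q fun i => Term.var (Sum.inr (nm (ts i)))) : L'.BoundedFormula (Fin n) K) =
        (fun q => cEq (cVar (2 * nmC (codeTerm c (Term.func f ts)) + 1))
          (cFun q (List.ofFn fun i => cVar (2 * nmC (codeTerm c (ts i)) + 1)))) (c'.func ⟨_, q⟩) := by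
      intro q
      simp only [codeFormula_equal, codeTerm_var, codeTerm_func, Encodable.encode_inr, encode_fin,
        hnm]
    simp only [flatDef, List.map_map, Function.comp_def, h2]
    refine Eq.trans (b := ((p.func f).toList.map fun q => c'.func ⟨_, q⟩).map fun q =>
      cEq (cVar (2 * nmC (codeTerm c (Term.func f ts)) + 1))
          (cFun q (List.ofFn fun i => cVar (2 * nmC (codeTerm c (ts i)) + 1))))
      (by rw [List.map_map]; rfl) ?_
    rw [hp.func]
    simp only [cFlatDef, codeTerm_func, termFold_cFun, List.map_ofFn,
      Function.comp_def]
    split_ifs <;> simp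

theorem codeFormula_flatLit (hp : p.Tracks c c') (hnm : ∀ t, (nm t : ℕ) = nmC (codeTerm c t))
    {φ : L.BoundedFormula (Fin n) k} (hφ : IsLiteral φ) :
    (flatLit p nm φ).map (codeFormula c') = cFlatLit p.index nmC (codeFormula c φ) := by
  have key : ∀ {φ : L.BoundedFormula (Fin n) k}, φ.IsAtomic →
      (flatLit p nm φ).map (codeFormula c') = cFlatLit p.index nmC (codeFormula c φ) := by
    intro φ hφ
    cases hφ with
    | equal s t =>
      by_cases h : p.index = 0 <;>
        simp [Term.bdEqual, flatLit, cFlatLit, h, eqVar, encode_fin, hnm]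
    | rel R ts =>
      have h2 : ∀ q, codeFormula c' (rel q fun i => Term.var (Sum.inr (nm (ts i))) :
          L'.BoundedFormula (Fin n) K) =
          (fun q => cRel q (List.ofFn fun i => cVar (2 * nmC (codeTerm c (ts i)) + 1)))
            (c'.rel ⟨_, q⟩) := by
        intro q
        simp only [codeFormula_rel, codeTerm_var, Encodable.encode_inr, encode_fin, hnm]
      simp only [Relations.boundedFormula, flatLit, List.map_map, Function.comp_def, h2]
      refine Eq.trans (b := ((p.rel R).toList.map fun q => c'.rel ⟨_, q⟩).map fun q =>
        cRel q (List.ofFn fun i => cVar (2 * nmC (codeTerm c (ts i)) + 1)))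
        (by rw [List.map_map]; rfl) ?_
      rw [hp.rel]
      simp only [cFlatLit, codeFormula_rel, formFold_cRel, List.map_ofFn, Function.comp_def]
      split_ifs <;> simp
  rcases hφ with hφ | ⟨φ, hφ, rfl⟩
  · exact key hφ
  · have h := key hφ
    rw [codeFormula_not, cNot, cFlatLit, formFold_cImp]
    rw [cFlatLit] at h
    rw [← h, BoundedFormula.not, flatLit, List.map_map, List.map_map]
    exact List.map_congr_left fun θ _ => by simp

theorem codeFormula_distinct : (distinct L' n K).map (codeFormula c') = cDistinct K := by
  rw [distinct, cDistinct, ← List.map_coe_finRange_eq_range, List.map_flatMap, List.flatMap_map]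
  refine congrArg List.flatten (List.map_congr_left fun i _ => ?_)
  simp only [List.map_flatMap, List.flatMap_map]
  refine congrArg List.flatten (List.map_congr_left fun j _ => ?_)
  split_ifs <;> simp [eqVar, encode_fin]

theorem codeTerm_subterms {α : Type*} [Encodable α] (t : L.Term α) :
    (subterms t).map (codeTerm c) = cSubterms (codeTerm c t) := by
  induction t with
  | var a => simp [subterms, cSubterms]
  | func f ts ih =>
    unfold cSubterms at ih ⊢
    simp [subterms, List.map_ofFn, Function.comp_def, List.map_flatten, ih]

theorem codeTerm_formTerms {φ : L.BoundedFormula (Fin n) k} :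
    (formTerms φ).map (codeTerm c) = cFormTerms (codeFormula c φ) := by
  unfold cFormTerms
  induction φ with
  | falsum => simp [formTerms]
  | equal s t => simp [formTerms, codeTerm_subterms]
  | rel R ts =>
    simp [formTerms, List.map_ofFn, Function.comp_def, List.map_flatten, codeTerm_subterms]
  | imp φ ψ ih₁ ih₂ => simp [formTerms, ih₁, ih₂]
  | all φ ih => simp [formTerms]

theorem codeFormula_purePart (hp : p.Tracks c c') (hnm : ∀ t, (nm t : ℕ) = nmC (codeTerm c t))
    (S : List (L.Term (Fin n ⊕ Fin k))) {ls : List (L.BoundedFormula (Fin n) k)}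
    (hls : ∀ φ ∈ ls, IsLiteral φ) : codeFormula c' (purePart p nm S ls) =
      cPurePart p.index nmC K (S.map (codeTerm c)) (ls.map (codeFormula c)) := by
  rw [purePart, codeFormula_conj, cPurePart, List.map_append, List.map_append, codeFormula_distinct,
    List.map_flatMap, List.map_flatMap, List.flatMap_map, List.flatMap_map]
  congr 3
  · exact congrArg List.flatten (List.map_congr_left fun t _ => codeFormula_flatDef hp hnm t)
  · exact congrArg List.flatten (List.map_congr_left fun φ hφ =>
      codeFormula_flatLit hp hnm (hls φ hφ))

end Flattening

/-! ### Separating the two signatures in a conjunction of literals. -/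

section Purification

variable {L₁ : FirstOrder.Language.{u₁, v₁}} {L₂ : FirstOrder.Language.{u₂, v₂}} {n k K : ℕ}

/-- The symbols of the first signature, and the equations. -/
def leftSide (L₁ : FirstOrder.Language.{u₁, v₁}) (L₂ : FirstOrder.Language.{u₂, v₂}) :
    Side (L₁.sum L₂) L₁ where
  func {l} (f : L₁.Functions l ⊕ L₂.Functions l) := f.getLeft?
  rel {l} (R : L₁.Relations l ⊕ L₂.Relations l) := R.getLeft?
  index := 0

/-- The symbols of the second signature. -/
def rightSide (L₁ : FirstOrder.Language.{u₁, v₁}) (L₂ : FirstOrder.Language.{u₂, v₂}) :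
    Side (L₁.sum L₂) L₂ where
  func {l} (f : L₁.Functions l ⊕ L₂.Functions l) := f.getRight?
  rel {l} (R : L₁.Relations l ⊕ L₂.Relations l) := R.getRight?
  index := 1

theorem tracks_leftSide (c₁ : SymbolCoding L₁) (c₂ : SymbolCoding L₂) :
    (leftSide L₁ L₂).Tracks (c₁.sum c₂) c₁ := by
  constructor <;> rintro l (f | f) <;> simp [leftSide, SymbolCoding.sum, Nat.add_mod]

theorem tracks_rightSide (c₁ : SymbolCoding L₁) (c₂ : SymbolCoding L₂) :
    (rightSide L₁ L₂).Tracks (c₁.sum c₂) c₂ := by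
  constructor <;> rintro l (f | f) <;> simp [rightSide, SymbolCoding.sum, Nat.add_mod] <;> omega

theorem realize_flatDef_var {M : Type*} [L₁.Structure M]
    {nm : (L₁.sum L₂).Term (Fin n ⊕ Fin k) → Fin K} {x : Fin n → M} {d : Fin K → M} (i : Fin n) :
    (∀ θ ∈ flatDef (leftSide L₁ L₂) nm (Term.var (Sum.inl i)), θ.Realize x d) ↔
      d (nm (Term.var (Sum.inl i))) = x i := by
  simp [flatDef, leftSide]

section Semantics

variable {M : Type*} [L₁.Structure M] [L₂.Structure M] [(L₁.sum L₂).Structure M]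
  [(LHom.sumInl : L₁ →ᴸ L₁.sum L₂).IsExpansionOn M]
  [(LHom.sumInr : L₂ →ᴸ L₁.sum L₂).IsExpansionOn M]
  {nm : (L₁.sum L₂).Term (Fin n ⊕ Fin k) → Fin K} {x : Fin n → M} {d : Fin K → M}

/-- A function symbol belongs to exactly one signature: that side contributes the equation and the
other contributes nothing. -/
theorem realize_flatDef_func {l : ℕ} (f : (L₁.sum L₂).Functions l)
    (ts : Fin l → (L₁.sum L₂).Term (Fin n ⊕ Fin k)) :
    ((∀ θ ∈ flatDef (leftSide L₁ L₂) nm (Term.func f ts), θ.Realize x d) ∧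
      ∀ θ ∈ flatDef (rightSide L₁ L₂) nm (Term.func f ts), θ.Realize x d) ↔
      d (nm (Term.func f ts)) = Structure.funMap f fun i => d (nm (ts i)) := by
  rcases f with f | f
  · have h := LHom.map_onFunction (LHom.sumInl : L₁ →ᴸ L₁.sum L₂) f fun i => d (nm (ts i))
    simp only [LHom.sumInl] at h
    rw [h]
    simp [flatDef, leftSide, rightSide, Realize]
  · have h := LHom.map_onFunction (LHom.sumInr : L₂ →ᴸ L₁.sum L₂) f fun i => d (nm (ts i))
    simp only [LHom.sumInr] at h
    rw [h]
    simp [flatDef, leftSide, rightSide, Realize]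

theorem realize_flatLit {e : Fin k → M} {φ : (L₁.sum L₂).BoundedFormula (Fin n) k}
    (hφ : IsLiteral φ) (h : ∀ t ∈ formTerms φ, t.realize (Sum.elim x e) = d (nm t)) :
    ((∀ θ ∈ flatLit (leftSide L₁ L₂) nm φ, θ.Realize x d) ∧
      ∀ θ ∈ flatLit (rightSide L₁ L₂) nm φ, θ.Realize x d) ↔ φ.Realize x e := by
  have eq : ∀ (s t : (L₁.sum L₂).Term (Fin n ⊕ Fin k)), (∀ r ∈ formTerms (equal s t),
      r.realize (Sum.elim x e) = d (nm r)) →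
      (d (nm s) = d (nm t) ↔ (equal s t).Realize x e) := by
    intro s t h
    rw [← h s (by simp [formTerms, mem_subterms_self]),
      ← h t (by simp [formTerms, mem_subterms_self])]
    rfl
  have rl : ∀ {l : ℕ} (R : (L₁.sum L₂).Relations l)
      (ts : Fin l → (L₁.sum L₂).Term (Fin n ⊕ Fin k)),
      (∀ r ∈ formTerms (rel R ts), r.realize (Sum.elim x e) = d (nm r)) →
      ((rel R ts).Realize x e ↔ Structure.RelMap R fun i => d (nm (ts i))) := by
    intro l R ts h
    have : (fun i => d (nm (ts i))) = fun i => (ts i).realize (Sum.elim x e) := funext fun i =>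
      (h _ (List.mem_flatten.2 ⟨_, (List.mem_ofFn' _ _).2 ⟨i, rfl⟩, mem_subterms_self _⟩)).symm
    rw [this]
    rfl
  rcases hφ with hφ | ⟨φ, hφ, rfl⟩
  · cases hφ with
    | equal s t =>
      rw [Term.bdEqual] at h ⊢
      rw [← eq s t h]
      simp [flatLit, leftSide, rightSide]
    | rel R ts =>
      rw [Relations.boundedFormula] at h ⊢
      rw [rl R ts h]
      rcases R with R | R
      · have h := LHom.map_onRelation (LHom.sumInl : L₁ →ᴸ L₁.sum L₂) R fun i => d (nm (ts i))
        simp only [LHom.sumInl] at h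
        rw [h]
        simp [flatLit, leftSide, rightSide, Realize]
      · have h := LHom.map_onRelation (LHom.sumInr : L₂ →ᴸ L₁.sum L₂) R fun i => d (nm (ts i))
        simp only [LHom.sumInr] at h
        rw [h]
        simp [flatLit, leftSide, rightSide, Realize]
  · have h : ∀ t ∈ formTerms φ, t.realize (Sum.elim x e) = d (nm t) := fun t ht =>
      h t (by simp [formTerms, ht])
    rw [realize_not]
    cases hφ with
    | equal s t =>
      rw [Term.bdEqual] at h ⊢
      rw [← eq s t h]
      simp [flatLit, BoundedFormula.not, leftSide, rightSide, Realize]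
    | rel R ts =>
      rw [Relations.boundedFormula] at h ⊢
      rw [rl R ts h]
      rcases R with R | R
      · have h := LHom.map_onRelation (LHom.sumInl : L₁ →ᴸ L₁.sum L₂) R fun i => d (nm (ts i))
        simp only [LHom.sumInl] at h
        rw [h]
        simp [flatLit, BoundedFormula.not, leftSide, rightSide, Realize]
      · have h := LHom.map_onRelation (LHom.sumInr : L₂ →ᴸ L₁.sum L₂) R fun i => d (nm (ts i))
        simp only [LHom.sumInr] at h
        rw [h]
        simp [flatLit, BoundedFormula.not, leftSide, rightSide, Realize]

end Semantics

/-- The working formula given by a naming of the terms in `ls`. -/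
def pureForm (K : ℕ) (nm : (L₁.sum L₂).Term (Fin n ⊕ Fin k) → Fin K)
    (ls : List ((L₁.sum L₂).BoundedFormula (Fin n) k)) : WorkingFormula L₁ L₂ n where
  m := n
  k := K
  -- At the start the defined variables are the parameters themselves.
  terms := Term.var
  ψ₁ := purePart (leftSide L₁ L₂) nm (ls.flatMap formTerms) ls
  ψ₂ := purePart (rightSide L₁ L₂) nm (ls.flatMap formTerms) ls

theorem isProper_pureForm (nm : (L₁.sum L₂).Term (Fin n ⊕ Fin k) → Fin K)
    {ls : List ((L₁.sum L₂).BoundedFormula (Fin n) k)} (hls : ∀ φ ∈ ls, IsLiteral φ) :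
    (pureForm K nm ls).IsProper :=
  ⟨isConstraint_purePart _ _ _ hls, isConstraint_purePart _ _ _ hls,
    forcesInjective_purePart _ _ _ _, forcesInjective_purePart _ _ _ _⟩

/-- The list of terms is closed under subterms, so the defining equations force, by induction on
terms, each slot to carry the value of every term that it names. Injectivity makes the naming record
exactly which values coincide. -/
theorem holds_pureForm {M : Type*} [L₁.Structure M] [L₂.Structure M] [(L₁.sum L₂).Structure M]
    [(LHom.sumInl : L₁ →ᴸ L₁.sum L₂).IsExpansionOn M]
    [(LHom.sumInr : L₂ →ᴸ L₁.sum L₂).IsExpansionOn M]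
    {nm : (L₁.sum L₂).Term (Fin n ⊕ Fin k) → Fin K}
    {ls : List ((L₁.sum L₂).BoundedFormula (Fin n) k)} (hls : ∀ φ ∈ ls, IsLiteral φ)
    {x : Fin n → M} : (pureForm K nm ls).Holds x ↔
      ∃ (e : Fin k → M) (d : Fin K → M), Function.Injective d ∧ (∀ φ ∈ ls, φ.Realize x e) ∧
        ∀ t ∈ ls.flatMap formTerms, t.realize (Sum.elim x e) = d (nm t) := by
  constructor
  · rintro ⟨d, h₁, h₂⟩
    obtain ⟨hd₁, hl₁, hi⟩ := realize_purePart.1 h₁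
    obtain ⟨hd₂, hl₂, -⟩ := realize_purePart.1 h₂
    -- The existential variables receive the values of their slots.
    have key : ∀ t ∈ ls.flatMap formTerms,
        t.realize (Sum.elim x fun j => d (nm (Term.var (Sum.inr j)))) = d (nm t) := by
      intro t
      induction t with
      | var a =>
        intro ht
        rcases a with i | j
        · exact ((realize_flatDef_var i).1 (hd₁ _ ht)).symm
        · rfl
      | func f ts ih =>
        intro ht
        have h := (realize_flatDef_func f ts).1 ⟨hd₁ _ ht, hd₂ _ ht⟩
        refine Eq.trans ?_ h.symm
        rw [Term.realize]
        congr 1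
        funext i
        refine ih i ?_
        obtain ⟨φ, hφ, ht⟩ := List.mem_flatMap.1 ht
        exact List.mem_flatMap.2 ⟨φ, hφ, mem_formTerms_of_func ht i⟩
    refine ⟨_, d, hi, fun φ hφ => ?_, key⟩
    exact (realize_flatLit (hls φ hφ) fun t ht => key t (List.mem_flatMap.2 ⟨φ, hφ, ht⟩)).1
      ⟨hl₁ φ hφ, hl₂ φ hφ⟩
  · rintro ⟨e, d, hi, hl, ht⟩
    have hd : ∀ t ∈ ls.flatMap formTerms,
        (∀ θ ∈ flatDef (leftSide L₁ L₂) nm t, θ.Realize x d) ∧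
          ∀ θ ∈ flatDef (rightSide L₁ L₂) nm t, θ.Realize x d := by
      intro t htS
      rcases t with (i | j) | ⟨f, ts⟩
      · exact ⟨(realize_flatDef_var i).2 (ht _ htS).symm, by simp [flatDef, rightSide]⟩
      · simp [flatDef]
      · refine (realize_flatDef_func f ts).2 ((ht _ htS).symm.trans ?_)
        rw [Term.realize]
        congr 1
        funext i
        refine ht _ ?_
        obtain ⟨φ, hφ, htS⟩ := List.mem_flatMap.1 htS
        exact List.mem_flatMap.2 ⟨φ, hφ, mem_formTerms_of_func htS i⟩
    have hlit : ∀ φ ∈ ls, (∀ θ ∈ flatLit (leftSide L₁ L₂) nm φ, θ.Realize x d) ∧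
        ∀ θ ∈ flatLit (rightSide L₁ L₂) nm φ, θ.Realize x d := fun φ hφ =>
      (realize_flatLit (hls φ hφ) fun t h => ht t (List.mem_flatMap.2 ⟨φ, hφ, h⟩)).2 (hl φ hφ)
    exact ⟨d, realize_purePart.2 ⟨fun t h => (hd t h).1, fun φ h => (hlit φ h).1, hi⟩,
      realize_purePart.2 ⟨fun t h => (hd t h).2, fun φ h => (hlit φ h).2, hi⟩⟩

/-- The lists of length `N` with entries at most `b`. -/
def tuples (b N : ℕ) : List (List ℕ) :=
  (fun T : List (List ℕ) => T.flatMap fun l => (List.range (b + 1)).map fun a => a :: l)^[N] [ [] ]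

@[fun_prop] theorem primrec_tuples {P : Type*} [Primcodable P] {b N : P → ℕ} (hb : Primrec b)
    (hN : Primrec N) : Primrec fun p => tuples (b p) (N p) := by
  unfold tuples; fun_prop

theorem mem_tuples {b : ℕ} {l : List ℕ} (h : ∀ a ∈ l, a ≤ b) : l ∈ tuples b l.length := by
  unfold tuples
  induction l with
  | nil => simp
  | cons a l ih =>
    have := ih fun a ha => h a (by simp [ha])
    rw [List.length_cons, Function.iterate_succ_apply']
    refine List.mem_flatMap.2 ⟨l, this, List.mem_map.2 ⟨a, ?_, rfl⟩⟩
    exact List.mem_range.2 (Nat.lt_succ_of_le (h a (by simp)))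

/-- The name of an entry of `S`, according to the list `G` of names. -/
def cName (b : ℕ) (S G : List ℕ) (t : ℕ) : ℕ := G.getD (S.idxOf t) 0 % (b + 1)

@[fun_prop] theorem primrec_cName {P : Type*} [Primcodable P] {b t : P → ℕ} {S G : P → List ℕ}
    (hb : Primrec b) (hS : Primrec S) (hG : Primrec G) (ht : Primrec t) :
    Primrec fun p => cName (b p) (S p) (G p) (t p) := by
  unfold cName; fun_prop

/-- The distinct values are enumerated without repetition. At least one slot is kept even for an
empty list, so that every term can be given a name. -/
theorem exists_injective_covering {M : Type*} [Nonempty M] (vs : List M) :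
    ∃ b ≤ vs.length, ∃ d : Fin (b + 1) → M, Function.Injective d ∧ ∀ v ∈ vs, ∃ i, d i = v := by
  classical
  rcases vs with - | ⟨v, vs⟩
  · exact ⟨0, le_rfl, fun _ => Classical.arbitrary M, fun i j _ => Fin.ext (by omega), by simp⟩
  · have h0 : (v :: vs).toFinset.card ≠ 0 :=
      Finset.card_ne_zero.2 ⟨v, by simp⟩
    obtain ⟨b, hb⟩ := Nat.exists_eq_succ_of_ne_zero h0
    let q := ((v :: vs).toFinset.equivFinOfCardEq hb).symm
    refine ⟨b, ?_, fun i => (q i).1, Subtype.val_injective.comp q.injective, fun v' hv' =>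
      ⟨q.symm ⟨v', List.mem_toFinset.2 hv'⟩, by simp⟩⟩
    have := List.toFinset_card_le (v :: vs)
    omega

/-- The name of a term, according to a list of names for the codes in `S`. -/
def slotName (c : SymbolCoding (L₁.sum L₂)) (b : ℕ) (S G : List ℕ)
    (t : (L₁.sum L₂).Term (Fin n ⊕ Fin k)) : Fin (b + 1) :=
  ⟨cName b S G (codeTerm c t), Nat.mod_lt _ b.succ_pos⟩

/-- On listed terms the reduction modulo b + 1 and the default of `cName` have no effect; their only
role is to make naming total. -/
theorem slotName_eq {c : SymbolCoding (L₁.sum L₂)} {b : ℕ}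
    {S : List ((L₁.sum L₂).Term (Fin n ⊕ Fin k))}
    (nm : (L₁.sum L₂).Term (Fin n ⊕ Fin k) → Fin (b + 1))
    {t : (L₁.sum L₂).Term (Fin n ⊕ Fin k)} (ht : t ∈ S) :
    slotName c b (S.map (codeTerm c)) (S.map fun t => (nm t : ℕ)) t = nm t := by
  ext
  have h1 : (S.map (codeTerm c)).idxOf (codeTerm c t) < (S.map (codeTerm c)).length :=
    List.idxOf_lt_length_iff.2 (List.mem_map_of_mem ht)
  have h2 : (S.map (codeTerm c)).idxOf (codeTerm c t) < S.length := by simpa using h1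
  have h3 := List.getElem_idxOf h1
  rw [List.getElem_map] at h3
  have h3 := codeTerm_injective c h3
  simp only [slotName, cName]
  rw [List.getD_eq_getElem _ _ (by simpa using h2), List.getElem_map, h3,
    Nat.mod_eq_of_lt (nm t).2]

/-- Separate the symbols in a conjunction of literals, in all possible ways. -/
def purify (c : SymbolCoding (L₁.sum L₂)) (ls : List ((L₁.sum L₂).BoundedFormula (Fin n) k)) :
    List (WorkingFormula L₁ L₂ n) :=
  (List.range ((ls.flatMap formTerms).length + 1)).flatMap fun b =>
    (tuples b (ls.flatMap formTerms).length).map fun G =>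
      pureForm (b + 1) (slotName c b ((ls.flatMap formTerms).map (codeTerm c)) G) ls

/-- `purify` on Gödel numbers. -/
def cPurify (n : ℕ) (ls : List ℕ) : List WorkingCode :=
  (List.range ((ls.flatMap fun φ => cFormTerms φ).length + 1)).flatMap fun b =>
    (tuples b (ls.flatMap fun φ => cFormTerms φ).length).map fun G =>
      (n, b + 1, (List.range n).map fun i => cVar i,
        cPurePart 0 (cName b (ls.flatMap fun φ => cFormTerms φ) G) (b + 1)
          (ls.flatMap fun φ => cFormTerms φ) ls,
        cPurePart 1 (cName b (ls.flatMap fun φ => cFormTerms φ) G) (b + 1)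
          (ls.flatMap fun φ => cFormTerms φ) ls)

@[fun_prop] theorem primrec_cPurify {P : Type*} [Primcodable P] {n : P → ℕ} {ls : P → List ℕ}
    (hn : Primrec n) (hls : Primrec ls) : Primrec fun p => cPurify (n p) (ls p) := by
  unfold cPurify; fun_prop

theorem isProper_of_mem_purify {c : SymbolCoding (L₁.sum L₂)}
    {ls : List ((L₁.sum L₂).BoundedFormula (Fin n) k)} (hls : ∀ φ ∈ ls, IsLiteral φ)
    {W : WorkingFormula L₁ L₂ n} (hW : W ∈ purify c ls) : W.IsProper := by
  simp only [purify, List.mem_flatMap, List.mem_map] at hW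
  obtain ⟨b, -, G, -, rfl⟩ := hW
  exact isProper_pureForm _ hls

/-- Whatever the naming, a pure form implies the literals. Conversely, given witnesses, each term is
named by the index of its value, and this naming is among those enumerated. -/
theorem exists_holds_purify {M : Type*} [L₁.Structure M] [L₂.Structure M]
    [(L₁.sum L₂).Structure M] [(LHom.sumInl : L₁ →ᴸ L₁.sum L₂).IsExpansionOn M]
    [(LHom.sumInr : L₂ →ᴸ L₁.sum L₂).IsExpansionOn M] [Nonempty M]
    (c : SymbolCoding (L₁.sum L₂))
    {ls : List ((L₁.sum L₂).BoundedFormula (Fin n) k)} (hls : ∀ φ ∈ ls, IsLiteral φ)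
    {x : Fin n → M} :
    (∃ W ∈ purify c ls, W.Holds x) ↔ ∃ e : Fin k → M, ∀ φ ∈ ls, φ.Realize x e := by
  constructor
  · rintro ⟨W, hW, h⟩
    simp only [purify, List.mem_flatMap, List.mem_map] at hW
    obtain ⟨b, -, G, -, rfl⟩ := hW
    obtain ⟨e, d, -, he, -⟩ := (holds_pureForm hls).1 h
    exact ⟨e, he⟩
  · rintro ⟨e, he⟩
    obtain ⟨b, hb, d, hd, hv⟩ := exists_injective_covering
      ((ls.flatMap formTerms).map fun t => t.realize (Sum.elim x e))
    -- Terms outside the list receive the irrelevant name 0.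
    have hnm : ∀ t : (L₁.sum L₂).Term (Fin n ⊕ Fin k), ∃ i : Fin (b + 1),
        t ∈ ls.flatMap formTerms → t.realize (Sum.elim x e) = d i := fun t => by
      by_cases ht : t ∈ ls.flatMap formTerms
      · obtain ⟨i, hi⟩ := hv _ (List.mem_map_of_mem ht)
        exact ⟨i, fun _ => hi.symm⟩
      · exact ⟨0, fun h => absurd h ht⟩
    choose nm hnm using hnm
    refine ⟨pureForm (b + 1) (slotName c b ((ls.flatMap formTerms).map (codeTerm c))
      ((ls.flatMap formTerms).map fun t => (nm t : ℕ))) ls, ?_, ?_⟩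
    · simp only [purify, List.mem_flatMap, List.mem_map]
      refine ⟨b, ?_, _, ?_, rfl⟩
      · rw [List.length_map] at hb
        exact List.mem_range.2 (Nat.lt_succ_of_le hb)
      · have := mem_tuples (b := b) (l := (ls.flatMap formTerms).map fun t => (nm t : ℕ))
          fun a ha => by
            obtain ⟨t, -, rfl⟩ := List.mem_map.1 ha
            exact Nat.le_of_lt_succ (nm t).2
        rwa [List.length_map] at this
    · refine (holds_pureForm hls).2 ⟨e, d, hd, he, fun t ht => ?_⟩
      rw [slotName_eq nm ht]
      exact hnm t ht

theorem code_purify (c₁ : SymbolCoding L₁) (c₂ : SymbolCoding L₂)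
    {ls : List ((L₁.sum L₂).BoundedFormula (Fin n) k)} (hls : ∀ φ ∈ ls, IsLiteral φ) :
    ((purify (c₁.sum c₂) ls).map fun W => W.code c₁ c₂) =
      cPurify n (ls.map (codeFormula (c₁.sum c₂))) := by
  have h1 : ((ls.map (codeFormula (c₁.sum c₂))).flatMap fun φ => cFormTerms φ) =
      (ls.flatMap formTerms).map (codeTerm (c₁.sum c₂)) := by
    rw [List.flatMap_map, List.map_flatMap]
    exact congrArg List.flatten (List.map_congr_left fun φ _ => codeTerm_formTerms.symm)
  rw [purify, cPurify, h1, List.map_flatMap, List.length_map]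
  refine congrArg List.flatten (List.map_congr_left fun b _ => ?_)
  rw [List.map_map]
  refine List.map_congr_left fun G _ => ?_
  refine Prod.ext rfl (Prod.ext rfl (Prod.ext ?_ (Prod.ext ?_ ?_)))
  · simp only [Function.comp_apply, WorkingFormula.code, pureForm, codeTerm_var, encode_fin]
    rw [← List.map_coe_finRange_eq_range, List.map_map, List.ofFn_eq_map]
    rfl
  · exact codeFormula_purePart (tracks_leftSide c₁ c₂) (fun _ => rfl) _ hls
  · exact codeFormula_purePart (tracks_rightSide c₁ c₂) (fun _ => rfl) _ hls

end Purification

/-! ### Terminal decompositions and covers in the combined signature. -/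

section Decomposition

variable {L₁ : FirstOrder.Language.{u₁, v₁}} {L₂ : FirstOrder.Language.{u₂, v₂}}
  {T₁ : L₁.Theory} {T₂ : L₂.Theory} {n k : ℕ}

theorem WorkingFormula.holds_iff (W : WorkingFormula L₁ L₂ n) {M : Type*} [L₁.Structure M]
    [L₂.Structure M] [(L₁.sum L₂).Structure M]
    [(LHom.sumInl : L₁ →ᴸ L₁.sum L₂).IsExpansionOn M]
    [(LHom.sumInr : L₂ →ᴸ L₁.sum L₂).IsExpansionOn M] (x : Fin n → M) :
    W.Holds x ↔ ∃ e, W.matrix.Realize x e :=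
  exists_congr fun e => (W.realize_combine W.ψ₁ W.ψ₂ x e).symm

theorem isTerminalDecomposition_iff {φ : (L₁.sum L₂).BoundedFormula (Fin n) k}
    {Ws : List (WorkingFormula L₁ L₂ n)} : IsTerminalDecomposition T₁ T₂ φ Ws ↔
      (∀ W ∈ Ws, W.IsTerminal T₁ T₂) ∧
      ∀ (M : Theory.ModelType.{max u₁ u₂, max v₁ v₂, max (max u₁ u₂) (max v₁ v₂)}
        (unionTheory T₁ T₂)) (x : Fin n → M),
        (∃ e, φ.Realize x e) ↔ ∃ W ∈ Ws, ∃ e, W.matrix.Realize x e := by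
  refine and_congr_right fun _ => ?_
  rw [Theory.models_formula_iff]
  refine forall₂_congr fun M x => ?_
  rw [Formula.Realize, realize_iff, realize_foldr_sup]
  refine iff_congr realize_exs ?_
  simp only [List.mem_map, exists_exists_and_eq_and]
  exact exists_congr fun W => and_congr_right fun _ => realize_exs

/-- A bound on the numbers of existential variables. -/
def cRounds (Ws : List WorkingCode) : ℕ := Ws.foldr (fun W r => W.2.1 + 1 + r) 0

/-- Decompose an existential formula into terminal working formulas. -/
def cDecompose (S₁ S₂ : ℕ × ℕ × ℕ → Option (List (ℕ × ℕ × ℕ) × List ℕ)) (n φ : ℕ) :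
    Option (List WorkingCode) :=
  (cLoop S₁ S₂ (cRounds ((cDnf φ).1.flatMap fun ls => cPurify n ls))
    ((cDnf φ).1.flatMap fun ls => cPurify n ls)).map fun p => p.1

@[fun_prop] theorem primrec_cRounds {P : Type*} [Primcodable P] {Ws : P → List WorkingCode}
    (h : Primrec Ws) : Primrec fun p => cRounds (Ws p) := by
  unfold cRounds; fun_prop

@[fun_prop] theorem primrec_cDecompose {P : Type*} [Primcodable P]
    {S₁ S₂ : P → ℕ × ℕ × ℕ → Option (List (ℕ × ℕ × ℕ) × List ℕ)} {n φ : P → ℕ}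
    (h₁ : Primrec fun p : P × ℕ × ℕ × ℕ => S₁ p.1 p.2)
    (h₂ : Primrec fun p : P × ℕ × ℕ × ℕ => S₂ p.1 p.2) (hn : Primrec n) (hφ : Primrec φ) :
    Primrec fun p => cDecompose (S₁ p) (S₂ p) (n p) (φ p) := by
  unfold cDecompose; fun_prop

theorem lt_cRounds {Ws : List WorkingCode} {W : WorkingCode} (h : W ∈ Ws) :
    W.2.1 < cRounds Ws := by
  induction Ws with
  | nil => simp at h
  | cons a l ih =>
    rw [cRounds, List.foldr_cons]
    change _ < _ + cRounds l
    rcases List.mem_cons.1 h with rfl | h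
    · omega
    · have := ih h
      omega

/-- The matrix may be any quantifier-free formula, not just a constraint, since it is first put into
disjunctive normal form. Covers of all existential formulas rely on this. -/
theorem exists_conv_cDecompose {c₁ : SymbolCoding L₁} {c₂ : SymbolCoding L₂}
    {S₁ S₂ : ℕ → ℕ × ℕ × ℕ → Option (List (ℕ × ℕ × ℕ) × List ℕ)}
    (hS₁ : SplitOracle.{u₁, v₁, max (max u₁ u₂) (max v₁ v₂)} c₁ T₁ S₁)
    (hS₂ : SplitOracle.{u₂, v₂, max (max u₁ u₂) (max v₁ v₂)} c₂ T₂ S₂)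
    {φ : (L₁.sum L₂).BoundedFormula (Fin n) k} (hφ : φ.IsQF) :
    ∃ Ws : List (WorkingFormula L₁ L₂ n), IsTerminalDecomposition T₁ T₂ φ Ws ∧
      Conv (fun s => cDecompose (S₁ s) (S₂ s) n (codeFormula (c₁.sum c₂) φ))
        (Ws.map fun W => W.code c₁ c₂) := by
  have hlit : ∀ ls ∈ (dnf φ).1, ∀ ψ ∈ ls, IsLiteral ψ := isLiteral_of_mem_dnf.1
  let todo : List (WorkingFormula L₁ L₂ n) := (dnf φ).1.flatMap (purify (c₁.sum c₂))
  have hcode : (todo.map fun W => W.code c₁ c₂) =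
      (cDnf (codeFormula (c₁.sum c₂) φ)).1.flatMap fun ls => cPurify n ls := by
    rw [cDnf_codeFormula, List.flatMap_map, List.map_flatMap]
    exact congrArg List.flatten (List.map_congr_left fun ls hls => code_purify c₁ c₂ (hlit ls hls))
  have hproper : ∀ W ∈ todo, W.IsProper := fun W hW => by
    obtain ⟨ls, hls, hW⟩ := List.mem_flatMap.1 hW
    exact isProper_of_mem_purify (hlit ls hls) hW
  obtain ⟨Ws, todo', h1, h2, h3, h4⟩ := exists_conv_cLoop hS₁ hS₂ hproper
    (cRounds (todo.map fun W => W.code c₁ c₂))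
  -- A pending formula would come from an input formula with at least as many existential variables
  -- as there were rounds, whereas the number of rounds exceeds all these counts.
  obtain rfl : todo' = [] := by
    refine List.eq_nil_iff_forall_not_mem.2 fun W hW => ?_
    obtain ⟨-, W', hW', hle⟩ := h2 W hW
    have : W'.k < _ := lt_cRounds (List.mem_map_of_mem (f := fun W => W.code c₁ c₂) hW')
    omega
  refine ⟨Ws, isTerminalDecomposition_iff.2 ⟨h1, fun M x => ?_⟩, ?_⟩
  · let : L₁.Structure M := (LHom.sumInl : L₁ →ᴸ L₁.sum L₂).reduct M
    let : L₂.Structure M := (LHom.sumInr : L₂ →ᴸ L₁.sum L₂).reduct M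
    obtain ⟨hM₁, hM₂⟩ := model_unionTheory_iff.1 M.is_model
    have h5 := h3 M x
    simp only [List.not_mem_nil, false_and, exists_false, or_false] at h5
    simp only [← WorkingFormula.holds_iff, ← h5]
    constructor
    · rintro ⟨e, he⟩
      obtain ⟨ls, hls, he⟩ := (realize_dnf hφ x e).1.1 he
      obtain ⟨W, hW, h⟩ := (exists_holds_purify (c₁.sum c₂) (hlit ls hls)).2 ⟨e, he⟩
      exact ⟨W, List.mem_flatMap.2 ⟨ls, hls, hW⟩, h⟩
    · rintro ⟨W, hW, h⟩
      obtain ⟨ls, hls, hW⟩ := List.mem_flatMap.1 hW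
      obtain ⟨e, he⟩ := (exists_holds_purify (c₁.sum c₂) (hlit ls hls)).1 ⟨W, hW, h⟩
      exact ⟨e, (realize_dnf hφ x e).1.2 ⟨ls, hls, he⟩⟩
  · rw [hcode] at h4
    exact h4.map fun p => p.1

/-- The quantifier-free formula `θ₁(terms) ∧ θ₂(terms)`, without relabelling of variables. -/
def WorkingFormula.pureCombine (W : WorkingFormula L₁ L₂ n) (θ₁ : L₁.Formula (Fin W.m))
    (θ₂ : L₂.Formula (Fin W.m)) : (L₁.sum L₂).Formula (Fin n) :=
  transQF LHom.sumInl (Sum.elim (fun i => transTerm (LHom.id _) (fun j => Term.var (Sum.inl j))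
    (W.terms i)) Fin.elim0) θ₁ ⊓
  transQF LHom.sumInr (Sum.elim (fun i => transTerm (LHom.id _) (fun j => Term.var (Sum.inl j))
    (W.terms i)) Fin.elim0) θ₂

/-- `pureCombine` agrees semantically with `combine`, and its code is obtained from the components
by the translations on Gödel numbers. -/
theorem WorkingFormula.realize_pureCombine (W : WorkingFormula L₁ L₂ n) {θ₁ : L₁.Formula (Fin W.m)}
    {θ₂ : L₂.Formula (Fin W.m)} (h₁ : θ₁.IsQF) (h₂ : θ₂.IsQF) {M : Type*}
    [(L₁.sum L₂).Structure M] (x : Fin n → M) :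
    (W.pureCombine θ₁ θ₂).Realize x ↔ Formula.Realize (W.combine θ₁ θ₂) x := by
  let : L₁.Structure M := (LHom.sumInl : L₁ →ᴸ L₁.sum L₂).reduct M
  let : L₂.Structure M := (LHom.sumInr : L₂ →ᴸ L₁.sum L₂).reduct M
  have hterm : ∀ i, Term.realize (Sum.elim x default) (transTerm (LHom.id (L₁.sum L₂))
      (fun j => Term.var (Sum.inl j : Fin n ⊕ Fin 0)) (W.terms i)) = (W.terms i).realize x :=
    fun i => by rw [realize_transTerm]; rfl
  rw [Formula.Realize, Formula.Realize, W.realize_combine, pureCombine, realize_inf,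
    realize_transQF _ _ h₁, realize_transQF _ _ h₂]
  simp only [Sum.elim_inl, hterm]
  exact and_congr (iff_of_eq (congrArg _ (Subsingleton.elim _ _)))
    (iff_of_eq (congrArg _ (Subsingleton.elim _ _)))

/-- Substitution of the terms of a working formula on Gödel numbers. -/
def cSubstTerms (ts : List ℕ) (v : ℕ) : ℕ :=
  cTransTerm 1 0 (fun v => cVar (2 * v)) (ts.getD (v / 2) 0)

/-- `WorkingFormula.pureCombine` on Gödel numbers. -/
def cCombine (W : WorkingCode) (θ₁ θ₂ : ℕ) : ℕ :=
  cAnd (cTransQF 2 0 (cSubstTerms W.2.2.1) θ₁) (cTransQF 2 1 (cSubstTerms W.2.2.1) θ₂)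

@[fun_prop] theorem primrec_cSubstTerms {P : Type*} [Primcodable P] {ts : P → List ℕ} {v : P → ℕ}
    (hts : Primrec ts) (hv : Primrec v) : Primrec fun p => cSubstTerms (ts p) (v p) := by
  unfold cSubstTerms; fun_prop

@[fun_prop] theorem primrec_cCombine {P : Type*} [Primcodable P] {W : P → WorkingCode}
    {θ₁ θ₂ : P → ℕ} (hW : Primrec W) (h₁ : Primrec θ₁) (h₂ : Primrec θ₂) :
    Primrec fun p => cCombine (W p) (θ₁ p) (θ₂ p) := by
  unfold cCombine; fun_prop

theorem codeFormula_pureCombine (c₁ : SymbolCoding L₁) (c₂ : SymbolCoding L₂)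
    (W : WorkingFormula L₁ L₂ n) {θ₁ : L₁.Formula (Fin W.m)}
    {θ₂ : L₂.Formula (Fin W.m)} (h₁ : θ₁.IsQF) (h₂ : θ₂.IsQF) :
    codeFormula (c₁.sum c₂) (W.pureCombine θ₁ θ₂) =
      cCombine (W.code c₁ c₂) (codeFormula c₁ θ₁) (codeFormula c₂ θ₂) := by
  have hV : ∀ a : Fin W.m ⊕ Fin 0, codeTerm (c₁.sum c₂) (Sum.elim (fun i =>
      transTerm (LHom.id (L₁.sum L₂)) (fun j => Term.var (Sum.inl j : Fin n ⊕ Fin 0)) (W.terms i))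
      Fin.elim0 a) = cSubstTerms (W.code c₁ c₂).2.2.1 (Encodable.encode a) := by
    rintro (a | a)
    · have h1 : 2 * (a : ℕ) / 2 = a := by omega
      simp only [Sum.elim_inl, Encodable.encode_inl, encode_fin, cSubstTerms, h1]
      rw [codeTerm_transTerm (tracks_id (c₁.sum c₂)) (V := fun v => cVar (2 * v))
        (fun j => by simp)]
      congr 1
      rw [List.getD_eq_getElem _ _ (by simp [WorkingFormula.code])]
      simp [WorkingFormula.code]
    · exact a.elim0
  rw [WorkingFormula.pureCombine, codeFormula_inf, cCombine]
  refine congrArg₂ _ ?_ ?_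
  · exact codeFormula_transQF (tracks_inl c₁ c₂) hV h₁
  · exact codeFormula_transQF (tracks_inr c₁ c₂) hV h₂

/-- Compute covers in the combined signature. -/
def cCover (F₁ F₂ : ℕ × ℕ × ℕ → Option ℕ)
    (S₁ S₂ : ℕ × ℕ × ℕ → Option (List (ℕ × ℕ × ℕ) × List ℕ)) (n φ : ℕ) : Option ℕ :=
  (cDecompose S₁ S₂ n φ).bind fun Ws =>
    (optMapM (fun W : WorkingCode => (F₁ (W.1, W.2.1, W.2.2.2.1)).bind fun θ₁ =>
      (F₂ (W.1, W.2.1, W.2.2.2.2)).map fun θ₂ => cCombine W θ₁ θ₂) Ws).map fun l => cDisj l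

@[fun_prop] theorem primrec_cCover {P : Type*} [Primcodable P] {F₁ F₂ : P → ℕ × ℕ × ℕ → Option ℕ}
    {S₁ S₂ : P → ℕ × ℕ × ℕ → Option (List (ℕ × ℕ × ℕ) × List ℕ)} {n φ : P → ℕ}
    (hF₁ : Primrec fun p : P × ℕ × ℕ × ℕ => F₁ p.1 p.2)
    (hF₂ : Primrec fun p : P × ℕ × ℕ × ℕ => F₂ p.1 p.2)
    (h₁ : Primrec fun p : P × ℕ × ℕ × ℕ => S₁ p.1 p.2)
    (h₂ : Primrec fun p : P × ℕ × ℕ × ℕ => S₂ p.1 p.2) (hn : Primrec n) (hφ : Primrec φ) :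
    Primrec fun p => cCover (F₁ p) (F₂ p) (S₁ p) (S₂ p) (n p) (φ p) := by
  have h3 : Primrec fun p : (P × List WorkingCode) × WorkingCode =>
      F₁ p.1.1 (p.2.1, p.2.2.1, p.2.2.2.2.1) :=
    hF₁.comp (g := fun p : (P × List WorkingCode) × WorkingCode =>
      (p.1.1, p.2.1, p.2.2.1, p.2.2.2.2.1)) (by fun_prop)
  have h4 : Primrec fun p : ((P × List WorkingCode) × WorkingCode) × ℕ =>
      F₂ p.1.1.1 (p.1.2.1, p.1.2.2.1, p.1.2.2.2.2.2) :=
    hF₂.comp (g := fun p : ((P × List WorkingCode) × WorkingCode) × ℕ =>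
      (p.1.1.1, p.1.2.1, p.1.2.2.1, p.1.2.2.2.2.2)) (by fun_prop)
  unfold cCover
  fun_prop

/-- The disjunction of the covers of the terminal pieces is a cover. A tuple satisfying one disjunct
lies in an extension that realizes the corresponding piece; that extension is again a model of the
union, so the decomposition yields witnesses for φ in it. -/
theorem exists_conv_cCover [Countable L₁.Symbols] [Countable L₂.Symbols]
    (hconv₁ : IsConvex T₁) (hconv₂ : IsConvex T₂)
    (hsi₁ : IsStablyInfinite T₁) (hsi₂ : IsStablyInfinite T₂)
    (hei₁ : IsEqualityInterpolating T₁) (hei₂ : IsEqualityInterpolating T₂)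
    {c₁ : SymbolCoding L₁} {c₂ : SymbolCoding L₂} {F₁ F₂ : ℕ → ℕ × ℕ × ℕ → Option ℕ}
    {S₁ S₂ : ℕ → ℕ × ℕ × ℕ → Option (List (ℕ × ℕ × ℕ) × List ℕ)}
    (hF₁ : CoverOracle c₁ T₁ F₁) (hF₂ : CoverOracle c₂ T₂ F₂)
    (hS₁ : SplitOracle.{u₁, v₁, max (max u₁ u₂) (max v₁ v₂)} c₁ T₁ S₁)
    (hS₂ : SplitOracle.{u₂, v₂, max (max u₁ u₂) (max v₁ v₂)} c₂ T₂ S₂)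
    {φ : (L₁.sum L₂).BoundedFormula (Fin n) k} (hφ : φ.IsQF) :
    ∃ ψ : (L₁.sum L₂).Formula (Fin n), IsCover (unionTheory T₁ T₂) φ ψ ∧
      Conv (fun s => cCover (F₁ s) (F₂ s) (S₁ s) (S₂ s) n (codeFormula (c₁.sum c₂) φ))
        (codeFormula (c₁.sum c₂) ψ) := by
  obtain ⟨Ws, hWs, hc⟩ := exists_conv_cDecompose hS₁ hS₂ hφ
  obtain ⟨hterm, hr⟩ := isTerminalDecomposition_iff.1 hWs
  obtain ⟨ys, h1, h2, h3⟩ := Conv.exists_optMapM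
    (F := fun s W => (F₁ s (W.1, W.2.1, W.2.2.2.1)).bind fun θ₁ =>
      (F₂ s (W.1, W.2.1, W.2.2.2.2)).map fun θ₂ => cCombine W θ₁ θ₂) Ws
    (fun W => W.code c₁ c₂) (fun W (θ : (L₁.sum L₂).Formula (Fin n)) => θ.IsQF ∧
      ∃ (θ₁ : L₁.Formula (Fin W.m)) (θ₂ : L₂.Formula (Fin W.m)),
        IsCover T₁ W.ψ₁ θ₁ ∧ IsCover T₂ W.ψ₂ θ₂ ∧ θ = W.pureCombine θ₁ θ₂)
    (fun _ θ => codeFormula (c₁.sum c₂) θ) fun W hW => by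
      obtain ⟨θ₁, hθ₁, hc₁⟩ := hF₁ _ _ _ (hterm W hW).1.1.isQF
      obtain ⟨θ₂, hθ₂, hc₂⟩ := hF₂ _ _ _ (hterm W hW).2.1.isQF
      refine ⟨W.pureCombine θ₁ θ₂, ⟨(isQF_transQF _ _ hθ₁.1.1).inf (isQF_transQF _ _ hθ₂.1.1),
        θ₁, θ₂, hθ₁, hθ₂, rfl⟩, ?_⟩
      rw [codeFormula_pureCombine c₁ c₂ W hθ₁.1.1 hθ₂.1.1]
      exact hc₁.bind (hc₂.map _)
  refine ⟨disj (ys.map fun q => q.2), isCover_of_extension (isQF_disj fun θ hθ => ?_)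
    (fun M x e he => ?_) (fun M x hx => ?_), ?_⟩
  · obtain ⟨q, hq, rfl⟩ := List.mem_map.1 hθ
    exact (h1 q hq).2.1
  · obtain ⟨W, hW, e', he'⟩ := (hr M x).1 ⟨e, he⟩
    obtain ⟨θ, hθ⟩ := h2 W hW
    obtain ⟨-, -, θ₁, θ₂, hθ₁, hθ₂, h⟩ := h1 _ hθ
    refine (realize_disj _ _ _).2 ⟨θ, List.mem_map.2 ⟨_, hθ, rfl⟩, ?_⟩
    simp only at h
    rw [h]
    exact (W.realize_pureCombine hθ₁.1.1 hθ₂.1.1 x).2 ((isCover_combine hconv₁ hconv₂ hsi₁ hsi₂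
      hei₁ hei₂ W (hterm W hW) hθ₁ hθ₂).realize he')
  · obtain ⟨θ, hθ, hx⟩ := (realize_disj _ _ _).1 hx
    obtain ⟨q, hq, rfl⟩ := List.mem_map.1 hθ
    obtain ⟨hqW, -, θ₁, θ₂, hθ₁, hθ₂, h⟩ := h1 _ hq
    rw [h] at hx
    obtain ⟨M', f, e, he⟩ := (isCover_combine hconv₁ hconv₂ hsi₁ hsi₂ hei₁ hei₂ q.1
      (hterm _ hqW) hθ₁ hθ₂).exists_extension (q.1.isQF_combine (hterm _ hqW).1.1.isQF
      (hterm _ hqW).2.1.isQF) M ((q.1.realize_pureCombine hθ₁.1.1 hθ₂.1.1 x).1 hx)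
    obtain ⟨e', he'⟩ := (hr M' (f ∘ x)).2 ⟨q.1, hqW, e, he⟩
    exact ⟨M', f, e', he'⟩
  · refine hc.bind ?_
    rw [codeFormula_disj, List.map_map]
    exact h3.map _

theorem IsUniversal.onBoundedFormula {L : FirstOrder.Language.{u, v}}
    {L' : FirstOrder.Language.{u₁, v₁}} (g : L →ᴸ L') {α : Type*} {k : ℕ}
    {φ : L.BoundedFormula α k} (h : φ.IsUniversal) : (g.onBoundedFormula φ).IsUniversal := by
  induction h with
  | of_isQF h => exact .of_isQF (isQF_onBoundedFormula g h)
  | all _ ih => exact .all ih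

theorem isUniversal_unionTheory (h₁ : T₁.IsUniversal) (h₂ : T₂.IsUniversal) :
    (unionTheory T₁ T₂).IsUniversal := by
  refine ⟨?_⟩
  rintro φ (hφ | hφ)
  · obtain ⟨ψ, hψ, rfl⟩ := LHom.mem_onTheory.1 hφ
    exact IsUniversal.onBoundedFormula _ (h₁.isUniversal_of_mem hψ)
  · obtain ⟨ψ, hψ, rfl⟩ := LHom.mem_onTheory.1 hφ
    exact IsUniversal.onBoundedFormula _ (h₂.isUniversal_of_mem hψ)

/-- Countability supplies some numbering, possibly not effective, on which the algorithms run for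
the existence statements. -/
theorem exists_symbolCoding (L : FirstOrder.Language.{u, v}) [Countable L.Symbols] :
    Nonempty (SymbolCoding L) := by
  have h1 : Countable (Σ l, L.Functions l) :=
    (Sum.inl_injective (α := Σ l, L.Functions l) (β := Σ l, L.Relations l)).countable
  have h2 : Countable (Σ l, L.Relations l) :=
    (Sum.inr_injective (α := Σ l, L.Functions l) (β := Σ l, L.Relations l)).countable
  obtain ⟨f, hf⟩ := exists_injective_nat (Σ l, L.Functions l)
  obtain ⟨g, hg⟩ := exists_injective_nat (Σ l, L.Relations l)
  exact ⟨⟨f, g, hf, hg⟩⟩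

theorem hasCovers_of_hasModelCompletion {L : FirstOrder.Language.{u, v}} {T : L.Theory}
    [T.IsUniversal] (h : HasModelCompletion T) : HasCovers T :=
  let ⟨_, h⟩ := h
  h.hasCovers

theorem splitOracle_cSplits {L : FirstOrder.Language.{u, v}} {c : SymbolCoding L} {T : L.Theory}
    [T.IsUniversal] (hmc : HasModelCompletion T) {Fc : ℕ → ℕ × ℕ × ℕ → Option ℕ}
    {Fb : ℕ → ℕ × ℕ × ℕ × ℕ → Option ℕ} (hFc : CoverOracle c T Fc) (hFb : BethOracle c T Fb) :
    SplitOracle.{u, v, w} c T fun s p => cSplits (Fc s) (Fb s) p.1 p.2.1 p.2.2 :=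
  fun _ _ _ hψ hψd => exists_conv_cSplits hmc hFc hFb hψ hψd

theorem primrec_fuel_cSplits {F : ℕ → ℕ × ℕ × ℕ → Option ℕ} {B : ℕ → ℕ × ℕ × ℕ × ℕ → Option ℕ}
    (hF : Primrec fun p : ℕ × ℕ × ℕ × ℕ => F p.1 p.2)
    (hB : Primrec fun p : ℕ × ℕ × ℕ × ℕ × ℕ => B p.1 p.2) {P : Type*} [Primcodable P] {s : P → ℕ}
    (hs : Primrec s) : Primrec fun p : P × ℕ × ℕ × ℕ =>
      cSplits (F (s p.1)) (B (s p.1)) p.2.1 p.2.2.1 p.2.2.2 :=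
  primrec_cSplits (hF.comp (g := fun q : (P × ℕ × ℕ × ℕ) × ℕ × ℕ × ℕ => (s q.1.1, q.2))
    (by fun_prop)) (hB.comp (g := fun q : (P × ℕ × ℕ × ℕ) × ℕ × ℕ × ℕ × ℕ => (s q.1.1, q.2))
    (by fun_prop)) (by fun_prop) (by fun_prop) (by fun_prop)

theorem hasComputableTerminalDecompositions (huniv₁ : T₁.IsUniversal) (huniv₂ : T₂.IsUniversal)
    (hmc₁ : HasModelCompletion T₁) (hmc₂ : HasModelCompletion T₂) {c₁ : SymbolCoding L₁}
    {c₂ : SymbolCoding L₂} (hc₁ : HasComputableCovers c₁ T₁) (hc₂ : HasComputableCovers c₂ T₂)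
    (hb₁ : HasComputableBethTerms c₁ T₁) (hb₂ : HasComputableBethTerms c₂ T₂) :
    HasComputableTerminalDecompositions c₁ c₂ T₁ T₂ := by
  obtain ⟨F₁, hF₁, hFp₁⟩ := hc₁.exists_oracle
  obtain ⟨F₂, hF₂, hFp₂⟩ := hc₂.exists_oracle
  obtain ⟨B₁, hB₁, hBp₁⟩ := hb₁.exists_oracle
  obtain ⟨B₂, hB₂, hBp₂⟩ := hb₂.exists_oracle
  obtain ⟨f, hf, hf'⟩ := exists_partrec_of_conv (A := fun s (p : ℕ × ℕ × ℕ) =>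
    (cDecompose (fun q => cSplits (F₁ s) (B₁ s) q.1 q.2.1 q.2.2)
      (fun q => cSplits (F₂ s) (B₂ s) q.1 q.2.1 q.2.2) p.1 p.2.2).map fun Ws => Encodable.encode
        (Ws.map fun W => Encodable.encode
          [W.1, W.2.1, Encodable.encode W.2.2.1, W.2.2.2.1, W.2.2.2.2])) (by
      have h1 := primrec_fuel_cSplits hFp₁ hBp₁ (P := ℕ × ℕ × ℕ × ℕ) (s := fun p => p.1)
        (by fun_prop)
      have h2 := primrec_fuel_cSplits hFp₂ hBp₂ (P := ℕ × ℕ × ℕ × ℕ) (s := fun p => p.1)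
        (by fun_prop)
      fun_prop)
  refine ⟨f, hf, fun n k φ hφ => ?_⟩
  obtain ⟨Ws, hWs, hc⟩ := exists_conv_cDecompose (splitOracle_cSplits hmc₁ hF₁ hB₁)
    (splitOracle_cSplits hmc₂ hF₂ hB₂) hφ.isQF
  refine ⟨Ws, hWs, hf' (n, k, codeFormula (c₁.sum c₂) φ) _ ?_⟩
  convert! hc.map _ using 1
  rw [List.map_map]
  rfl

theorem hasComputableCovers_unionTheory [Countable L₁.Symbols] [Countable L₂.Symbols]
    (huniv₁ : T₁.IsUniversal) (huniv₂ : T₂.IsUniversal)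
    (hconv₁ : IsConvex T₁) (hconv₂ : IsConvex T₂)
    (hsi₁ : IsStablyInfinite T₁) (hsi₂ : IsStablyInfinite T₂)
    (hei₁ : IsEqualityInterpolating T₁) (hei₂ : IsEqualityInterpolating T₂)
    (hmc₁ : HasModelCompletion T₁) (hmc₂ : HasModelCompletion T₂) {c₁ : SymbolCoding L₁}
    {c₂ : SymbolCoding L₂} (hc₁ : HasComputableCovers c₁ T₁) (hc₂ : HasComputableCovers c₂ T₂)
    (hb₁ : HasComputableBethTerms c₁ T₁) (hb₂ : HasComputableBethTerms c₂ T₂) :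
    HasComputableCovers (c₁.sum c₂) (unionTheory T₁ T₂) := by
  obtain ⟨F₁, hF₁, hFp₁⟩ := hc₁.exists_oracle
  obtain ⟨F₂, hF₂, hFp₂⟩ := hc₂.exists_oracle
  obtain ⟨B₁, hB₁, hBp₁⟩ := hb₁.exists_oracle
  obtain ⟨B₂, hB₂, hBp₂⟩ := hb₂.exists_oracle
  obtain ⟨f, hf, hf'⟩ := exists_partrec_of_conv (A := fun s (p : ℕ × ℕ × ℕ) =>
    cCover (F₁ s) (F₂ s) (fun q => cSplits (F₁ s) (B₁ s) q.1 q.2.1 q.2.2)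
      (fun q => cSplits (F₂ s) (B₂ s) q.1 q.2.1 q.2.2) p.1 p.2.2) (by
      have h1 := primrec_fuel_cSplits hFp₁ hBp₁ (P := ℕ × ℕ × ℕ × ℕ) (s := fun p => p.1)
        (by fun_prop)
      have h2 := primrec_fuel_cSplits hFp₂ hBp₂ (P := ℕ × ℕ × ℕ × ℕ) (s := fun p => p.1)
        (by fun_prop)
      have h3 : Primrec fun p : (ℕ × ℕ × ℕ × ℕ) × ℕ × ℕ × ℕ => F₁ p.1.1 p.2 :=
        hFp₁.comp (g := fun p : (ℕ × ℕ × ℕ × ℕ) × ℕ × ℕ × ℕ => (p.1.1, p.2)) (by fun_prop)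
      have h4 : Primrec fun p : (ℕ × ℕ × ℕ × ℕ) × ℕ × ℕ × ℕ => F₂ p.1.1 p.2 :=
        hFp₂.comp (g := fun p : (ℕ × ℕ × ℕ × ℕ) × ℕ × ℕ × ℕ => (p.1.1, p.2)) (by fun_prop)
      fun_prop)
  refine ⟨f, hf, fun n k φ hφ => ?_⟩
  obtain ⟨ψ, hψ, hc⟩ := exists_conv_cCover hconv₁ hconv₂ hsi₁ hsi₂ hei₁ hei₂ hF₁ hF₂
    (splitOracle_cSplits hmc₁ hF₁ hB₁) (splitOracle_cSplits hmc₂ hF₂ hB₂) hφ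
  exact ⟨ψ, hψ, hf' (n, k, codeFormula (c₁.sum c₂) φ) _ hc⟩

end Decomposition

end Covers

/-! ### The main theorem. -/

theorem mainTheorem1
    {L₁ : FirstOrder.Language.{u₁, v₁}} {L₂ : FirstOrder.Language.{u₂, v₂}}
    [Countable L₁.Symbols] [Countable L₂.Symbols]
    [Nonempty L₁.Constants] [Nonempty L₂.Constants]
    (T₁ : L₁.Theory) (T₂ : L₂.Theory)
    (huniv₁ : T₁.IsUniversal) (huniv₂ : T₂.IsUniversal)
    (hconv₁ : Covers.IsConvex T₁) (hconv₂ : Covers.IsConvex T₂)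
    (hsi₁ : Covers.IsStablyInfinite T₁) (hsi₂ : Covers.IsStablyInfinite T₂)
    (hei₁ : Covers.IsEqualityInterpolating T₁) (hei₂ : Covers.IsEqualityInterpolating T₂)
    (hmc₁ : Covers.HasModelCompletion T₁) (hmc₂ : Covers.HasModelCompletion T₂) :
    Covers.HasCovers (Covers.unionTheory T₁ T₂) ∧
    (∀ (n k : ℕ) (φ : (L₁.sum L₂).BoundedFormula (Fin n) k), Covers.IsConstraint φ →
      ∃ Ws : List (Covers.WorkingFormula L₁ L₂ n),
        Covers.IsTerminalDecomposition T₁ T₂ φ Ws) ∧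
    (∀ (n : ℕ) (W : Covers.WorkingFormula L₁ L₂ n), W.IsTerminal T₁ T₂ →
      ∀ (θ₁ : L₁.Formula (Fin W.m)) (θ₂ : L₂.Formula (Fin W.m)),
        Covers.IsCover T₁ W.ψ₁ θ₁ → Covers.IsCover T₂ W.ψ₂ θ₂ →
        Covers.IsCover (Covers.unionTheory T₁ T₂) W.matrix (W.combine θ₁ θ₂)) ∧
    ∃ Tstar : (L₁.sum L₂).Theory,
      Covers.IsModelCompletion (Covers.unionTheory T₁ T₂) Tstar ∧
      ∀ (c₁ : Covers.SymbolCoding L₁) (c₂ : Covers.SymbolCoding L₂),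
        Covers.HasComputableCovers c₁ T₁ → Covers.HasComputableCovers c₂ T₂ →
        Covers.HasComputableBethTerms c₁ T₁ → Covers.HasComputableBethTerms c₂ T₂ →
        Covers.HasComputableTerminalDecompositions c₁ c₂ T₁ T₂ ∧
        Covers.HasComputableCovers (c₁.sum c₂) (Covers.unionTheory T₁ T₂) ∧
        Covers.HasComputableQE (c₁.sum c₂) Tstar := by
  -- Arbitrary numberings and oracles by choice suffice for the non-effective claims.
  obtain ⟨d₁⟩ := Covers.exists_symbolCoding L₁
  obtain ⟨d₂⟩ := Covers.exists_symbolCoding L₂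
  obtain ⟨F₁, hF₁⟩ := (Covers.hasCovers_of_hasModelCompletion hmc₁).exists_oracle d₁
  obtain ⟨F₂, hF₂⟩ := (Covers.hasCovers_of_hasModelCompletion hmc₂).exists_oracle d₂
  obtain ⟨B₁, hB₁⟩ := hei₁.exists_oracle d₁
  obtain ⟨B₂, hB₂⟩ := hei₂.exists_oracle d₂
  have := Covers.isUniversal_unionTheory huniv₁ huniv₂
  have hcov : Covers.HasCovers (Covers.unionTheory T₁ T₂) := fun n k φ hφ =>
    let ⟨ψ, hψ, _⟩ := Covers.exists_conv_cCover hconv₁ hconv₂ hsi₁ hsi₂ hei₁ hei₂ hF₁ hF₂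
      (Covers.splitOracle_cSplits hmc₁ hF₁ hB₁) (Covers.splitOracle_cSplits hmc₂ hF₂ hB₂) hφ
    ⟨ψ, hψ⟩
  -- The model completion is given by the cover axioms and does not depend on a numbering, so one T*
  -- serves all codings in the effective part.
  refine ⟨hcov, fun n k φ hφ => ?_, fun n W hW θ₁ θ₂ h₁ h₂ =>
    Covers.isCover_combine hconv₁ hconv₂ hsi₁ hsi₂ hei₁ hei₂ W hW h₁ h₂,
    Covers.coverTheory _, Covers.isModelCompletion_coverTheory (d₁.sum d₂) hcov,
    fun c₁ c₂ hc₁ hc₂ hb₁ hb₂ => ?_⟩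
  · obtain ⟨Ws, hWs, -⟩ := Covers.exists_conv_cDecompose
      (Covers.splitOracle_cSplits hmc₁ hF₁ hB₁) (Covers.splitOracle_cSplits hmc₂ hF₂ hB₂) hφ.isQF
    exact ⟨Ws, hWs⟩
  · have hc := Covers.hasComputableCovers_unionTheory huniv₁ huniv₂ hconv₁ hconv₂ hsi₁ hsi₂
      hei₁ hei₂ hmc₁ hmc₂ hc₁ hc₂ hb₁ hb₂
    exact ⟨Covers.hasComputableTerminalDecompositions huniv₁ huniv₂ hmc₁ hmc₂ hc₁ hc₂ hb₁ hb₂,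
      hc, Covers.hasComputableQE_coverTheory hc⟩
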